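/- Let $p$ be a prime, let $X_0$ be the set of isomorphism classes of finite abelian $p$-groups (i.e. finite $\mathbb{Z}_p$-modules), and let $X_1$ be the set of isomorphism classes of finitely generated $\mathbb{Z}_p$-modules of rank $1$. Put $c_0=\prod_{j\ge 1}(1-p^{-j})$ and $\mu_0(G)=c_0/\#\mathrm{Aut}(G)$ for $G\in X_0$. Let $\mathbb{K}$ be $\mathbb{R}$ or $\mathbb{C}$, and let $L^2(X_0,\mu_0)^{*}$ be the Hilbert space of $\mathbb{K}$-valued measures $\nu$ on the discrete set $X_0$ with $\sum_G |\nu(G)|^2/\mu_0(G)<\infty$, with inner product $\langle \nu_1,\nu_2\rangle=\sum_{G}\overline{\nu_1(G)}\,\nu_2(G)/\mu_0(G)$. For $G\in X_0$ and $H\in X_1$, let $\mathbb{P}(G\xrightarrow{d^{*}}H)$ be the probability that the extension $0\to\mathbb{Z}_p\to E\to G\to 0$ corresponding to a uniformly random element of the finite set $\mathrm{Ext}(G,\mathbb{Z}_p)$ has $E\cong H$, and let $\mathbb{P}(H\xrightarrow{d}G)$ be the probability that $H/\mathbb{Z}_p h\cong G$ for a Haar random $h\in H$. Define $(d^{*}\nu)(H)=\sum_{G}\nu(G)\,\mathbb{P}(G\xrightarrow{d^{*}}H)$,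 $(d\eta)(G)=\sum_{H}\eta(H)\,\mathbb{P}(H\xrightarrow{d}G)$, and $\Delta_0=d\,d^{*}$. Then for $\nu\in L^2(X_0,\mu_0)^{*}$ the series defining $\Delta_0\nu=d(d^{*}\nu)$ converge absolutely; $\Delta_0$ and the multiplication operator $\nu\mapsto\big(G\mapsto|G|^{-1}\nu(G)\big)$ are bounded self-adjoint operators on $L^2(X_0,\mu_0)^{*}$; and they have the same spectrum, namely $\{p^{-n}: n=0,1,2,\dots\}\cup\{0\}$. -/

import Mathlib

noncomputable section

namespace CohenLenstra

/-! ### The sets `X₀` and `X₁` of isomorphism classes of modules -/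

/-- A finite `ℤ_p`-module, i.e. a finite abelian `p`-group. -/
structure FinMod (p : ℕ) [Fact p.Prime] where
  carrier : Type
  [addCommGroup : AddCommGroup carrier]
  [module : Module ℤ_[p] carrier]
  [finite : Finite carrier]

attribute [instance] FinMod.addCommGroup FinMod.module FinMod.finite

/-- A finitely generated `ℤ_p`-module of rank `1`. -/
structure RankOneMod (p : ℕ) [Fact p.Prime] where
  carrier : Type
  [addCommGroup : AddCommGroup carrier]
  [module : Module ℤ_[p] carrier]
  [fg : Module.Finite ℤ_[p] carrier]
  finrank_eq : Module.finrank ℤ_[p] carrier = 1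

attribute [instance] RankOneMod.addCommGroup RankOneMod.module RankOneMod.fg

/-- Isomorphism of finite `ℤ_p`-modules. -/
instance finModSetoid (p : ℕ) [Fact p.Prime] : Setoid (FinMod p) where
  r G G' := Nonempty (G.carrier ≃ₗ[ℤ_[p]] G'.carrier)
  iseqv :=
    { refl := fun _ => ⟨LinearEquiv.refl _ _⟩
      symm := fun ⟨e⟩ => ⟨e.symm⟩
      trans := fun ⟨e⟩ ⟨f⟩ => ⟨e.trans f⟩ }

/-- Isomorphism of finitely generated `ℤ_p`-modules of rank `1`. -/
instance rankOneModSetoid (p : ℕ) [Fact p.Prime] : Setoid (RankOneMod p) where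
  r H H' := Nonempty (H.carrier ≃ₗ[ℤ_[p]] H'.carrier)
  iseqv :=
    { refl := fun _ => ⟨LinearEquiv.refl _ _⟩
      symm := fun ⟨e⟩ => ⟨e.symm⟩
      trans := fun ⟨e⟩ ⟨f⟩ => ⟨e.trans f⟩ }

/-- `X₀`: the set of isomorphism classes of finite abelian `p`-groups. -/
def X₀ (p : ℕ) [Fact p.Prime] : Type 1 := Quotient (finModSetoid p)

/-- `X₁`: the set of isomorphism classes of finitely generated `ℤ_p`-modules of rank `1`. -/
def X₁ (p : ℕ) [Fact p.Prime] : Type 1 := Quotient (rankOneModSetoid p)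

/-- A module in the isomorphism class `G`. -/
abbrev X₀.rep {p : ℕ} [Fact p.Prime] (G : X₀ p) : FinMod p := Quotient.out G

/-- A module in the isomorphism class `H`. -/
abbrev X₁.rep {p : ℕ} [Fact p.Prime] (H : X₁ p) : RankOneMod p := Quotient.out H

/-- `#G`. -/
def X₀.card {p : ℕ} [Fact p.Prime] (G : X₀ p) : ℕ := Nat.card G.rep.carrier

/-- `#Aut(G)`. -/
def X₀.cardAut {p : ℕ} [Fact p.Prime] (G : X₀ p) : ℕ :=
  Nat.card (G.rep.carrier ≃ₗ[ℤ_[p]] G.rep.carrier)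

/-! ### The Cohen-Lenstra measure and the Hilbert space `L²(X₀, μ₀)*` -/

/-- `c₀ = ∏_{j ≥ 1} (1 - p^{-j})`. -/
def c₀ (p : ℕ) : ℝ := ∏' j : ℕ, (1 - 1 / (p : ℝ) ^ (j + 1))

/-- The Cohen-Lenstra measure `μ₀(G) = c₀ / #Aut(G)`, given by its point masses. -/
def μ₀ {p : ℕ} [Fact p.Prime] (G : X₀ p) : ℝ := c₀ p / (G.cardAut : ℝ)

instance (p : ℕ) [Fact p.Prime] : MeasurableSpace (X₀ p) := ⊤

/-- The weight on `X₀` giving each point `G` the mass `1 / μ₀(G)`. -/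
def invWeight (p : ℕ) [Fact p.Prime] : MeasureTheory.Measure (X₀ p) :=
  MeasureTheory.Measure.sum fun G => ENNReal.ofReal (1 / μ₀ G) • MeasureTheory.Measure.dirac G

/-- `L²(X₀, μ₀)*`: the Hilbert space of (signed or complex) measures `ν` on the discrete set `X₀`,
given by their point masses `ν G`, with `∑_G |ν(G)|² / μ₀(G) < ∞`; the inner product is
`⟪ν₁, ν₂⟫ = ∑_G conj(ν₁(G)) ν₂(G) / μ₀(G)`.  Every point has positive mass for `invWeight`, so that
almost everywhere equal functions are equal. -/
abbrev L2Star (p : ℕ) [Fact p.Prime] (𝕜 : Type) [RCLike 𝕜] :=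
  MeasureTheory.Lp 𝕜 2 (invWeight p)

/-! ### The random operator `d*`: a uniformly random extension -/

/-- An extension `0 → ℤ_p → H → G → 0` of `ℤ_p`-modules. -/
structure Extn {p : ℕ} [Fact p.Prime] (G : FinMod p) where
  mid : Type
  [addCommGroup : AddCommGroup mid]
  [module : Module ℤ_[p] mid]
  inl : ℤ_[p] →ₗ[ℤ_[p]] mid
  proj : mid →ₗ[ℤ_[p]] G.carrier
  inl_injective : Function.Injective inl
  exact : Function.Exact inl proj
  proj_surjective : Function.Surjective proj

attribute [instance] Extn.addCommGroup Extn.module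

/-- Equivalence of extensions: an isomorphism of the middle modules that induces the identity on
`ℤ_p` and on `G`. -/
instance extnSetoid {p : ℕ} [Fact p.Prime] (G : FinMod p) : Setoid (Extn G) where
  r E E' := ∃ e : E.mid ≃ₗ[ℤ_[p]] E'.mid,
    (∀ x, e (E.inl x) = E'.inl x) ∧ ∀ y, E'.proj (e y) = E.proj y
  iseqv :=
    { refl := fun _ => ⟨LinearEquiv.refl _ _, fun _ => rfl, fun _ => rfl⟩
      symm := by
        rintro E E' ⟨e, h₁, h₂⟩
        refine ⟨e.symm, fun x => ?_, fun y => ?_⟩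
        · rw [← h₁ x, e.symm_apply_apply]
        · rw [← h₂, e.apply_symm_apply]
      trans := by
        rintro E E' E'' ⟨e, h₁, h₂⟩ ⟨f, k₁, k₂⟩
        refine ⟨e.trans f, fun x => ?_, fun y => ?_⟩
        · rw [LinearEquiv.trans_apply, h₁, k₁]
        · rw [LinearEquiv.trans_apply, k₂, h₂] }

/-- `Ext(G, ℤ_p)`, as the set of equivalence classes of extensions of `G` by `ℤ_p`. -/
def ExtZp {p : ℕ} [Fact p.Prime] (G : FinMod p) : Type 1 := Quotient (extnSetoid G)

theorem Extn.finite_mid {p : ℕ} [Fact p.Prime] {G : FinMod p} (E : Extn G) :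
    Module.Finite ℤ_[p] E.mid := by
  have hk : LinearMap.ker E.proj = LinearMap.range E.inl := LinearMap.exact_iff.1 E.exact
  have : Module.Finite ℤ_[p] (LinearMap.ker E.proj) := by
    rw [hk]; exact Module.Finite.range _
  have : Module.Finite ℤ_[p] (E.mid ⧸ LinearMap.ker E.proj) :=
    Module.Finite.equiv (E.proj.quotKerEquivOfSurjective E.proj_surjective).symm
  exact Module.Finite.of_submodule_quotient (LinearMap.ker E.proj)

theorem finrank_eq_zero_of_finite {p : ℕ} [Fact p.Prime] (A : Type) [AddCommGroup A]
    [Module ℤ_[p] A] [Finite A] : Module.finrank ℤ_[p] A = 0 := by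
  rw [Module.finrank_eq_zero_iff]
  intro x
  refine ⟨(Nat.card A : ℤ_[p]), ?_, ?_⟩
  · exact_mod_cast (Nat.card_pos (α := A)).ne'
  · rw [Nat.cast_smul_eq_nsmul]
    exact card_nsmul_eq_zero'

theorem Extn.finrank_mid {p : ℕ} [Fact p.Prime] {G : FinMod p} (E : Extn G) :
    Module.finrank ℤ_[p] E.mid = 1 := by
  have := E.finite_mid
  have hk : LinearMap.ker E.proj = LinearMap.range E.inl := LinearMap.exact_iff.1 E.exact
  have h := (LinearMap.ker E.proj).finrank_quotient_add_finrank
  rw [(E.proj.quotKerEquivOfSurjective E.proj_surjective).finrank_eq,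
    finrank_eq_zero_of_finite, zero_add, hk,
    LinearMap.finrank_range_of_inj E.inl_injective, Module.finrank_self] at h
  exact h.symm

/-- The middle module `H` of an extension `0 → ℤ_p → H → G → 0`. -/
def Extn.toRankOneMod {p : ℕ} [Fact p.Prime] {G : FinMod p} (E : Extn G) : RankOneMod p :=
  { carrier := E.mid, fg := E.finite_mid, finrank_eq := E.finrank_mid }

/-- The isomorphism class of the middle module of a class of extensions. -/
def ExtZp.middle {p : ℕ} [Fact p.Prime] {G : FinMod p} : ExtZp G → X₁ p :=
  Quotient.lift (fun E => (Quotient.mk _ E.toRankOneMod : X₁ p))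
    fun _ _ ⟨e, _⟩ => Quotient.sound ⟨e⟩

/-- `ℙ(G --d*--> H)`: the probability that the extension corresponding to a uniformly random
element of the finite set `Ext(G, ℤ_p)` is isomorphic to `H`. -/
def dStarProb {p : ℕ} [Fact p.Prime] (G : X₀ p) (H : X₁ p) : ℝ :=
  (Nat.card {ξ : ExtZp G.rep // ξ.middle = H} : ℝ) / (Nat.card (ExtZp G.rep) : ℝ)

/-! ### The random operator `d`: the quotient by a Haar random element -/

theorem compactSpace_moduleTopology {p : ℕ} [Fact p.Prime] (A : Type) [AddCommGroup A]
    [Module ℤ_[p] A] [Module.Finite ℤ_[p] A] [TopologicalSpace A] [IsModuleTopology ℤ_[p] A] :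
    CompactSpace A := by
  have := IsModuleTopology.topologicalAddGroup ℤ_[p] A
  obtain ⟨n, f, hf⟩ := Module.Finite.exists_fin' ℤ_[p] A
  have hc : Continuous f := IsModuleTopology.continuous_of_linearMap f
  exact hf.compactSpace hc

/-- The Haar probability of a subset `s` of a finitely generated `ℤ_p`-module `A`, which is a
compact group for its canonical topology. -/
def haarProb {p : ℕ} [Fact p.Prime] (A : Type) [AddCommGroup A] [Module ℤ_[p] A]
    [Module.Finite ℤ_[p] A] (s : Set A) : ℝ :=
  letI : TopologicalSpace A := moduleTopology ℤ_[p] A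
  haveI : IsModuleTopology ℤ_[p] A := ⟨rfl⟩
  haveI : IsTopologicalAddGroup A := IsModuleTopology.topologicalAddGroup ℤ_[p] A
  haveI : CompactSpace A := compactSpace_moduleTopology (p := p) A
  letI : MeasurableSpace A := borel A
  haveI : BorelSpace A := ⟨rfl⟩
  (MeasureTheory.Measure.addHaarMeasure (⊤ : TopologicalSpace.PositiveCompacts A)).real s

/-- `ℙ(H --d--> G)`: the probability that the quotient of `H` by (the submodule generated by) a
Haar random element of `H` is isomorphic to `G`. -/
def dProb {p : ℕ} [Fact p.Prime] (H : X₁ p) (G : X₀ p) : ℝ :=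
  haarProb (p := p) H.rep.carrier
    {h | Nonempty ((H.rep.carrier ⧸ Submodule.span ℤ_[p] {h}) ≃ₗ[ℤ_[p]] G.rep.carrier)}

/-! ### The linear operators on measures -/

/-- `d*` on measures: `(d* ν)(H) = ∑_G ν(G) ℙ(G --d*--> H)`. -/
def dStar {p : ℕ} [Fact p.Prime] {𝕜 : Type} [RCLike 𝕜] (ν : X₀ p → 𝕜) (H : X₁ p) : 𝕜 :=
  ∑' G, ν G * (dStarProb G H : 𝕜)

/-- `d` on measures: `(d η)(G) = ∑_H η(H) ℙ(H --d--> G)`. -/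
def d {p : ℕ} [Fact p.Prime] {𝕜 : Type} [RCLike 𝕜] (η : X₁ p → 𝕜) (G : X₀ p) : 𝕜 :=
  ∑' H, η H * (dProb H G : 𝕜)

/-- The Cohen-Lenstra operator `Δ₀ = d d*` on measures on `X₀`. -/
def Δ₀ {p : ℕ} [Fact p.Prime] {𝕜 : Type} [RCLike 𝕜] (ν : X₀ p → 𝕜) : X₀ p → 𝕜 := d (dStar ν)

end CohenLenstra

end

noncomputable section

namespace CohenLenstra

open Module

variable {p : ℕ} [Fact p.Prime]

/-! ### Finite `ℤ_p`-modules -/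

/-! Detailed balance makes `Δ₀` the product of an operator and its adjoint, and moments make it
triangular.

A surjection `ℤ_p × A → G` with cyclic kernel amounts to a character `χ` of `G`, an isomorphism of
`A` with `ker χ`, and a lift to `G` of a generator of the image of `χ`. Characters also classify the
extensions of `G` by `ℤ_p`, the middle module being `ℤ_p × ker χ`. Counting these surjections in two
ways yields positive weights `μ₁` on `X₁` with `μ₀ G * dStarProb G H = μ₁ H * dProb H G`
(`exists_reversible`). Hence `d` is the adjoint of `d*` for the weights `μ₀` and `μ₁`; by
Cauchy-Schwarz `d*` is a contraction, and `Δ₀` is bounded and self-adjoint (`IsKernel.sqOp`).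

For `B` in `X₀` let `m_B` be the measure `#Sur(·, B) μ₀`. The quotient of `H` by a Haar random
element has on average `#Sur(H, B) / |B|` surjections to `B`, and a random extension of `G` has on
average `∑_b #Sur(G, B/⟨b⟩)` of them. Reversibility turns this into `Δ₀ m_B = |B|⁻¹ ∑_b m_{B/⟨b⟩}`
(`sqOp_momentMeasure`). The term `b = 0` is `|B|⁻¹ m_B` and the others belong to smaller groups, so
`Δ₀` is triangular with diagonal entries `|B|⁻¹ = p⁻ⁿ`. As distinct levels have distinct entries, it
can be diagonalised on the span of the `m_B`; if that span is dense, self-adjointness forces the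
spectrum to be the closure of the set of these entries (`spectrum_eq_of_triangular`). The same lemma
applied to the point masses treats multiplication by `|G|⁻¹`.

The analytic core is this density: a square integrable `ν` whose moments all vanish is zero
(`eq_zero_of_moments_eq_zero`). For a polynomial `P`, the sum of `P(p^rank(ker f))` over the
surjections `f : G → A` is a finite combination of moments of `G`. Take `P(1) = 1` and `P = 0` at
`p, …, p^R`. As `R → ∞` only the isomorphisms `f` survive, which isolates `ν A`. The limit may be
taken under the sum because `|P(p^d)| ≤ c₀⁻¹ p^(d(d-1)/2)` uniformly in `R`, and the resulting
majorant is square summable against `1/#Aut`: the groups `G` of rank `n` with given `pG` contribute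
a factor `p^(-n²)`, which beats the square `p^(n²-n)`. -/

theorem natCast_smul_eq_zero_of_finite (M : Type*) [AddCommGroup M] [Module ℤ_[p] M] [Finite M]
    (x : M) : ((Nat.card M : ℕ) : ℤ_[p]) • x = 0 := by
  rw [Nat.cast_smul_eq_nsmul]; exact card_nsmul_eq_zero'

/-- The part of `#M` prime to `p` is a unit of `ℤ_p`, so a power of `p` already kills `M`. -/
theorem exists_card_eq_pow (p : ℕ) [Fact p.Prime] (M : Type*) [AddCommGroup M] [Module ℤ_[p] M]
    [Finite M] : ∃ k, Nat.card M = p ^ k := by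
  have hp : p.Prime := Fact.out
  obtain ⟨k, m, hm, hk⟩ := Nat.exists_eq_pow_mul_and_not_dvd (Nat.card_pos (α := M)).ne' p hp.ne_one
  have hu : IsUnit ((m : ℕ) : ℤ_[p]) := by
    by_contra h
    rw [PadicInt.not_isUnit_iff, PadicInt.norm_lt_one_iff_dvd] at h
    have := (PadicInt.pow_p_dvd_int_iff (p := p) 1 (m : ℤ)).1 (by simpa using h)
    rw [pow_one] at this
    exact hm (by exact_mod_cast this)
  have hG : IsPGroup p (Multiplicative M) := by
    intro x
    refine ⟨k, ?_⟩
    have h := natCast_smul_eq_zero_of_finite (p := p) M x.toAdd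
    rw [hk, Nat.cast_mul, mul_comm, mul_smul] at h
    have h2 := (hu.smul_eq_zero).1 h
    rw [Nat.cast_smul_eq_nsmul] at h2
    exact h2
  obtain ⟨n, hn⟩ := IsPGroup.iff_card.1 hG
  exact ⟨n, hn⟩

theorem pow_smul_eq_zero_of_card {M : Type*} [AddCommGroup M] [Module ℤ_[p] M] [Finite M] {k n : ℕ}
    (h : Nat.card M = p ^ k) (hkn : k ≤ n) (x : M) : ((p : ℤ_[p]) ^ n) • x = 0 := by
  have := natCast_smul_eq_zero_of_finite (p := p) M x
  rw [h, Nat.cast_pow] at this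
  obtain ⟨m, rfl⟩ := Nat.exists_eq_add_of_le hkn
  rw [pow_add, mul_comm, mul_smul, this, smul_zero]

theorem card_ker_eq_card_quotient_range {A : Type*} [Ring A] {M : Type*} [AddCommGroup M]
    [Module A M] [Finite M] (f : M →ₗ[A] M) :
    Nat.card (LinearMap.ker f) = Nat.card (M ⧸ LinearMap.range f) := by
  have h1 := (LinearMap.ker f).card_eq_card_quotient_mul_card
  have h2 := (LinearMap.range f).card_eq_card_quotient_mul_card
  rw [Nat.card_congr f.quotKerEquivRange.toEquiv, h2, mul_comm] at h1
  exact (Nat.eq_of_mul_eq_mul_right (Nat.card_pos) h1).symm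

/-! ### Isomorphism classes -/

/-- The class of a finite `ℤ_p`-module. -/
def cls (p : ℕ) [Fact p.Prime] (M : Type) [AddCommGroup M] [Module ℤ_[p] M] [Finite M] : X₀ p :=
  Quotient.mk _ ⟨M⟩

theorem nonempty_rep_cls (M : Type) [AddCommGroup M] [Module ℤ_[p] M] [Finite M] :
    Nonempty ((cls p M).rep.carrier ≃ₗ[ℤ_[p]] M) :=
  Quotient.exact (Quotient.out_eq (cls p M))

theorem cls_eq_iff (M : Type) [AddCommGroup M] [Module ℤ_[p] M] [Finite M] (G : X₀ p) :
    cls p M = G ↔ Nonempty (M ≃ₗ[ℤ_[p]] G.rep.carrier) := by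
  constructor
  · rintro rfl
    exact ⟨(nonempty_rep_cls M).some.symm⟩
  · rintro ⟨e⟩
    rw [← Quotient.out_eq G]
    exact Quotient.sound ⟨e⟩

theorem cls_rep (G : X₀ p) : cls p G.rep.carrier = G :=
  (cls_eq_iff _ _).2 ⟨LinearEquiv.refl _ _⟩

theorem card_cls (M : Type) [AddCommGroup M] [Module ℤ_[p] M] [Finite M] :
    (cls p M).card = Nat.card M :=
  Nat.card_congr (nonempty_rep_cls M).some.toEquiv

/-! ### Counting homomorphisms and surjections -/

/-- The number of surjective homomorphisms. -/
def surCard (p : ℕ) [Fact p.Prime] (Q G : Type*) [AddCommGroup Q] [Module ℤ_[p] Q]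
    [AddCommGroup G] [Module ℤ_[p] G] : ℕ :=
  Nat.card {f : Q →ₗ[ℤ_[p]] G // Function.Surjective f}

theorem surCard_congr {Q Q' G G' : Type*} [AddCommGroup Q] [Module ℤ_[p] Q]
    [AddCommGroup G] [Module ℤ_[p] G] [AddCommGroup Q'] [Module ℤ_[p] Q']
    [AddCommGroup G'] [Module ℤ_[p] G'] (e : Q ≃ₗ[ℤ_[p]] Q') (e' : G ≃ₗ[ℤ_[p]] G') :
    surCard p Q G = surCard p Q' G' := by
  refine Nat.card_congr ((e.arrowCongr e').toEquiv.subtypeEquiv fun f => ?_)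
  simp [LinearEquiv.arrowCongr]

theorem homCard_congr {Q Q' G G' : Type*} [AddCommGroup Q] [Module ℤ_[p] Q]
    [AddCommGroup G] [Module ℤ_[p] G] [AddCommGroup Q'] [Module ℤ_[p] Q']
    [AddCommGroup G'] [Module ℤ_[p] G'] (e : Q ≃ₗ[ℤ_[p]] Q') (e' : G ≃ₗ[ℤ_[p]] G') :
    Nat.card (Q →ₗ[ℤ_[p]] G) = Nat.card (Q' →ₗ[ℤ_[p]] G') :=
  Nat.card_congr (e.arrowCongr e').toEquiv

instance finite_linearMap (Q G : Type*) [AddCommGroup Q] [Module ℤ_[p] Q] [Module.Finite ℤ_[p] Q]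
    [AddCommGroup G] [Module ℤ_[p] G] [Finite G] : Finite (Q →ₗ[ℤ_[p]] G) := by
  obtain ⟨n, s, hs⟩ := Module.Finite.exists_fin (R := ℤ_[p]) (M := Q)
  refine Finite.of_injective (fun f : Q →ₗ[ℤ_[p]] G => fun i => f (s i)) fun f g h => ?_
  refine LinearMap.ext_on_range (v := s) hs fun i => congrFun h i

instance finite_linearEquiv (Q G : Type*) [AddCommGroup Q] [Module ℤ_[p] Q] [Module.Finite ℤ_[p] Q]
    [AddCommGroup G] [Module ℤ_[p] G] [Finite G] : Finite (Q ≃ₗ[ℤ_[p]] G) :=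
  Finite.of_injective (fun e : Q ≃ₗ[ℤ_[p]] G => (e : Q →ₗ[ℤ_[p]] G)) LinearEquiv.toLinearMap_injective

theorem surCard_le_homCard (Q G : Type*) [AddCommGroup Q] [Module ℤ_[p] Q] [Module.Finite ℤ_[p] Q]
    [AddCommGroup G] [Module ℤ_[p] G] [Finite G] :
    surCard p Q G ≤ Nat.card (Q →ₗ[ℤ_[p]] G) :=
  Nat.card_le_card_of_injective _ Subtype.val_injective

/-- Surjections `Q → G` are the kernels with quotient `G`, up to automorphisms of `G`. -/
theorem card_surjective_ker (Q G : Type*) [AddCommGroup Q] [Module ℤ_[p] Q]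
    [AddCommGroup G] [Module ℤ_[p] G] (P : Submodule ℤ_[p] Q → Prop) :
    Nat.card {f : Q →ₗ[ℤ_[p]] G // Function.Surjective f ∧ P (LinearMap.ker f)} =
      Nat.card {K : Submodule ℤ_[p] Q // Nonempty ((Q ⧸ K) ≃ₗ[ℤ_[p]] G) ∧ P K} *
        Nat.card (G ≃ₗ[ℤ_[p]] G) := by
  rw [← Nat.card_prod]
  -- A chosen isomorphism `Q ⧸ K ≃ G` trivialises the `Aut G`-torsor of surjections with kernel `K`.
  let F : {K : Submodule ℤ_[p] Q // Nonempty ((Q ⧸ K) ≃ₗ[ℤ_[p]] G) ∧ P K} × (G ≃ₗ[ℤ_[p]] G) →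
      {f : Q →ₗ[ℤ_[p]] G // Function.Surjective f ∧ P (LinearMap.ker f)} := fun x =>
    ⟨(x.1.2.1.some.trans x.2).toLinearMap ∘ₗ x.1.1.mkQ, by
      refine ⟨?_, ?_⟩
      · rw [LinearMap.coe_comp]
        exact (LinearEquiv.surjective _).comp (Submodule.mkQ_surjective _)
      · rw [LinearEquiv.ker_comp, Submodule.ker_mkQ]
        exact x.1.2.2⟩
  refine (Nat.card_congr (Equiv.ofBijective F ⟨?_, ?_⟩)).symm
  · rintro ⟨⟨K, hK, hP⟩, α⟩ ⟨⟨K', hK', hP'⟩, β⟩ h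
    have h1 : (hK.some.trans α).toLinearMap ∘ₗ K.mkQ = (hK'.some.trans β).toLinearMap ∘ₗ K'.mkQ :=
      congrArg Subtype.val h
    have hKK : K = K' := by
      have := congrArg LinearMap.ker h1
      rwa [LinearEquiv.ker_comp, Submodule.ker_mkQ, LinearEquiv.ker_comp, Submodule.ker_mkQ] at this
    subst hKK
    congr 1
    ext g
    obtain ⟨x, hx⟩ := K.mkQ_surjective (hK.some.symm g)
    have h2 := LinearMap.congr_fun h1 x
    simp only [LinearMap.comp_apply, hx] at h2
    simpa using h2
  · rintro ⟨f, hf, hP⟩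
    have hn : Nonempty ((Q ⧸ LinearMap.ker f) ≃ₗ[ℤ_[p]] G) := ⟨f.quotKerEquivOfSurjective hf⟩
    refine ⟨⟨⟨LinearMap.ker f, hn, hP⟩, hn.some.symm.trans (f.quotKerEquivOfSurjective hf)⟩, ?_⟩
    apply Subtype.ext
    ext x
    simp [F]

theorem surCard_eq (Q G : Type*) [AddCommGroup Q] [Module ℤ_[p] Q]
    [AddCommGroup G] [Module ℤ_[p] G] :
    surCard p Q G = Nat.card {K : Submodule ℤ_[p] Q // Nonempty ((Q ⧸ K) ≃ₗ[ℤ_[p]] G)} *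
        Nat.card (G ≃ₗ[ℤ_[p]] G) := by
  have := card_surjective_ker (p := p) Q G (fun _ => True)
  simpa [surCard] using this

end CohenLenstra
end
noncomputable section

namespace CohenLenstra

open Module

variable {p : ℕ} [Fact p.Prime]

instance finite_quotient {A W : Type*} [Ring A] [AddCommGroup W] [Module A W] [Finite W]
    (K : Submodule A W) : Finite (W ⧸ K) :=
  Finite.of_surjective _ K.mkQ_surjective

/-! ### Duality for finite `ℤ_p`-modules -/

/-- The cyclic module `ℤ_p / p^k`. -/
abbrev Cyc (p : ℕ) [Fact p.Prime] (k : ℕ) : Type := ℤ_[p] ⧸ Ideal.span {(p : ℤ_[p]) ^ k}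

theorem card_Cyc (k : ℕ) : Nat.card (Cyc p k) = p ^ k := by
  have e := RingHom.quotientKerEquivOfSurjective
    (f := (PadicInt.toZModPow k : ℤ_[p] →+* ZMod (p ^ k))) (ZMod.ringHom_surjective _)
  rw [Nat.card_congr ((Ideal.quotEquivOfEq (PadicInt.ker_toZModPow (p := p) k).symm).trans e).toEquiv,
    Nat.card_zmod]

instance finite_Cyc (k : ℕ) : Finite (Cyc p k) :=
  Nat.finite_of_card_ne_zero (by
    rw [card_Cyc]; exact pow_ne_zero _ (Fact.out : p.Prime).ne_zero)

theorem mk_eq_zero_iff {k : ℕ} {z : ℤ_[p]} :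
    (Ideal.Quotient.mk (Ideal.span {(p : ℤ_[p]) ^ k}) z : Cyc p k) = 0 ↔ (p : ℤ_[p]) ^ k ∣ z := by
  rw [Ideal.Quotient.eq_zero_iff_mem, Ideal.mem_span_singleton]

theorem smul_mk {k : ℕ} (a z : ℤ_[p]) :
    a • (Ideal.Quotient.mk (Ideal.span {(p : ℤ_[p]) ^ k}) z : Cyc p k) =
      Ideal.Quotient.mk _ (a * z) := rfl

theorem padic_p_ne_zero : (p : ℤ_[p]) ≠ 0 := by
  exact_mod_cast (Fact.out : p.Prime).ne_zero

theorem padic_pow_ne_zero (k : ℕ) : (p : ℤ_[p]) ^ k ≠ 0 := pow_ne_zero _ padic_p_ne_zero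

theorem pow_smul_Cyc {k n : ℕ} (h : k ≤ n) (x : Cyc p k) : (p : ℤ_[p]) ^ n • x = 0 := by
  obtain ⟨z, rfl⟩ := Ideal.Quotient.mk_surjective x
  rw [smul_mk, mk_eq_zero_iff]
  exact (pow_dvd_pow _ h).mul_right _

/-- The elements of `ℤ_p / p^N` killed by `p^e` are the multiples of `p^(N-e)`. -/
theorem Cyc_pow_smul_eq_zero_iff {N e : ℕ} (h : e ≤ N) (x : Cyc p N) :
    (p : ℤ_[p]) ^ e • x = 0 ↔ ∃ z : ℤ_[p], x = Ideal.Quotient.mk _ ((p : ℤ_[p]) ^ (N - e) * z) := by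
  constructor
  · obtain ⟨z, rfl⟩ := Ideal.Quotient.mk_surjective x
    rw [smul_mk, mk_eq_zero_iff]
    intro hd
    have h2 : (p : ℤ_[p]) ^ N = p ^ e * p ^ (N - e) := by rw [← pow_add]; congr 1; omega
    rw [h2] at hd
    obtain ⟨y, rfl⟩ := (mul_dvd_mul_iff_left (padic_pow_ne_zero e)).1 hd
    exact ⟨y, rfl⟩
  · rintro ⟨z, rfl⟩
    rw [smul_mk, mk_eq_zero_iff, ← mul_assoc, ← pow_add]
    exact (pow_dvd_pow _ (by omega)).mul_right _

theorem card_Cyc_torsion {N e : ℕ} (h : e ≤ N) :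
    Nat.card {x : Cyc p N // (p : ℤ_[p]) ^ e • x = 0} = p ^ e := by
  let f : ℤ_[p] →ₗ[ℤ_[p]] Cyc p N := LinearMap.toSpanSingleton ℤ_[p] (Cyc p N)
    (Ideal.Quotient.mk _ ((p : ℤ_[p]) ^ (N - e)))
  have hf : ∀ z, f z = Ideal.Quotient.mk _ ((p : ℤ_[p]) ^ (N - e) * z) := fun z => by
    rw [LinearMap.toSpanSingleton_apply, smul_mk, mul_comm]
  have hker : LinearMap.ker f = Ideal.span {(p : ℤ_[p]) ^ e} := by
    ext z
    rw [LinearMap.mem_ker, hf, mk_eq_zero_iff, Ideal.mem_span_singleton]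
    have h2 : (p : ℤ_[p]) ^ N = p ^ (N - e) * p ^ e := by rw [← pow_add]; congr 1; omega
    rw [h2]
    exact mul_dvd_mul_iff_left (padic_pow_ne_zero _)
  have e1 := f.quotKerEquivRange
  rw [hker] at e1
  rw [← card_Cyc (p := p) e, Nat.card_congr e1.toEquiv]
  refine Nat.card_congr (Equiv.subtypeEquivRight fun x => ?_)
  rw [Cyc_pow_smul_eq_zero_iff h, LinearMap.mem_range]
  constructor
  · rintro ⟨z, rfl⟩; exact ⟨z, hf z⟩
  · rintro ⟨z, rfl⟩; exact ⟨z, hf z⟩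

theorem homCard_Cyc {N e : ℕ} (h : e ≤ N) :
    Nat.card (Cyc p e →ₗ[ℤ_[p]] Cyc p N) = p ^ e := by
  rw [← card_Cyc_torsion (p := p) h]
  let F : (Cyc p e →ₗ[ℤ_[p]] Cyc p N) → {x : Cyc p N // (p : ℤ_[p]) ^ e • x = 0} := fun f =>
    ⟨f (Ideal.Quotient.mk _ 1), by rw [← map_smul, pow_smul_Cyc le_rfl, map_zero]⟩
  refine Nat.card_congr (Equiv.ofBijective F ⟨fun f g hfg => ?_, fun ⟨x, hx⟩ => ?_⟩)
  · have h1 : f (Ideal.Quotient.mk _ 1) = g (Ideal.Quotient.mk _ 1) := congrArg Subtype.val hfg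
    ext
    simpa using h1
  · refine ⟨Submodule.liftQSpanSingleton ((p : ℤ_[p]) ^ e)
      (LinearMap.toSpanSingleton ℤ_[p] (Cyc p N) x) (by simpa using hx), Subtype.ext ?_⟩
    change LinearMap.toSpanSingleton ℤ_[p] (Cyc p N) x 1 = x
    simp

/-- A finite `ℤ_p`-module killed by `p^N` has as many characters with values in `ℤ_p / p^N` as it
has elements. -/
theorem homCard_Cyc_eq_card {N : ℕ} (W : Type) [AddCommGroup W] [Module ℤ_[p] W] [Finite W]
    (hW : ∀ x : W, (p : ℤ_[p]) ^ N • x = 0) :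
    Nat.card (W →ₗ[ℤ_[p]] Cyc p N) = Nat.card W := by
  classical
  -- The structure theorem reduces the count to cyclic modules `ℤ_p / p^e` with `e ≤ N`.
  have htor : Module.IsTorsion' W (Submonoid.powers (p : ℤ_[p])) := fun x =>
    ⟨⟨(p : ℤ_[p]) ^ N, N, rfl⟩, hW x⟩
  obtain ⟨d, k, ⟨e⟩⟩ := Module.torsion_by_prime_power_decomposition PadicInt.irreducible_p htor
  have hk : ∀ i, k i ≤ N := by
    intro i
    have h1 := hW (e.symm (DirectSum.lof ℤ_[p] (Fin d) (fun i => Cyc p (k i)) i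
      (Ideal.Quotient.mk _ 1)))
    rw [← map_smul, ← map_smul, LinearEquiv.map_eq_zero_iff] at h1
    have h2 := congrArg (DirectSum.component ℤ_[p] (Fin d) (fun i => Cyc p (k i)) i) h1
    rw [DirectSum.component.lof_self, map_zero, smul_mk, mk_eq_zero_iff, mul_one] at h2
    exact (pow_dvd_pow_iff padic_p_ne_zero PadicInt.irreducible_p.not_isUnit).1 h2
  have e2 : W ≃ₗ[ℤ_[p]] ((i : Fin d) → Cyc p (k i)) :=
    e.trans (DirectSum.linearEquivFunOnFintype ℤ_[p] (Fin d) (fun i => Cyc p (k i)))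
  have e3 := (LinearMap.lsum ℤ_[p] (fun i => Cyc p (k i)) ℤ_[p] (M := Cyc p N)).toEquiv
  rw [homCard_congr e2 (LinearEquiv.refl _ (Cyc p N)), ← Nat.card_congr e3, Nat.card_pi,
    Nat.card_congr e2.toEquiv, Nat.card_pi]
  refine Finset.prod_congr rfl fun i _ => ?_
  rw [homCard_Cyc (hk i), card_Cyc]

theorem card_hom_quotient_Cyc {N : ℕ} (W : Type) [AddCommGroup W] [Module ℤ_[p] W] [Finite W]
    (hW : ∀ x : W, (p : ℤ_[p]) ^ N • x = 0) (K : Submodule ℤ_[p] W) :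
    Nat.card {η : W →ₗ[ℤ_[p]] Cyc p N // K ≤ LinearMap.ker η} = Nat.card (W ⧸ K) := by
  rw [← homCard_Cyc_eq_card (N := N) (W ⧸ K) (fun x => by
    obtain ⟨y, rfl⟩ := K.mkQ_surjective x
    rw [← map_smul, hW, map_zero])]
  exact Nat.card_congr
    { toFun := fun η => K.liftQ η.1 η.2
      invFun := fun η => ⟨η ∘ₗ K.mkQ, by
        intro x hx
        simp [(Submodule.Quotient.mk_eq_zero K).2 hx]⟩
      left_inv := fun η => by ext; simp
      right_inv := fun η => by ext; simp }

/-- The number of characters with a prescribed (possible) value at one element. -/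
theorem card_hom_Cyc_apply_eq {N j : ℕ} (W : Type) [AddCommGroup W] [Module ℤ_[p] W] [Finite W]
    (hW : ∀ x : W, (p : ℤ_[p]) ^ N • x = 0) (hj : j ≤ N) (w : W)
    (hw : Nat.card (Submodule.span ℤ_[p] {w}) = p ^ j) (r : Cyc p N)
    (hr : (p : ℤ_[p]) ^ j • r = 0) :
    Nat.card {η : W →ₗ[ℤ_[p]] Cyc p N // η w = r} =
      Nat.card (W ⧸ Submodule.span ℤ_[p] {w}) := by
  have hpw : (p : ℤ_[p]) ^ j • w = 0 := by
    have := pow_smul_eq_zero_of_card hw le_rfl ⟨w, Submodule.mem_span_singleton_self w⟩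
    exact congrArg Subtype.val this
  let ev : (W →ₗ[ℤ_[p]] Cyc p N) →ₗ[ℤ_[p]] Cyc p N :=
    { toFun := fun η => η w, map_add' := fun _ _ => rfl, map_smul' := fun _ _ => rfl }
  have hker : Nat.card (LinearMap.ker ev) = Nat.card (W ⧸ Submodule.span ℤ_[p] {w}) := by
    rw [← card_hom_quotient_Cyc W hW]
    refine Nat.card_congr (Equiv.subtypeEquivRight fun η => ?_)
    rw [Submodule.span_singleton_le_iff_mem]
    rfl
  -- Counting shows that the values at `w` fill the whole `p^j`-torsion of `ℤ_p / p^N`. So `r` is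
  -- attained, and its fibre is a coset of the characters that vanish at `w`.
  have hrange : Nat.card (LinearMap.range ev) = p ^ j := by
    have h1 := (LinearMap.ker ev).card_eq_card_quotient_mul_card
    rw [Nat.card_congr ev.quotKerEquivRange.toEquiv, hker, homCard_Cyc_eq_card W hW,
      (Submodule.span ℤ_[p] {w}).card_eq_card_quotient_mul_card, hw, mul_comm] at h1
    rw [mul_comm] at h1
    exact (Nat.eq_of_mul_eq_mul_left Nat.card_pos (by rw [← h1, mul_comm])).symm
  have hsub : (LinearMap.range ev : Set (Cyc p N)) = {x | (p : ℤ_[p]) ^ j • x = 0} := by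
    refine Set.eq_of_subset_of_ncard_le ?_ ?_ (Set.toFinite _)
    · rintro _ ⟨η, rfl⟩
      change (p : ℤ_[p]) ^ j • η w = 0
      rw [← map_smul, hpw, map_zero]
    · have h1 := card_Cyc_torsion (p := p) hj
      change Nat.card (LinearMap.range ev : Set (Cyc p N)) = p ^ j at hrange
      rw [Nat.card_coe_set_eq] at hrange
      rw [hrange]
      exact h1.le
  have hmem : r ∈ (LinearMap.range ev : Set (Cyc p N)) := by rw [hsub]; exact hr
  obtain ⟨η₀, hη₀⟩ := hmem
  rw [← hker]
  exact Nat.card_congr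
    { toFun := fun η => ⟨η.1 - η₀, by
        rw [LinearMap.mem_ker, map_sub, hη₀]; exact sub_eq_zero.2 η.2⟩
      invFun := fun η => ⟨η.1 + η₀, by
        have h1 : ev η.1 = 0 := η.2
        have h2 : ev (η.1 + η₀) = r := by rw [map_add, h1, hη₀, zero_add]
        exact h2⟩
      left_inv := fun η => by ext; simp
      right_inv := fun η => by ext; simp }

end CohenLenstra
end
noncomputable section

namespace CohenLenstra

open Module

variable {p : ℕ} [Fact p.Prime]

/-! ### Extensions by `ℤ_p` and characters -/

/-- The fibre product of a character `χ : G → ℤ_p / p^k` and the projection `ℤ_p → ℤ_p / p^k`. -/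
def fiberProd {k : ℕ} {G : Type} [AddCommGroup G] [Module ℤ_[p] G] (χ : G →ₗ[ℤ_[p]] Cyc p k) :
    Submodule ℤ_[p] (G × ℤ_[p]) :=
  LinearMap.eqLocus (χ ∘ₗ LinearMap.fst ℤ_[p] G ℤ_[p])
    ((Submodule.mkQ (Ideal.span {(p : ℤ_[p]) ^ k})) ∘ₗ LinearMap.snd ℤ_[p] G ℤ_[p])

theorem mem_fiberProd {k : ℕ} {G : Type} [AddCommGroup G] [Module ℤ_[p] G]
    {χ : G →ₗ[ℤ_[p]] Cyc p k} {x : G × ℤ_[p]} :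
    x ∈ fiberProd χ ↔ χ x.1 = Ideal.Quotient.mk _ x.2 := Iff.rfl

theorem mk_pow_mul {k : ℕ} (t : ℤ_[p]) :
    (Ideal.Quotient.mk (Ideal.span {(p : ℤ_[p]) ^ k}) ((p : ℤ_[p]) ^ k * t) : Cyc p k) = 0 :=
  mk_eq_zero_iff.2 (dvd_mul_right _ _)

theorem mk_eq_mk_iff {k : ℕ} {x y : ℤ_[p]} :
    (Ideal.Quotient.mk (Ideal.span {(p : ℤ_[p]) ^ k}) x : Cyc p k) = Ideal.Quotient.mk _ y ↔
      (p : ℤ_[p]) ^ k ∣ x - y := by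
  rw [← sub_eq_zero, ← map_sub, mk_eq_zero_iff]

/-- The inclusion of `ℤ_p` in the fibre product. -/
def fiberProdInl {k : ℕ} {G : Type} [AddCommGroup G] [Module ℤ_[p] G] (χ : G →ₗ[ℤ_[p]] Cyc p k) :
    ℤ_[p] →ₗ[ℤ_[p]] fiberProd χ where
  toFun t := ⟨(0, (p : ℤ_[p]) ^ k * t), mem_fiberProd.2 (by simp only [map_zero]; rw [mk_pow_mul])⟩
  map_add' s t := by ext <;> simp [mul_add]
  map_smul' s t := by ext <;> simp [mul_left_comm]

/-- The projection of the fibre product to `G`. -/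
def fiberProdProj {k : ℕ} {G : Type} [AddCommGroup G] [Module ℤ_[p] G]
    (χ : G →ₗ[ℤ_[p]] Cyc p k) : fiberProd χ →ₗ[ℤ_[p]] G :=
  LinearMap.fst ℤ_[p] G ℤ_[p] ∘ₗ (fiberProd χ).subtype

theorem fiberProdProj_surjective {k : ℕ} {G : Type} [AddCommGroup G] [Module ℤ_[p] G]
    (χ : G →ₗ[ℤ_[p]] Cyc p k) : Function.Surjective (fiberProdProj χ) := by
  intro g
  obtain ⟨z, hz⟩ := Ideal.Quotient.mk_surjective (χ g)
  exact ⟨⟨(g, z), mem_fiberProd.2 hz.symm⟩, rfl⟩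

theorem fiberProdProj_eq_zero {k : ℕ} {G : Type} [AddCommGroup G] [Module ℤ_[p] G]
    (χ : G →ₗ[ℤ_[p]] Cyc p k) (y : fiberProd χ) :
    fiberProdProj χ y = 0 ↔ ∃ t, fiberProdInl χ t = y := by
  constructor
  · intro h
    obtain ⟨⟨g, z⟩, hy⟩ := y
    change g = 0 at h
    subst h
    rw [mem_fiberProd, map_zero, eq_comm, mk_eq_zero_iff] at hy
    obtain ⟨t, ht⟩ := hy
    exact ⟨t, Subtype.ext (Prod.ext rfl ht.symm)⟩
  · rintro ⟨t, rfl⟩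
    rfl

/-- The extension of `G` by `ℤ_p` defined by a character. -/
def charExtn {k : ℕ} (G : FinMod p) (χ : G.carrier →ₗ[ℤ_[p]] Cyc p k) : Extn G where
  mid := fiberProd χ
  inl := fiberProdInl χ
  proj := fiberProdProj χ
  inl_injective s t h := by
    have h1 : (p : ℤ_[p]) ^ k * s = p ^ k * t := congrArg (fun y => (Subtype.val y).2) h
    exact mul_left_cancel₀ (padic_pow_ne_zero k) h1
  exact y := fiberProdProj_eq_zero χ y
  proj_surjective := fiberProdProj_surjective χ

/-- When `p^k` kills `G`, the second coordinate `z` of a point `y` of the fibre product is visible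
in the extension, since `p^k y` is the image of `z` under the inclusion of `ℤ_p`. An equivalence
therefore preserves it, and `z` modulo `p^k` is the value of the character. -/
theorem charExtn_injective {k : ℕ} (G : FinMod p)
    (hG : ∀ x : G.carrier, (p : ℤ_[p]) ^ k • x = 0) :
    Function.Injective fun χ : G.carrier →ₗ[ℤ_[p]] Cyc p k =>
      (Quotient.mk _ (charExtn G χ) : ExtZp G) := by
  intro χ χ' h
  obtain ⟨e, h1, h2⟩ : ∃ e : fiberProd χ ≃ₗ[ℤ_[p]] fiberProd χ',
      (∀ x, e (fiberProdInl χ x) = fiberProdInl χ' x) ∧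
        ∀ y, fiberProdProj χ' (e y) = fiberProdProj χ y := Quotient.exact h
  ext g
  obtain ⟨z, hz⟩ := Ideal.Quotient.mk_surjective (χ g)
  let y : fiberProd χ := ⟨(g, z), mem_fiberProd.2 hz.symm⟩
  have hy : (p : ℤ_[p]) ^ k • y = fiberProdInl χ z :=
    Subtype.ext (Prod.ext (hG g) rfl)
  have h3 := h1 z
  rw [← hy, map_smul] at h3
  have h4 : (p : ℤ_[p]) ^ k * (e y).1.2 = p ^ k * z := congrArg (fun y => (Subtype.val y).2) h3
  have h5 : (e y).1.2 = z := mul_left_cancel₀ (padic_pow_ne_zero k) h4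
  have h6 : (e y).1.1 = g := h2 y
  have h7 := mem_fiberProd.1 (e y).2
  rw [h5, h6] at h7
  rw [h7, ← hz]

/-- Multiplication by `p^k` maps the middle module into the submodule `ℤ_p`, which gives `σ : E →
ℤ_p` extending `p^k` on `ℤ_p`. Modulo `p^k` it descends to a character of `G`, and `(proj, σ)`
identifies `E` with the fibre product. -/
theorem charExtn_surjective {k : ℕ} (G : FinMod p)
    (hG : ∀ x : G.carrier, (p : ℤ_[p]) ^ k • x = 0) :
    Function.Surjective fun χ : G.carrier →ₗ[ℤ_[p]] Cyc p k =>
      (Quotient.mk _ (charExtn G χ) : ExtZp G) := by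
  intro ξ
  obtain ⟨E, rfl⟩ := Quotient.exists_rep ξ
  have hmem : ∀ y : E.mid, (p : ℤ_[p]) ^ k • y ∈ LinearMap.range E.inl := fun y => by
    rw [← LinearMap.exact_iff.1 E.exact, LinearMap.mem_ker, map_smul, hG]
  let σ : E.mid →ₗ[ℤ_[p]] ℤ_[p] :=
    (LinearEquiv.ofInjective E.inl E.inl_injective).symm.toLinearMap ∘ₗ
      ((p : ℤ_[p]) ^ k • LinearMap.id).codRestrict (LinearMap.range E.inl) hmem
  have hσ : ∀ y, E.inl (σ y) = (p : ℤ_[p]) ^ k • y := fun y =>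
    congrArg Subtype.val ((LinearEquiv.ofInjective E.inl E.inl_injective).apply_symm_apply
      ⟨(p : ℤ_[p]) ^ k • y, hmem y⟩)
  have hσi : ∀ t, σ (E.inl t) = (p : ℤ_[p]) ^ k * t := fun t => by
    apply E.inl_injective
    rw [hσ, ← map_smul, smul_eq_mul]
  let χ₀ : E.mid →ₗ[ℤ_[p]] Cyc p k := (Submodule.mkQ (Ideal.span {(p : ℤ_[p]) ^ k})) ∘ₗ σ
  have hχ₀ : LinearMap.ker E.proj ≤ LinearMap.ker χ₀ := by
    rw [LinearMap.exact_iff.1 E.exact]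
    rintro _ ⟨t, rfl⟩
    change (Ideal.Quotient.mk _ (σ (E.inl t)) : Cyc p k) = 0
    rw [hσi, mk_pow_mul]
  let χ : G.carrier →ₗ[ℤ_[p]] Cyc p k := (LinearMap.ker E.proj).liftQ χ₀ hχ₀ ∘ₗ
    (E.proj.quotKerEquivOfSurjective E.proj_surjective).symm.toLinearMap
  have hχ : ∀ y, χ (E.proj y) = Ideal.Quotient.mk _ (σ y) := fun y => by
    have : (E.proj.quotKerEquivOfSurjective E.proj_surjective).symm (E.proj y) =
        Submodule.Quotient.mk y := by
      rw [LinearEquiv.symm_apply_eq]; rfl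
    simp only [χ, LinearMap.comp_apply, LinearEquiv.coe_coe, this]
    rfl
  let f : E.mid →ₗ[ℤ_[p]] fiberProd χ :=
    (E.proj.prod σ).codRestrict (fiberProd χ) fun y => mem_fiberProd.2 (hχ y)
  have hf : Function.Bijective f := by
    constructor
    · rw [← LinearMap.ker_eq_bot, LinearMap.ker_eq_bot']
      intro y hy
      have h1 : E.proj y = 0 := congrArg (fun y => (Subtype.val y).1) hy
      have h2 : σ y = 0 := congrArg (fun y => (Subtype.val y).2) hy
      obtain ⟨t, rfl⟩ := (E.exact y).1 h1
      rw [hσi] at h2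
      rw [(mul_eq_zero.1 h2).resolve_left (padic_pow_ne_zero k), map_zero]
    · rintro ⟨⟨g, z⟩, hx⟩
      obtain ⟨y, rfl⟩ := E.proj_surjective g
      rw [mem_fiberProd] at hx
      change χ (E.proj y) = Ideal.Quotient.mk _ z at hx
      rw [hχ, eq_comm, mk_eq_mk_iff] at hx
      obtain ⟨t, ht⟩ := hx
      refine ⟨y + E.inl t, Subtype.ext (Prod.ext ?_ ?_)⟩
      · change E.proj (y + E.inl t) = E.proj y
        rw [map_add, (E.exact _).2 ⟨t, rfl⟩, add_zero]
      · change σ (y + E.inl t) = z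
        rw [map_add, hσi, ← ht]
        ring
  refine ⟨χ, Quotient.sound (Setoid.symm ⟨LinearEquiv.ofBijective f hf, fun t => ?_, fun y => rfl⟩)⟩
  refine Subtype.ext (Prod.ext ?_ (hσi t))
  exact (E.exact _).2 ⟨t, rfl⟩

instance finite_fiberProd {k : ℕ} {G : Type} [AddCommGroup G] [Module ℤ_[p] G] [Finite G]
    (χ : G →ₗ[ℤ_[p]] Cyc p k) : Module.Finite ℤ_[p] (fiberProd χ) :=
  inferInstance

theorem card_ExtZp (G : FinMod p) : Nat.card (ExtZp G) = Nat.card G.carrier := by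
  obtain ⟨k, hk⟩ := exists_card_eq_pow p G.carrier
  have hG := fun x : G.carrier => pow_smul_eq_zero_of_card hk le_rfl x
  rw [← homCard_Cyc_eq_card G.carrier hG]
  exact (Nat.card_congr
    (Equiv.ofBijective _ ⟨charExtn_injective G hG, charExtn_surjective G hG⟩)).symm

theorem dStarProb_eq {k : ℕ} (G : X₀ p) (hG : ∀ x : G.rep.carrier, (p : ℤ_[p]) ^ k • x = 0)
    (H : X₁ p) : dStarProb G H =
      (Nat.card {χ : G.rep.carrier →ₗ[ℤ_[p]] Cyc p k //
        Nonempty (fiberProd χ ≃ₗ[ℤ_[p]] H.rep.carrier)} : ℝ) / G.card := by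
  rw [dStarProb, card_ExtZp, X₀.card]
  congr 2
  refine (Nat.card_congr ((Equiv.ofBijective _ ⟨charExtn_injective G.rep hG,
    charExtn_surjective G.rep hG⟩).subtypeEquiv fun χ => ?_)).symm
  change _ ↔ (Quotient.mk _ (charExtn G.rep χ).toRankOneMod : X₁ p) = H
  constructor
  · rintro ⟨e⟩
    rw [← Quotient.out_eq H]
    exact Quotient.sound ⟨e⟩
  · intro h
    rw [← Quotient.out_eq H] at h
    exact Quotient.exact h

end CohenLenstra
end
noncomputable section

namespace CohenLenstra

open Module

variable {p : ℕ} [Fact p.Prime]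

/-! ### Surjections from a random extension -/

/-- Bijections are given by a relation, because the two objects matched later determine each other
through a compatibility condition rather than an explicit formula. -/
theorem card_eq_of_rel {α β : Type*} (r : α → β → Prop) (h₁ : ∀ a, ∃! b, r a b)
    (h₂ : ∀ b, ∃! a, r a b) : Nat.card α = Nat.card β := by
  choose f hf hf' using h₁
  choose g hg hg' using h₂
  exact Nat.card_congr ⟨f, g, fun a => (hg' _ _ (hf a)).symm, fun b => (hf' _ _ (hg b)).symm⟩

theorem card_eq_sum_of_rel {α β : Type*} [Finite α] [Fintype β] (r : α → β → Prop)
    (h : ∀ a, ∃! b, r a b) : Nat.card α = ∑ b, Nat.card {a // r a b} := by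
  rw [← Nat.card_sigma]
  choose f hf hf' using h
  exact Nat.card_congr
    { toFun := fun a => ⟨f a, a, hf a⟩
      invFun := fun x => x.2.1
      left_inv := fun a => rfl
      right_inv := by
        rintro ⟨b, a, hab⟩
        obtain rfl := hf' _ _ hab
        rfl }

/-- The annihilator of `b` is a nonzero ideal of `ℤ_p`, hence generated by a power of `p`, and the
order of the cyclic module fixes the exponent. -/
theorem smul_eq_zero_iff_of_card_span {B : Type*} [AddCommGroup B] [Module ℤ_[p] B] {b : B} {j : ℕ}
    (hb : Nat.card (Submodule.span ℤ_[p] {b}) = p ^ j) (t : ℤ_[p]) :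
    t • b = 0 ↔ (p : ℤ_[p]) ^ j ∣ t := by
  have hp : p.Prime := Fact.out
  have e := (LinearMap.toSpanSingleton ℤ_[p] B b).quotKerEquivRange
  rw [LinearMap.range_toSpanSingleton] at e
  have hc := Nat.card_congr e.toEquiv
  rw [hb] at hc
  have hne : LinearMap.ker (LinearMap.toSpanSingleton ℤ_[p] B b) ≠ ⊥ := by
    intro h0
    have : Finite (ℤ_[p] ⧸ LinearMap.ker (LinearMap.toSpanSingleton ℤ_[p] B b)) :=
      Nat.finite_of_card_ne_zero (by rw [hc]; exact pow_ne_zero _ hp.ne_zero)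
    have h1 := finrank_eq_zero_of_finite (p := p)
      (ℤ_[p] ⧸ LinearMap.ker (LinearMap.toSpanSingleton ℤ_[p] B b))
    rw [(Submodule.quotEquivOfEqBot _ h0).finrank_eq, Module.finrank_self] at h1
    exact one_ne_zero h1
  have hI := PadicInt.ideal_eq_span_pow_p hne
  obtain ⟨i, hi⟩ := hI
  have hij : i = j := by
    rw [hi] at hc
    rw [card_Cyc] at hc
    exact Nat.pow_right_injective hp.two_le hc
  subst hij
  rw [← Ideal.mem_span_singleton, ← hi, LinearMap.mem_ker, LinearMap.toSpanSingleton_apply]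

/-- The reduction `ℤ_p / p^(k+j) → ℤ_p / p^k`. -/
def redCyc (k j : ℕ) : Cyc p (k + j) →ₗ[ℤ_[p]] Cyc p k :=
  Submodule.liftQ _ (Submodule.mkQ (Ideal.span {(p : ℤ_[p]) ^ k})) (by
    rw [Submodule.ker_mkQ]
    exact Ideal.span_singleton_le_span_singleton.2 (pow_dvd_pow _ (Nat.le_add_right k j)))

theorem redCyc_mk (k j : ℕ) (z : ℤ_[p]) :
    redCyc k j (Ideal.Quotient.mk _ z) = Ideal.Quotient.mk _ z := rfl

/-- The pullback to `G` of the extension `0 → ⟨b⟩ → B → B/⟨b⟩ → 0`. -/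
def pullback {G B : Type} [AddCommGroup G] [Module ℤ_[p] G] [AddCommGroup B] [Module ℤ_[p] B]
    (b : B) (φ : G →ₗ[ℤ_[p]] B ⧸ Submodule.span ℤ_[p] {b}) : Submodule ℤ_[p] (G × B) :=
  LinearMap.eqLocus (φ ∘ₗ LinearMap.fst ℤ_[p] G B)
    (Submodule.mkQ (Submodule.span ℤ_[p] {b}) ∘ₗ LinearMap.snd ℤ_[p] G B)

section

variable {G B : Type} [AddCommGroup G] [Module ℤ_[p] G] [AddCommGroup B] [Module ℤ_[p] B]
    {b : B} {φ : G →ₗ[ℤ_[p]] B ⧸ Submodule.span ℤ_[p] {b}}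

theorem mem_pullback {x : G × B} :
    x ∈ pullback b φ ↔ φ x.1 = Submodule.Quotient.mk x.2 := Iff.rfl

theorem zero_mem_pullback {c : B} : ((0 : G), c) ∈ pullback b φ ↔ ∃ t : ℤ_[p], t • b = c := by
  rw [mem_pullback, map_zero, eq_comm, Submodule.Quotient.mk_eq_zero, Submodule.mem_span_singleton]

/-- The element `b` of the pullback. -/
def pullbackInl (b : B) (φ : G →ₗ[ℤ_[p]] B ⧸ Submodule.span ℤ_[p] {b}) : pullback b φ :=
  ⟨(0, b), zero_mem_pullback.2 ⟨1, one_smul _ _⟩⟩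

theorem exists_pullback_fst (φ : G →ₗ[ℤ_[p]] B ⧸ Submodule.span ℤ_[p] {b}) (g : G) :
    ∃ w : pullback b φ, w.1.1 = g := by
  obtain ⟨y, hy⟩ := Submodule.Quotient.mk_surjective _ (φ g)
  exact ⟨⟨(g, y), mem_pullback.2 hy.symm⟩, rfl⟩

theorem pullback_eq_smul_inl {w : pullback b φ} (h : w.1.1 = 0) :
    ∃ t : ℤ_[p], w = t • pullbackInl b φ := by
  obtain ⟨⟨g, c⟩, hw⟩ := w
  change g = 0 at h
  subst h
  obtain ⟨t, rfl⟩ := zero_mem_pullback.1 hw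
  exact ⟨t, Subtype.ext (Prod.ext (smul_zero t).symm rfl)⟩

theorem card_pullback_quotient (b : B) (φ : G →ₗ[ℤ_[p]] B ⧸ Submodule.span ℤ_[p] {b}) :
    Nat.card (pullback b φ ⧸ Submodule.span ℤ_[p] {pullbackInl b φ}) = Nat.card G := by
  let f : pullback b φ →ₗ[ℤ_[p]] G := LinearMap.fst ℤ_[p] G B ∘ₗ (pullback b φ).subtype
  have hk : Submodule.span ℤ_[p] {pullbackInl b φ} = LinearMap.ker f := by
    ext w
    rw [Submodule.mem_span_singleton, LinearMap.mem_ker]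
    constructor
    · rintro ⟨t, rfl⟩
      exact smul_zero t
    · intro h
      obtain ⟨t, rfl⟩ := pullback_eq_smul_inl h
      exact ⟨t, rfl⟩
  rw [hk]
  refine Nat.card_congr (f.quotKerEquivOfSurjective fun g => ?_).toEquiv
  exact exists_pullback_fst φ g

theorem card_span_pullbackInl (b : B) (φ : G →ₗ[ℤ_[p]] B ⧸ Submodule.span ℤ_[p] {b}) :
    Nat.card (Submodule.span ℤ_[p] {pullbackInl b φ}) = Nat.card (Submodule.span ℤ_[p] {b}) := by
  let f : pullback b φ →ₗ[ℤ_[p]] B := LinearMap.snd ℤ_[p] G B ∘ₗ (pullback b φ).subtype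
  have h : Submodule.map f (Submodule.span ℤ_[p] {pullbackInl b φ}) = Submodule.span ℤ_[p] {b} := by
    rw [Submodule.map_span, Set.image_singleton]; rfl
  rw [← h]
  refine Nat.card_congr (Equiv.ofBijective
    (fun w : Submodule.span ℤ_[p] {pullbackInl b φ} =>
      (⟨f w, Submodule.mem_map_of_mem w.2⟩ : Submodule.map f (Submodule.span ℤ_[p] _))) ⟨?_, ?_⟩)
  · rintro ⟨x, hx⟩ ⟨y, hy⟩ hxy
    obtain ⟨s, rfl⟩ := Submodule.mem_span_singleton.1 hx
    obtain ⟨t, rfl⟩ := Submodule.mem_span_singleton.1 hy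
    have h1 : s • b = t • b := congrArg Subtype.val hxy
    exact Subtype.ext (Subtype.ext (Prod.ext (by simp [pullbackInl]) h1))
  · rintro ⟨_, y, hy, rfl⟩
    exact ⟨⟨y, hy⟩, rfl⟩

variable {k j : ℕ}

/-- The projection to `G` and `η` are jointly injective: on a multiple `t • (0, b)` the value of `η`
is `t p^k` modulo `p^(k+j)`, which vanishes exactly when `p^j ∣ t`, that is when `t • b = 0`. -/
theorem pullback_eq_zero (hb : Nat.card (Submodule.span ℤ_[p] {b}) = p ^ j)
    {η : pullback b φ →ₗ[ℤ_[p]] Cyc p (k + j)}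
    (hη : η (pullbackInl b φ) = Ideal.Quotient.mk _ ((p : ℤ_[p]) ^ k)) {w : pullback b φ}
    (h : w.1.1 = 0) (hw : η w = 0) : w = 0 := by
  obtain ⟨t, rfl⟩ := pullback_eq_smul_inl h
  rw [map_smul, hη, smul_mk, mk_eq_zero_iff, pow_add, mul_comm t,
    mul_dvd_mul_iff_left (padic_pow_ne_zero k)] at hw
  refine Subtype.ext (Prod.ext (smul_zero t) ?_)
  exact (smul_eq_zero_iff_of_card_span hb t).2 hw

/-- Homomorphisms from an extension to `B` correspond to characters of the pullback. -/
theorem card_hom_fiberProd (χ : G →ₗ[ℤ_[p]] Cyc p k)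
    (hb : Nat.card (Submodule.span ℤ_[p] {b}) = p ^ j) :
    Nat.card {f : fiberProd χ →ₗ[ℤ_[p]] B // f (fiberProdInl χ 1) = b ∧
        ∀ y, φ (fiberProdProj χ y) = Submodule.Quotient.mk (f y)} =
      Nat.card {η : pullback b φ →ₗ[ℤ_[p]] Cyc p (k + j) //
        η (pullbackInl b φ) = Ideal.Quotient.mk _ ((p : ℤ_[p]) ^ k) ∧
          ∀ w, redCyc k j (η w) = χ w.1.1} := by
  -- The graph map `y ↦ (proj y, f y)` sends the fibre product onto the pullback, and `η` is the
  -- `ℤ_p`-coordinate of `y` modulo `p^(k+j)`, which depends only on the image of `y`.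
  refine card_eq_of_rel (fun f η => ∀ y (w : pullback b φ), w.1 = (fiberProdProj χ y, f.1 y) →
    η.1 w = Ideal.Quotient.mk _ y.1.2) ?_ ?_
  · rintro ⟨f, hf1, hf2⟩
    let F : fiberProd χ →ₗ[ℤ_[p]] pullback b φ :=
      ((fiberProdProj χ).prod f).codRestrict (pullback b φ) fun y => mem_pullback.2 (hf2 y)
    have hinl : ∀ t, f (fiberProdInl χ t) = t • b := fun t => by
      rw [← hf1, ← map_smul, ← map_smul, smul_eq_mul, mul_one]
    have hF : Function.Surjective F := by
      rintro ⟨⟨g, c⟩, hw⟩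
      obtain ⟨y, rfl⟩ := fiberProdProj_surjective χ g
      have h1 : (Submodule.Quotient.mk (f y) : B ⧸ Submodule.span ℤ_[p] {b}) =
        Submodule.Quotient.mk c := (hf2 y).symm.trans (mem_pullback.1 hw)
      rw [Submodule.Quotient.eq, Submodule.mem_span_singleton] at h1
      obtain ⟨t, ht⟩ := h1
      refine ⟨y - fiberProdInl χ t, Subtype.ext (Prod.ext ?_ ?_)⟩
      · change fiberProdProj χ (y - fiberProdInl χ t) = fiberProdProj χ y
        rw [map_sub, (fiberProdProj_eq_zero χ _).2 ⟨t, rfl⟩, sub_zero]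
      · change f (y - fiberProdInl χ t) = c
        rw [map_sub, hinl, ht, sub_sub_cancel]
    let ζ : fiberProd χ →ₗ[ℤ_[p]] Cyc p (k + j) :=
      Submodule.mkQ (Ideal.span {(p : ℤ_[p]) ^ (k + j)}) ∘ₗ LinearMap.snd ℤ_[p] G ℤ_[p] ∘ₗ
        (fiberProd χ).subtype
    have hζ : LinearMap.ker F ≤ LinearMap.ker ζ := by
      intro y hy
      have h1 : fiberProdProj χ y = 0 := congrArg (fun w => (Subtype.val w).1) hy
      have h2 : f y = 0 := congrArg (fun w => (Subtype.val w).2) hy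
      obtain ⟨t, rfl⟩ := (fiberProdProj_eq_zero χ y).1 h1
      rw [hinl, smul_eq_zero_iff_of_card_span hb] at h2
      change (Ideal.Quotient.mk _ ((p : ℤ_[p]) ^ k * t) : Cyc p (k + j)) = 0
      rw [mk_eq_zero_iff, pow_add]
      exact mul_dvd_mul_left _ h2
    let η : pullback b φ →ₗ[ℤ_[p]] Cyc p (k + j) := (LinearMap.ker F).liftQ ζ hζ ∘ₗ
      (F.quotKerEquivOfSurjective hF).symm.toLinearMap
    have hη : ∀ y, η (F y) = Ideal.Quotient.mk _ y.1.2 := fun y => by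
      have : (F.quotKerEquivOfSurjective hF).symm (F y) = Submodule.Quotient.mk y := by
        rw [LinearEquiv.symm_apply_eq]; rfl
      simp only [η, LinearMap.comp_apply, LinearEquiv.coe_coe, this]
      rfl
    refine ⟨⟨η, ?_, fun w => ?_⟩, fun y w hw => ?_, ?_⟩
    · have : pullbackInl b φ = F (fiberProdInl χ 1) := Subtype.ext (Prod.ext rfl hf1.symm)
      rw [this, hη]
      congr 1
      exact mul_one _
    · obtain ⟨y, rfl⟩ := hF w
      rw [hη, redCyc_mk]
      exact (mem_fiberProd.1 y.2).symm
    · have : w = F y := Subtype.ext hw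
      rw [this]
      exact hη y
    · rintro ⟨η', h1, h2⟩ h3
      refine Subtype.ext (LinearMap.ext fun w => ?_)
      obtain ⟨y, rfl⟩ := hF w
      exact (h3 y (F y) rfl).trans (hη y).symm
  · rintro ⟨η, hη1, hη2⟩
    -- Conversely, the fibre product of `η` is isomorphic to that of `χ` by forgetting the
    -- coordinate in `B`; that coordinate is the homomorphism sought.
    let P : fiberProd η →ₗ[ℤ_[p]] fiberProd χ :=
      ((LinearMap.fst ℤ_[p] G B ∘ₗ (pullback b φ).subtype ∘ₗ fiberProdProj η).prod
        (LinearMap.snd ℤ_[p] (pullback b φ) ℤ_[p] ∘ₗ (fiberProd η).subtype)).codRestrict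
        (fiberProd χ) fun y => by
          have h1 := congrArg (redCyc k j) (mem_fiberProd.1 y.2)
          rw [hη2, redCyc_mk] at h1
          exact h1
    have hP : Function.Bijective P := by
      constructor
      · rintro ⟨⟨w, z⟩, hy⟩ ⟨⟨w', z'⟩, hy'⟩ h
        have h1 : w.1.1 = w'.1.1 := congrArg (fun w => (Subtype.val w).1) h
        have h2 : z = z' := congrArg (fun w => (Subtype.val w).2) h
        subst h2
        have h3 : w - w' = 0 := by
          refine pullback_eq_zero hb hη1 ?_ ?_
          · change w.1.1 - w'.1.1 = 0
            rw [h1, sub_self]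
          · rw [map_sub, sub_eq_zero]
            exact (mem_fiberProd.1 hy).trans (mem_fiberProd.1 hy').symm
        obtain rfl := sub_eq_zero.1 h3
        rfl
      · rintro ⟨⟨g, z⟩, hy⟩
        obtain ⟨w, rfl⟩ := exists_pullback_fst φ g
        obtain ⟨x, hx⟩ := Ideal.Quotient.mk_surjective (η w)
        have h1 := mem_fiberProd.1 hy
        change χ w.1.1 = _ at h1
        rw [← hη2, ← hx, redCyc_mk] at h1
        obtain ⟨s, hs⟩ := mk_eq_mk_iff.1 h1
        -- Initially `η w` agrees with `z` only modulo `p^k`. Since `η` takes the value `p^k` at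
        -- `(0, b)`, subtracting `s` times this element corrects it modulo `p^(k+j)`.
        refine ⟨⟨(w - s • pullbackInl b φ, z), mem_fiberProd.2 ?_⟩, Subtype.ext (Prod.ext ?_ rfl)⟩
        · change η (w - s • pullbackInl b φ) = Ideal.Quotient.mk _ z
          rw [map_sub, map_smul, hη1, ← hx, smul_mk, ← map_sub]
          congr 1
          rw [mul_comm s, ← hs]
          exact sub_sub_cancel _ _
        · change w.1.1 - s • (0 : G) = w.1.1
          rw [smul_zero, sub_zero]
    let e := LinearEquiv.ofBijective P hP
    let f : fiberProd χ →ₗ[ℤ_[p]] B := LinearMap.snd ℤ_[p] G B ∘ₗ (pullback b φ).subtype ∘ₗ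
      fiberProdProj η ∘ₗ e.symm.toLinearMap
    have hf : ∀ y, ∃ w : pullback b φ, w.1 = (fiberProdProj χ y, f y) ∧
        η w = Ideal.Quotient.mk _ y.1.2 := by
      intro y
      obtain ⟨x, rfl⟩ := hP.2 y
      have h1 : e.symm (P x) = x := e.symm_apply_apply x
      refine ⟨fiberProdProj η x, Prod.ext rfl ?_, mem_fiberProd.1 x.2⟩
      simp only [f, LinearMap.comp_apply, LinearEquiv.coe_coe, h1]
      rfl
    have hrel : ∀ y (w : pullback b φ), w.1 = (fiberProdProj χ y, f y) →
        η w = Ideal.Quotient.mk _ y.1.2 := by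
      intro y w hw
      obtain ⟨w', h1, h2⟩ := hf y
      rw [← h2]
      congr 1
      exact Subtype.ext (hw.trans h1.symm)
    refine ⟨⟨f, ?_, fun y => ?_⟩, hrel, ?_⟩
    · obtain ⟨w, h1, h2⟩ := hf (fiberProdInl χ 1)
      have h3 : w - pullbackInl b φ = 0 := by
        refine pullback_eq_zero hb hη1 ?_ ?_
        · change w.1.1 - 0 = 0
          rw [h1, sub_zero]
          rfl
        · rw [map_sub, h2, hη1, sub_eq_zero]
          congr 1
          exact mul_one _
      have h4 : f (fiberProdInl χ 1) = w.1.2 := by rw [h1]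
      rw [h4, sub_eq_zero.1 h3]
      rfl
    · obtain ⟨w, h1, h2⟩ := hf y
      have := mem_pullback.1 w.2
      rwa [h1] at this
    · rintro ⟨f', h1, h2⟩ h3
      refine Subtype.ext (LinearMap.ext fun y => ?_)
      change f' y = f y
      obtain ⟨w, hw1, hw2⟩ := hf y
      let w' : pullback b φ := ⟨(fiberProdProj χ y, f' y), mem_pullback.2 (h2 y)⟩
      have h4 : w' - w = 0 := by
        refine pullback_eq_zero hb hη1 ?_ ?_
        · change w'.1.1 - w.1.1 = 0
          rw [hw1, sub_self]
        · rw [map_sub, hw2, h3 y w' rfl, sub_self]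
      have h5 : w'.1.2 = w.1.2 := by rw [sub_eq_zero.1 h4]
      rw [hw1] at h5
      exact h5

end

-- Every admissible `η` on the pullback lies over exactly one `χ`, its reduction modulo `p^k`, which
-- kills `(0, b)`. Summing over `χ` thus leaves only the condition at `(0, b)`, and the number of
-- such `η` is the order of the pullback modulo `(0, b)`, a copy of `G`.
open Classical in
theorem sum_card_hom_fiberProd {G B : Type} [AddCommGroup G] [Module ℤ_[p] G] [Finite G]
    [AddCommGroup B] [Module ℤ_[p] B] [Finite B] {k : ℕ}
    [Fintype (G →ₗ[ℤ_[p]] Cyc p k)]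
    (hG : ∀ x : G, (p : ℤ_[p]) ^ k • x = 0) (b : B)
    (φ : G →ₗ[ℤ_[p]] B ⧸ Submodule.span ℤ_[p] {b}) :
    ∑ χ : G →ₗ[ℤ_[p]] Cyc p k,
      Nat.card {f : fiberProd χ →ₗ[ℤ_[p]] B // f (fiberProdInl χ 1) = b ∧
        ∀ y, φ (fiberProdProj χ y) = Submodule.Quotient.mk (f y)} = Nat.card G := by
  obtain ⟨j, hb⟩ := exists_card_eq_pow p (Submodule.span ℤ_[p] {b})
  have hkill : ∀ w : pullback b φ, (p : ℤ_[p]) ^ (k + j) • w = 0 := by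
    intro w
    have h1 : ((p : ℤ_[p]) ^ k • w).1.1 = 0 := hG _
    obtain ⟨t, ht⟩ := pullback_eq_smul_inl h1
    rw [pow_add, mul_comm, mul_smul, ht, smul_comm]
    have : (p : ℤ_[p]) ^ j • pullbackInl b φ = 0 :=
      (smul_eq_zero_iff_of_card_span ((card_span_pullbackInl b φ).trans hb) _).2 dvd_rfl
    rw [this, smul_zero]
  have hr : (p : ℤ_[p]) ^ j •
      (Ideal.Quotient.mk (Ideal.span {(p : ℤ_[p]) ^ (k + j)}) ((p : ℤ_[p]) ^ k) : Cyc p (k + j)) =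
      0 := by
    rw [smul_mk, mk_eq_zero_iff, pow_add, mul_comm]
  have hmain := card_hom_Cyc_apply_eq (pullback b φ) hkill (Nat.le_add_left j k)
    (pullbackInl b φ) ((card_span_pullbackInl b φ).trans hb) _ hr
  rw [card_pullback_quotient] at hmain
  rw [← hmain, card_eq_sum_of_rel
    (fun (η : {η : pullback b φ →ₗ[ℤ_[p]] Cyc p (k + j) // η (pullbackInl b φ) =
      Ideal.Quotient.mk _ ((p : ℤ_[p]) ^ k)}) (χ : G →ₗ[ℤ_[p]] Cyc p k) =>
        ∀ w, redCyc k j (η.1 w) = χ w.1.1)]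
  · refine Finset.sum_congr rfl fun χ _ => ?_
    rw [card_hom_fiberProd χ hb]
    exact Nat.card_congr (Equiv.subtypeSubtypeEquivSubtypeInter _ _).symm
  · rintro ⟨η, hη⟩
    let q : pullback b φ →ₗ[ℤ_[p]] G := LinearMap.fst ℤ_[p] G B ∘ₗ (pullback b φ).subtype
    have hq : Function.Surjective q := exists_pullback_fst φ
    have hk : LinearMap.ker q ≤ LinearMap.ker (redCyc k j ∘ₗ η) := by
      intro w hw
      obtain ⟨t, rfl⟩ := pullback_eq_smul_inl hw
      rw [LinearMap.mem_ker, LinearMap.comp_apply, map_smul, map_smul, hη, redCyc_mk,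
        mk_eq_zero_iff.2 dvd_rfl, smul_zero]
    let χ : G →ₗ[ℤ_[p]] Cyc p k := (LinearMap.ker q).liftQ _ hk ∘ₗ
      (q.quotKerEquivOfSurjective hq).symm.toLinearMap
    have hχ : ∀ w, χ (q w) = redCyc k j (η w) := fun y => by
      have : (q.quotKerEquivOfSurjective hq).symm (q y) = Submodule.Quotient.mk y := by
        rw [LinearEquiv.symm_apply_eq]; rfl
      simp only [χ, LinearMap.comp_apply, LinearEquiv.coe_coe, this]
      rfl
    refine ⟨χ, fun w => (hχ w).symm, fun χ' h => LinearMap.ext fun g => ?_⟩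
    obtain ⟨w, rfl⟩ := hq g
    exact (h w).symm.trans (hχ w).symm

open Classical in
/-- The average number of surjections from a random extension of `G` by `ℤ_p` to `B`. -/
theorem sum_surCard_fiberProd {G B : Type} [AddCommGroup G] [Module ℤ_[p] G] [Finite G]
    [AddCommGroup B] [Module ℤ_[p] B] [Finite B] [Fintype B] {k : ℕ}
    [Fintype (G →ₗ[ℤ_[p]] Cyc p k)]
    (hG : ∀ x : G, (p : ℤ_[p]) ^ k • x = 0) :
    ∑ χ : G →ₗ[ℤ_[p]] Cyc p k, surCard p (fiberProd χ) B =
      Nat.card G * ∑ b : B, surCard p G (B ⧸ Submodule.span ℤ_[p] {b}) := by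
  have : ∀ b : B, Fintype {φ : G →ₗ[ℤ_[p]] B ⧸ Submodule.span ℤ_[p] {b} //
    Function.Surjective φ} := fun b => Fintype.ofFinite _
  -- A surjection `f` to `B` determines the image `b` of `1 ∈ ℤ_p` and a surjection `φ : G → B/⟨b⟩`.
  -- Any homomorphism over such a pair is surjective, so the previous count applies to each pair
  -- separately.
  have key : ∀ χ : G →ₗ[ℤ_[p]] Cyc p k, surCard p (fiberProd χ) B =
      ∑ x : (Σ b : B, {φ : G →ₗ[ℤ_[p]] B ⧸ Submodule.span ℤ_[p] {b} // Function.Surjective φ}),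
        Nat.card {f : fiberProd χ →ₗ[ℤ_[p]] B // f (fiberProdInl χ 1) = x.1 ∧
          ∀ y, x.2.1 (fiberProdProj χ y) = Submodule.Quotient.mk (f y)} := by
    intro χ
    rw [surCard, card_eq_sum_of_rel
      (fun (f : {f : fiberProd χ →ₗ[ℤ_[p]] B // Function.Surjective f})
        (x : (Σ b : B, {φ : G →ₗ[ℤ_[p]] B ⧸ Submodule.span ℤ_[p] {b} //
          Function.Surjective φ})) => f.1 (fiberProdInl χ 1) = x.1 ∧
          ∀ y, x.2.1 (fiberProdProj χ y) = Submodule.Quotient.mk (f.1 y))]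
    · refine Finset.sum_congr rfl fun x _ => ?_
      obtain ⟨b, φ, hφ⟩ := x
      refine Nat.card_congr ⟨fun f => ⟨f.1.1, f.2⟩, fun f => ⟨⟨f.1, ?_⟩, f.2⟩, fun _ => rfl,
        fun _ => rfl⟩
      obtain ⟨f, h1, h2⟩ := f
      intro c
      obtain ⟨g, hg⟩ := hφ (Submodule.Quotient.mk c)
      obtain ⟨y, rfl⟩ := fiberProdProj_surjective χ g
      have h3 := (h2 y).symm.trans hg
      rw [Submodule.Quotient.eq, Submodule.mem_span_singleton] at h3
      obtain ⟨t, ht⟩ := h3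
      refine ⟨y - t • fiberProdInl χ 1, ?_⟩
      rw [map_sub, map_smul]
      change f y - t • f (fiberProdInl χ 1) = c
      rw [h1, ht, sub_sub_cancel]
    · rintro ⟨f, hf⟩
      let ψ : fiberProd χ →ₗ[ℤ_[p]] B ⧸ Submodule.span ℤ_[p] {f (fiberProdInl χ 1)} :=
        Submodule.mkQ _ ∘ₗ f
      have hψ : Function.Surjective ψ := (Submodule.mkQ_surjective _).comp hf
      have hk : LinearMap.ker (fiberProdProj χ) ≤ LinearMap.ker ψ := by
        intro y hy
        obtain ⟨t, rfl⟩ := (fiberProdProj_eq_zero χ y).1 hy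
        rw [LinearMap.mem_ker]
        refine (Submodule.Quotient.mk_eq_zero _).2 (Submodule.mem_span_singleton.2 ⟨t, ?_⟩)
        rw [← map_smul, ← map_smul, smul_eq_mul, mul_one]
      have hq := fiberProdProj_surjective χ
      let φ : G →ₗ[ℤ_[p]] B ⧸ Submodule.span ℤ_[p] {f (fiberProdInl χ 1)} :=
        (LinearMap.ker (fiberProdProj χ)).liftQ _ hk ∘ₗ
          ((fiberProdProj χ).quotKerEquivOfSurjective hq).symm.toLinearMap
      have hφ : ∀ w, φ (fiberProdProj χ w) = ψ w := fun y => by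
        have : ((fiberProdProj χ).quotKerEquivOfSurjective hq).symm (fiberProdProj χ y) =
            Submodule.Quotient.mk y := by
          rw [LinearEquiv.symm_apply_eq]; rfl
        simp only [φ, LinearMap.comp_apply, LinearEquiv.coe_coe, this]
        rfl
      refine ⟨⟨f (fiberProdInl χ 1), φ, fun c => ?_⟩, ⟨rfl, hφ⟩, ?_⟩
      · obtain ⟨y, rfl⟩ := hψ c
        exact ⟨_, hφ y⟩
      · rintro ⟨b, φ', hφ'⟩ ⟨h1, h2⟩
        change f (fiberProdInl χ 1) = b at h1
        subst h1
        congr 2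
        refine LinearMap.ext fun g => ?_
        obtain ⟨y, rfl⟩ := hq g
        exact (h2 y).trans (hφ y).symm
  simp_rw [key]
  rw [Finset.sum_comm, Fintype.sum_sigma, Finset.mul_sum]
  refine Finset.sum_congr rfl fun b _ => ?_
  rw [Finset.sum_congr rfl fun φ _ => sum_card_hom_fiberProd hG b φ.1]
  rw [Finset.sum_const, Finset.card_univ, smul_eq_mul, mul_comm, surCard, ← Nat.card_eq_fintype_card]

end CohenLenstra
end
noncomputable section

namespace CohenLenstra

open Module MeasureTheory

variable {p : ℕ} [Fact p.Prime]

/-! ### Finitely generated modules of rank one -/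

/-- Coefficients with respect to finitely many generators matter only modulo `p^N`. -/
theorem finite_of_pow_smul_eq_zero (Q : Type*) [AddCommGroup Q] [Module ℤ_[p] Q]
    [Module.Finite ℤ_[p] Q] (N : ℕ) (h : ∀ x : Q, (p : ℤ_[p]) ^ N • x = 0) : Finite Q := by
  obtain ⟨n, f, hf⟩ := Module.Finite.exists_fin' ℤ_[p] Q
  refine Finite.of_surjective (fun c : Fin n → Cyc p N => f fun i => Quotient.out (c i)) ?_
  intro q
  obtain ⟨x, rfl⟩ := hf q
  refine ⟨fun i => Ideal.Quotient.mk _ (x i), ?_⟩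
  have hd : ∀ i, ∃ t, Quotient.out (Ideal.Quotient.mk (Ideal.span {(p : ℤ_[p]) ^ N}) (x i) :
      Cyc p N) - x i = (p : ℤ_[p]) ^ N * t := fun i => by
    have h1 : (Ideal.Quotient.mk (Ideal.span {(p : ℤ_[p]) ^ N}) (Quotient.out
      (Ideal.Quotient.mk (Ideal.span {(p : ℤ_[p]) ^ N}) (x i) : Cyc p N)) : Cyc p N) =
        Ideal.Quotient.mk _ (x i) := Quotient.out_eq _
    exact mk_eq_mk_iff.1 h1
  choose t ht using hd
  rw [← sub_eq_zero, ← map_sub]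
  have : (fun i => Quotient.out (Ideal.Quotient.mk (Ideal.span {(p : ℤ_[p]) ^ N}) (x i) :
      Cyc p N)) - x = (p : ℤ_[p]) ^ N • t := by
    ext i
    simp only [Pi.sub_apply, Pi.smul_apply, smul_eq_mul]
    rw [ht]
  rw [this, map_smul, h]

theorem finrank_prod_of_finite (F A : Type) [AddCommGroup F] [Module ℤ_[p] F]
    [Module.Finite ℤ_[p] F] [AddCommGroup A]    [Module ℤ_[p] A] [Finite A] : finrank ℤ_[p] (F × A) = finrank ℤ_[p] F := by
  have h := (LinearMap.ker (LinearMap.snd ℤ_[p] F A)).finrank_quotient_add_finrank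
  rw [((LinearMap.snd ℤ_[p] F A).quotKerEquivOfSurjective LinearMap.snd_surjective).finrank_eq,
    finrank_eq_zero_of_finite, zero_add, LinearMap.ker_snd,
    LinearMap.finrank_range_of_inj LinearMap.inl_injective] at h
  exact h.symm

/-- Structure theorem over `ℤ_p`: the torsion summands are finite, and the rank says that the free
part is one copy of `ℤ_p`. -/
theorem exists_equiv_prod (M : Type) [AddCommGroup M] [Module ℤ_[p] M] [Module.Finite ℤ_[p] M]
    (hM : finrank ℤ_[p] M = 1) : ∃ A : FinMod p, Nonempty (M ≃ₗ[ℤ_[p]] ℤ_[p] × A.carrier) := by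
  classical
  obtain ⟨n, ι, hι, q, hq, e, ⟨f⟩⟩ := Module.equiv_free_prod_directSum ℤ_[p] M
  have hfin : ∀ i, Finite (ℤ_[p] ⧸ Submodule.span ℤ_[p] {q i ^ e i}) := fun i => by
    have hne : Submodule.span ℤ_[p] {q i ^ e i} ≠ ⊥ := by
      rw [Ne, Submodule.span_singleton_eq_bot]
      exact pow_ne_zero _ (hq i).ne_zero
    obtain ⟨k, hk⟩ := PadicInt.ideal_eq_span_pow_p hne
    rw [hk]
    exact finite_Cyc k
  have hfin2 : Finite (DirectSum ι fun i => ℤ_[p] ⧸ Submodule.span ℤ_[p] {q i ^ e i}) :=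
    Finite.of_equiv _ (DirectSum.linearEquivFunOnFintype ℤ_[p] ι
      (fun i => ℤ_[p] ⧸ Submodule.span ℤ_[p] {q i ^ e i})).symm.toEquiv
  have hn : n = 1 := by
    have h1 := f.finrank_eq
    rw [hM] at h1
    have h2 := finrank_prod_of_finite (p := p) (Fin n →₀ ℤ_[p])
      (DirectSum ι fun i => ℤ_[p] ⧸ Submodule.span ℤ_[p] {q i ^ e i})
    rw [← h1, Module.finrank_finsupp_self, Fintype.card_fin] at h2
    exact h2.symm
  subst hn
  exact ⟨⟨DirectSum ι fun i => ℤ_[p] ⧸ Submodule.span ℤ_[p] {q i ^ e i}⟩,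
    ⟨f.trans (LinearEquiv.prodCongr ((Finsupp.linearEquivFunOnFinite ℤ_[p] ℤ_[p] (Fin 1)).trans
      (LinearEquiv.funUnique (Fin 1) ℤ_[p] ℤ_[p])) (LinearEquiv.refl _ _))⟩⟩

/-- A torsion element `h` would span a finite submodule of finite index, making `M` finite and of
rank zero. -/
theorem smul_eq_zero_of_finite_quotient {M : Type} [AddCommGroup M] [Module ℤ_[p] M]
    (hM : finrank ℤ_[p] M = 1) {h : M} (hfin : Finite (M ⧸ Submodule.span ℤ_[p] {h}))
    {t : ℤ_[p]} (ht : t • h = 0) : t = 0 := by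
  by_contra hne
  have hk : LinearMap.ker (LinearMap.toSpanSingleton ℤ_[p] M h) ≠ ⊥ := by
    intro h0
    have : t ∈ LinearMap.ker (LinearMap.toSpanSingleton ℤ_[p] M h) := ht
    rw [h0] at this
    exact hne this
  obtain ⟨k, hk⟩ := PadicInt.ideal_eq_span_pow_p hk
  have e := (LinearMap.toSpanSingleton ℤ_[p] M h).quotKerEquivRange
  rw [LinearMap.range_toSpanSingleton, hk] at e
  have h1 : Finite (Submodule.span ℤ_[p] {h}) := Finite.of_equiv _ e.toEquiv
  have h2 : Finite M := Nat.finite_of_card_ne_zero (by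
    rw [(Submodule.span ℤ_[p] {h}).card_eq_card_quotient_mul_card]
    exact mul_ne_zero Nat.card_pos.ne' Nat.card_pos.ne')
  rw [finrank_eq_zero_of_finite] at hM
  exact zero_ne_one hM

/-- The submodule `⟨h⟩` is free, so `⟨p h⟩` has index `p` in it. -/
theorem card_quotient_span_p_smul {M : Type} [AddCommGroup M] [Module ℤ_[p] M]
    (hM : finrank ℤ_[p] M = 1) {h : M} (hfin : Finite (M ⧸ Submodule.span ℤ_[p] {h})) :
    Nat.card (M ⧸ Submodule.span ℤ_[p] {(p : ℤ_[p]) • h}) =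
      p * Nat.card (M ⧸ Submodule.span ℤ_[p] {h}) := by
  have hle : Submodule.span ℤ_[p] {(p : ℤ_[p]) • h} ≤ Submodule.span ℤ_[p] {h} :=
    (Submodule.span_singleton_le_iff_mem _ _).2 (Submodule.mem_span_singleton.2 ⟨_, rfl⟩)
  rw [← Submodule.card_quotient_mul_card_quotient _ _ hle]
  congr 1
  let f := LinearMap.toSpanSingleton ℤ_[p] (M ⧸ Submodule.span ℤ_[p] {(p : ℤ_[p]) • h})
    (Submodule.Quotient.mk h)
  have hr : LinearMap.range f = Submodule.map (Submodule.mkQ _) (Submodule.span ℤ_[p] {h}) := by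
    rw [LinearMap.range_toSpanSingleton, Submodule.map_span, Set.image_singleton]
    rfl
  have hk : LinearMap.ker f = Ideal.span {(p : ℤ_[p]) ^ 1} := by
    ext t
    rw [LinearMap.mem_ker, LinearMap.toSpanSingleton_apply, ← Submodule.Quotient.mk_smul,
      Submodule.Quotient.mk_eq_zero, Submodule.mem_span_singleton, Ideal.mem_span_singleton, pow_one]
    constructor
    · rintro ⟨s, hs⟩
      refine ⟨s, ?_⟩
      rw [smul_smul, ← sub_eq_zero, ← sub_smul] at hs
      rw [mul_comm]
      exact (sub_eq_zero.1 (smul_eq_zero_of_finite_quotient hM hfin hs)).symm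
    · rintro ⟨s, rfl⟩
      exact ⟨s, by rw [smul_smul, mul_comm]⟩
  rw [← hr, ← Nat.card_congr f.quotKerEquivRange.toEquiv, hk, card_Cyc, pow_one]

/-- The elements of a cyclic submodule of finite index that generate it. -/
theorem span_singleton_eq_iff {M : Type} [AddCommGroup M] [Module ℤ_[p] M]
    (hM : finrank ℤ_[p] M = 1) {h : M} (hfin : Finite (M ⧸ Submodule.span ℤ_[p] {h})) (x : M) :
    Submodule.span ℤ_[p] {x} = Submodule.span ℤ_[p] {h} ↔
      x ∈ (Submodule.span ℤ_[p] {h} : Set M) \ Submodule.span ℤ_[p] {(p : ℤ_[p]) • h} := by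
  constructor
  · intro hx
    have h1 : x ∈ Submodule.span ℤ_[p] {h} := hx ▸ Submodule.mem_span_singleton_self x
    refine ⟨h1, fun h2 => ?_⟩
    obtain ⟨t, rfl⟩ := Submodule.mem_span_singleton.1 h2
    have h3 : h ∈ Submodule.span ℤ_[p] {t • (p : ℤ_[p]) • h} :=
      hx ▸ Submodule.mem_span_singleton_self h
    obtain ⟨s, hs⟩ := Submodule.mem_span_singleton.1 h3
    have h4 : (s * (t * p) - 1) • h = 0 := by
      rw [sub_smul, one_smul, mul_smul, mul_smul, hs, sub_self]
    have h5 := sub_eq_zero.1 (smul_eq_zero_of_finite_quotient hM hfin h4)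
    exact PadicInt.irreducible_p.not_isUnit (IsUnit.of_mul_eq_one (s * t) (by rw [← h5]; ring))
  · rintro ⟨h1, h2⟩
    obtain ⟨t, rfl⟩ := Submodule.mem_span_singleton.1 h1
    have ht : IsUnit t := by
      by_contra hu
      rw [PadicInt.not_isUnit_iff, PadicInt.norm_lt_one_iff_dvd] at hu
      obtain ⟨s, rfl⟩ := hu
      exact h2 (Submodule.mem_span_singleton.2 ⟨s, by rw [smul_smul, mul_comm]⟩)
    exact Submodule.span_singleton_smul_eq ht h

/-! ### Haar probabilities -/

/-- For the module topology a surjection `ℤ_p^n → A` is an open quotient map, and the preimage of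
`K` contains `p^k ℤ_p^n` as soon as `p^k` kills `A ⧸ K`. -/
theorem isOpen_of_finite_quotient {A : Type} [AddCommGroup A] [Module ℤ_[p] A]
    [Module.Finite ℤ_[p] A] [TopologicalSpace A] [IsModuleTopology ℤ_[p] A]
    [IsTopologicalAddGroup A] (K : Submodule ℤ_[p] A) [Finite (A ⧸ K)] : IsOpen (K : Set A) := by
  obtain ⟨n, f, hf⟩ := Module.Finite.exists_fin' ℤ_[p] A
  have hq := (IsModuleTopology.isOpenQuotientMap_of_surjective (R := ℤ_[p]) hf)
  rw [← hq.isQuotientMap.isOpen_preimage]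
  obtain ⟨k, hk⟩ := exists_card_eq_pow p (A ⧸ K)
  have hmem : ∀ x : A, (p : ℤ_[p]) ^ k • x ∈ K := fun x => by
    rw [← Submodule.Quotient.mk_eq_zero, Submodule.Quotient.mk_smul]
    exact pow_smul_eq_zero_of_card hk le_rfl _
  refine AddSubgroup.isOpen_of_mem_nhds (K.comap f).toAddSubgroup (g := 0) ?_
  -- The norm takes only powers of `p` as nonzero values, so the strict bound `p^(-k+1)` means at
  -- most `p^(-k)`.
  have hball : ∀ z : ℤ_[p], z ∈ Metric.ball (0 : ℤ_[p]) ((p : ℝ) ^ (-(k : ℤ) + 1)) →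
      (p : ℤ_[p]) ^ k ∣ z := fun z hz => by
    rw [mem_ball_zero_iff] at hz
    rw [← Ideal.mem_span_singleton, ← PadicInt.norm_le_pow_iff_mem_span_pow,
      PadicInt.norm_le_pow_iff_norm_lt_pow_add_one]
    exact hz
  have hp0 : (0 : ℝ) < p := by exact_mod_cast (Fact.out : p.Prime).pos
  refine Filter.mem_of_superset (set_pi_mem_nhds (Set.toFinite Set.univ)
    (s := fun _ : Fin n => Metric.ball (0 : ℤ_[p]) ((p : ℝ) ^ (-(k : ℤ) + 1)))
    fun i _ => Metric.ball_mem_nhds _ (zpow_pos hp0 _)) ?_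
  intro x hx
  choose y hy using fun i => hball (x i) (hx i (Set.mem_univ i))
  have : x = (p : ℤ_[p]) ^ k • y := funext hy
  change f x ∈ K
  rw [this, map_smul]
  exact hmem _

/-- This packages the Haar measure without its topology. Only the measures of submodules of finite
index are needed later, and translation invariance gives them. -/
theorem exists_haar_measure (A : Type) [AddCommGroup A] [Module ℤ_[p] A]
    [Module.Finite ℤ_[p] A] : ∃ (_ : MeasurableSpace A) (μ : Measure A), IsProbabilityMeasure μ ∧
      (∀ s : Set A, haarProb (p := p) A s = μ.real s) ∧
      ∀ K : Submodule ℤ_[p] A, Finite (A ⧸ K) →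
        MeasurableSet (K : Set A) ∧ μ.real K = (Nat.card (A ⧸ K) : ℝ)⁻¹ := by
  let : TopologicalSpace A := moduleTopology ℤ_[p] A
  have : IsModuleTopology ℤ_[p] A := ⟨rfl⟩
  have : IsTopologicalAddGroup A := IsModuleTopology.topologicalAddGroup ℤ_[p] A
  have : CompactSpace A := compactSpace_moduleTopology (p := p) A
  let : MeasurableSpace A := borel A
  have : BorelSpace A := ⟨rfl⟩
  let μ := Measure.addHaarMeasure (⊤ : TopologicalSpace.PositiveCompacts A)
  have hμ : IsProbabilityMeasure μ := ⟨Measure.addHaarMeasure_self⟩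
  refine ⟨borel A, μ, hμ, fun s => rfl, fun K hK => ?_⟩
  have hm : MeasurableSet (K : Set A) := (isOpen_of_finite_quotient K).measurableSet
  refine ⟨hm, ?_⟩
  have hfi : K.toAddSubgroup.FiniteIndex := by
    have : Finite (A ⧸ K.toAddSubgroup) := hK
    exact AddSubgroup.finiteIndex_of_finite_quotient
  have h1 := MeasureTheory.AddSubgroup.index_mul_measure K.toAddSubgroup hm μ
  rw [measure_univ] at h1
  have h2 : K.toAddSubgroup.index = Nat.card (A ⧸ K) := rfl
  rw [h2] at h1
  have h3 := congrArg ENNReal.toReal h1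
  rw [ENNReal.toReal_mul, ENNReal.toReal_natCast, ENNReal.toReal_one] at h3
  exact eq_inv_of_mul_eq_one_right h3

end CohenLenstra
end
noncomputable section

namespace CohenLenstra

open Module MeasureTheory

variable {p : ℕ} [Fact p.Prime]

/-! ### Quotients by Haar random elements and their surjections. -/

theorem finite_submodule_of_quotient (M G : Type) [AddCommGroup M] [Module ℤ_[p] M]
    [Module.Finite ℤ_[p] M] [AddCommGroup G] [Module ℤ_[p] G] [Finite G]
    (P : Submodule ℤ_[p] M → Prop) :
    Finite {K : Submodule ℤ_[p] M // Nonempty ((M ⧸ K) ≃ₗ[ℤ_[p]] G) ∧ P K} := by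
  refine Finite.of_injective (fun K => (K.2.1.some.toLinearMap ∘ₗ K.1.mkQ : M →ₗ[ℤ_[p]] G)) ?_
  rintro ⟨K, hK⟩ ⟨K', hK'⟩ h
  have := congrArg LinearMap.ker h
  simp only [LinearEquiv.ker_comp, Submodule.ker_mkQ] at this
  exact Subtype.ext this

/-- The probability that a Haar random element generates a submodule with property `P` and
quotient `G`. -/
theorem measure_span_quotient {M : Type} [AddCommGroup M] [Module ℤ_[p] M]
    [Module.Finite ℤ_[p] M] (hM : finrank ℤ_[p] M = 1) {_ : MeasurableSpace M} {μ : Measure M}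
    [IsProbabilityMeasure μ] (hμ : ∀ K : Submodule ℤ_[p] M, Finite (M ⧸ K) →
        MeasurableSet (K : Set M) ∧ μ.real K = (Nat.card (M ⧸ K) : ℝ)⁻¹)
    (G : Type) [AddCommGroup G] [Module ℤ_[p] G] [Finite G] (P : Submodule ℤ_[p] M → Prop) :
    MeasurableSet {h : M | Nonempty ((M ⧸ Submodule.span ℤ_[p] {h}) ≃ₗ[ℤ_[p]] G) ∧
        P (Submodule.span ℤ_[p] {h})} ∧
      μ.real {h : M | Nonempty ((M ⧸ Submodule.span ℤ_[p] {h}) ≃ₗ[ℤ_[p]] G) ∧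
        P (Submodule.span ℤ_[p] {h})} =
      Nat.card {K : Submodule ℤ_[p] M // Nonempty ((M ⧸ K) ≃ₗ[ℤ_[p]] G) ∧
        ((∃ h, K = Submodule.span ℤ_[p] {h}) ∧ P K)} * ((1 - (p : ℝ)⁻¹) / Nat.card G) := by
  classical
  have hfinC := finite_submodule_of_quotient M G
    (fun K => (∃ h, K = Submodule.span ℤ_[p] {h}) ∧ P K)
  let C := {K : Submodule ℤ_[p] M // Nonempty ((M ⧸ K) ≃ₗ[ℤ_[p]] G) ∧
        ((∃ h, K = Submodule.span ℤ_[p] {h}) ∧ P K)}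
  have : Fintype C := Fintype.ofFinite C
  have hset : {h : M | Nonempty ((M ⧸ Submodule.span ℤ_[p] {h}) ≃ₗ[ℤ_[p]] G) ∧
      P (Submodule.span ℤ_[p] {h})} =
      ⋃ K ∈ (Finset.univ : Finset C), {x : M | Submodule.span ℤ_[p] {x} = K.1} := by
    ext x
    simp only [Set.mem_ofPred_eq, Finset.mem_univ, Set.iUnion_true, Set.mem_iUnion]
    constructor
    · rintro ⟨h1, h2⟩
      exact ⟨⟨_, h1, ⟨x, rfl⟩, h2⟩, rfl⟩
    · rintro ⟨⟨K, h1, h2, h3⟩, h4⟩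
      change Submodule.span ℤ_[p] {x} = K at h4
      subst h4
      exact ⟨h1, h3⟩
  have hp1 : (p : ℝ) ≠ 0 := by exact_mod_cast (Fact.out : p.Prime).ne_zero
  -- The generators of `⟨h⟩` are the elements outside `⟨p h⟩`, so their measure is `1/|G| -
  -- 1/(p|G|)`, the same for every cyclic submodule with quotient `G`.
  have hgen : ∀ K : C, MeasurableSet {x : M | Submodule.span ℤ_[p] {x} = K.1} ∧
      μ.real {x : M | Submodule.span ℤ_[p] {x} = K.1} = (1 - (p : ℝ)⁻¹) / Nat.card G := by
    rintro ⟨K, ⟨e⟩, ⟨h, rfl⟩, -⟩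
    have hf : Finite (M ⧸ Submodule.span ℤ_[p] {h}) := Finite.of_equiv _ e.symm.toEquiv
    have hc : Nat.card (M ⧸ Submodule.span ℤ_[p] {h}) = Nat.card G := Nat.card_congr e.toEquiv
    have hpos : 0 < Nat.card G := Nat.card_pos
    have hc' := card_quotient_span_p_smul hM hf
    have hf' : Finite (M ⧸ Submodule.span ℤ_[p] {(p : ℤ_[p]) • h}) :=
      Nat.finite_of_card_ne_zero (by
        rw [hc', hc]
        exact mul_ne_zero (Fact.out : p.Prime).ne_zero hpos.ne')
    have heq : {x : M | Submodule.span ℤ_[p] {x} = Submodule.span ℤ_[p] {h}} =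
        (Submodule.span ℤ_[p] {h} : Set M) \ Submodule.span ℤ_[p] {(p : ℤ_[p]) • h} := by
      ext x
      exact span_singleton_eq_iff hM hf x
    obtain ⟨hm, hv⟩ := hμ _ hf
    obtain ⟨hm', hv'⟩ := hμ _ hf'
    have hle : Submodule.span ℤ_[p] {(p : ℤ_[p]) • h} ≤ Submodule.span ℤ_[p] {h} :=
      (Submodule.span_singleton_le_iff_mem _ _).2 (Submodule.mem_span_singleton.2 ⟨_, rfl⟩)
    change MeasurableSet {x : M | Submodule.span ℤ_[p] {x} = Submodule.span ℤ_[p] {h}} ∧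
      μ.real {x : M | Submodule.span ℤ_[p] {x} = Submodule.span ℤ_[p] {h}} = _
    rw [heq]
    refine ⟨hm.diff hm', ?_⟩
    rw [measureReal_sdiff (by exact_mod_cast hle) hm', hv, hv', hc', hc]
    push_cast
    field_simp
  have hdisj : ((Finset.univ : Finset C) : Set C).PairwiseDisjoint
      fun K : C => {x : M | Submodule.span ℤ_[p] {x} = K.1} := by
    intro K _ K' _ hne
    refine Set.disjoint_left.2 fun x hx hx' => hne (Subtype.ext ?_)
    exact (Eq.symm hx).trans hx'
  rw [hset]
  refine ⟨Finset.measurableSet_biUnion _ fun K _ => (hgen K).1, ?_⟩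
  rw [measureReal_biUnion_finset hdisj fun K _ => (hgen K).1,
    Finset.sum_congr rfl fun K _ => (hgen K).2, Finset.sum_const, Finset.card_univ, nsmul_eq_mul,
    ← Nat.card_eq_fintype_card]

theorem dProb_eq (H : X₁ p) (G : X₀ p) : dProb H G =
    Nat.card {K : Submodule ℤ_[p] H.rep.carrier //
      Nonempty ((H.rep.carrier ⧸ K) ≃ₗ[ℤ_[p]] G.rep.carrier) ∧
        ∃ h, K = Submodule.span ℤ_[p] {h}} * ((1 - (p : ℝ)⁻¹) / G.card) := by
  obtain ⟨m, μ, hμp, hμ, hK⟩ := exists_haar_measure (p := p) H.rep.carrier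
  have h := (measure_span_quotient H.rep.finrank_eq hK G.rep.carrier (fun _ => True)).2
  rw [dProb, hμ, X₀.card]
  simpa using h

theorem dProb_nonneg (H : X₁ p) (G : X₀ p) : 0 ≤ dProb H G := by
  obtain ⟨m, μ, hμp, hμ, hK⟩ := exists_haar_measure (p := p) H.rep.carrier
  rw [dProb, hμ]
  exact measureReal_nonneg

/-- In a module of rank one almost all elements have a finite quotient. -/
theorem measure_infinite_quotient {M : Type} [AddCommGroup M] [Module ℤ_[p] M]
    [Module.Finite ℤ_[p] M] (hM : finrank ℤ_[p] M = 1) {_ : MeasurableSpace M} {μ : Measure M}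
    [IsProbabilityMeasure μ] (hμ : ∀ K : Submodule ℤ_[p] M, Finite (M ⧸ K) →
        MeasurableSet (K : Set M) ∧ μ.real K = (Nat.card (M ⧸ K) : ℝ)⁻¹) :
    μ {h : M | ¬ Finite (M ⧸ Submodule.span ℤ_[p] {h})} = 0 := by
  obtain ⟨A, ⟨e⟩⟩ := exists_equiv_prod M hM
  let π : M →ₗ[ℤ_[p]] ℤ_[p] := LinearMap.fst ℤ_[p] ℤ_[p] A.carrier ∘ₗ e.toLinearMap
  have hπ : Function.Surjective π := (Prod.fst_surjective (α := ℤ_[p]) (β := A.carrier)).comp e.surjective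
  have hsub : {h : M | ¬ Finite (M ⧸ Submodule.span ℤ_[p] {h})} ⊆ {h | π h = 0} := by
    intro h hh
    by_contra hne
    change π h ≠ 0 at hne
    refine hh ?_
    obtain ⟨k, hk⟩ := exists_card_eq_pow p A.carrier
    have hs : Ideal.span {π h} ≠ ⊥ := by
      rw [Ne, Ideal.span_singleton_eq_bot]; exact hne
    obtain ⟨n, hn⟩ := PadicInt.ideal_eq_span_pow_p hs
    have hd : π h ∣ (p : ℤ_[p]) ^ n := by
      rw [← Ideal.mem_span_singleton, hn]
      exact Ideal.mem_span_singleton_self _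
    obtain ⟨c, hc⟩ := hd
    refine finite_of_pow_smul_eq_zero (p := p) _ (n + k) fun y => ?_
    obtain ⟨x, rfl⟩ := Submodule.Quotient.mk_surjective _ y
    rw [← Submodule.Quotient.mk_smul, Submodule.Quotient.mk_eq_zero, Submodule.mem_span_singleton]
    -- Here `p^n = π h * c` and `p^k` kills the torsion part. The multiple of `h` that matches
    -- `p^(n+k) x` in the first coordinate also matches it in the second, where both vanish.
    refine ⟨π x * c * (p : ℤ_[p]) ^ k, e.injective (Prod.ext ?_ ?_)⟩
    · rw [map_smul, map_smul]
      change π x * c * (p : ℤ_[p]) ^ k * π h = (p : ℤ_[p]) ^ (n + k) * π x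
      rw [pow_add, hc]; ring
    · rw [map_smul, map_smul]
      change (π x * c * (p : ℤ_[p]) ^ k) • (e h).2 = (p : ℤ_[p]) ^ (n + k) • (e x).2
      rw [mul_smul, pow_smul_eq_zero_of_card hk le_rfl, smul_zero,
        pow_smul_eq_zero_of_card hk (Nat.le_add_left k n)]
  refine measure_mono_null hsub ?_
  rw [← measureReal_eq_zero_iff]
  refine le_antisymm ?_ measureReal_nonneg
  have hp : (1 : ℝ) < p := by exact_mod_cast (Fact.out : p.Prime).one_lt
  refine ge_of_tendsto' (tendsto_pow_atTop_nhds_zero_of_lt_one (inv_nonneg.2 (zero_le_one.trans hp.le))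
    (inv_lt_one_of_one_lt₀ hp)) fun n => ?_
  -- The exceptional set lies in the preimage of `p^n ℤ_p`, of measure `p^(-n)`, for every `n`.
  let K : Submodule ℤ_[p] M := LinearMap.ker (Submodule.mkQ (Ideal.span {(p : ℤ_[p]) ^ n}) ∘ₗ π)
  have eK : (M ⧸ K) ≃ₗ[ℤ_[p]] Cyc p n := LinearMap.quotKerEquivOfSurjective _
    ((Submodule.mkQ_surjective _).comp hπ)
  have hfK : Finite (M ⧸ K) := Finite.of_equiv _ eK.symm.toEquiv
  have hv := (hμ K hfK).2
  rw [Nat.card_congr eK.toEquiv, card_Cyc] at hv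
  push_cast at hv
  rw [inv_pow, ← hv]
  refine measureReal_mono ?_
  intro x hx
  change Submodule.mkQ (Ideal.span {(p : ℤ_[p]) ^ n}) (π x) = 0
  rw [show π x = 0 from hx, map_zero]

theorem card_surjective_le_ker {M B : Type} [AddCommGroup M] [Module ℤ_[p] M] [AddCommGroup B]
    [Module ℤ_[p] B] (K : Submodule ℤ_[p] M) :
    Nat.card {f : {f : M →ₗ[ℤ_[p]] B // Function.Surjective f} // K ≤ LinearMap.ker f.1} =
      surCard p (M ⧸ K) B :=
  Nat.card_congr
    { toFun := fun f => ⟨K.liftQ f.1.1 f.2, fun b => by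
        obtain ⟨x, hx⟩ := f.1.2 b
        exact ⟨Submodule.Quotient.mk x, hx⟩⟩
      invFun := fun g => ⟨⟨g.1 ∘ₗ K.mkQ, g.2.comp K.mkQ_surjective⟩, by
        intro x hx
        simp [(Submodule.Quotient.mk_eq_zero K).2 hx]⟩
      left_inv := fun f => by ext; simp
      right_inv := fun g => by ext; simp }

/-- Count pairs `(h, f)` with `f : M → B` surjective and `f h = 0`. A given `f` kills a random `h`
with probability `1/|B|`; for a given `h` these `f` are the surjections `M/⟨h⟩ → B`. Almost surely
`M/⟨h⟩` is finite, so its isomorphism classes exhaust the probability. -/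
theorem hasSum_measure_mul_surCard [Countable (X₀ p)] {M : Type} [AddCommGroup M] [Module ℤ_[p] M]
    [Module.Finite ℤ_[p] M] (hM : finrank ℤ_[p] M = 1) {_ : MeasurableSpace M} {μ : Measure M}
    [IsProbabilityMeasure μ] (hK : ∀ K : Submodule ℤ_[p] M, Finite (M ⧸ K) →
        MeasurableSet (K : Set M) ∧ μ.real K = (Nat.card (M ⧸ K) : ℝ)⁻¹)
    (B : Type) [AddCommGroup B] [Module ℤ_[p] B] [Finite B] :
    HasSum (fun G : X₀ p =>
      μ.real {h : M | Nonempty ((M ⧸ Submodule.span ℤ_[p] {h}) ≃ₗ[ℤ_[p]] G.rep.carrier)} *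
        surCard p G.rep.carrier B) (surCard p M B / Nat.card B : ℝ) := by
  classical
  let S := {f : M →ₗ[ℤ_[p]] B // Function.Surjective f}
  have : Fintype S := Fintype.ofFinite S
  let E : S → X₀ p → Set M := fun f G =>
    {h : M | Nonempty ((M ⧸ Submodule.span ℤ_[p] {h}) ≃ₗ[ℤ_[p]] G.rep.carrier) ∧
        Submodule.span ℤ_[p] {h} ≤ LinearMap.ker f.1}
  have hE := fun (f : S) (G : X₀ p) =>
    measure_span_quotient hM hK G.rep.carrier (fun K => K ≤ LinearMap.ker f.1)
  have hsum : ∀ f : S, HasSum (fun G => μ.real (E f G)) ((Nat.card B : ℝ)⁻¹) := by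
    intro f
    have hdisj : Pairwise (Function.onFun Disjoint (E f)) := by
      intro G G' hne
      refine Set.disjoint_left.2 ?_
      rintro x ⟨⟨e⟩, -⟩ ⟨⟨e'⟩, -⟩
      refine hne ?_
      rw [← cls_rep G, cls_eq_iff]
      exact ⟨e.symm.trans e'⟩
    have hU : μ (⋃ G, E f G) = μ (LinearMap.ker f.1 : Set M) := by
      refine le_antisymm (measure_mono ?_) ?_
      · refine Set.iUnion_subset fun G x hx => ?_
        exact (Submodule.span_singleton_le_iff_mem _ _).1 hx.2
      · have h0 := measure_infinite_quotient hM hK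
        refine (measure_mono (t := (⋃ G, E f G) ∪
          {h : M | ¬ Finite (M ⧸ Submodule.span ℤ_[p] {h})}) fun x hx => ?_).trans
          ((measure_union_le _ _).trans (by rw [h0, add_zero]))
        by_cases hf : Finite (M ⧸ Submodule.span ℤ_[p] {x})
        · refine Or.inl (Set.mem_iUnion.2 ⟨cls p (M ⧸ Submodule.span ℤ_[p] {x}), ?_, ?_⟩)
          · exact ⟨(nonempty_rep_cls _).some.symm⟩
          · exact (Submodule.span_singleton_le_iff_mem _ _).2 hx
        · exact Or.inr hf
    have h1 := measure_iUnion (μ := μ) hdisj fun G => (hE f G).1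
    have hker : μ.real (LinearMap.ker f.1 : Set M) = (Nat.card B : ℝ)⁻¹ := by
      have e := f.1.quotKerEquivOfSurjective f.2
      have hf : Finite (M ⧸ LinearMap.ker f.1) := Finite.of_equiv _ e.symm.toEquiv
      rw [(hK _ hf).2, Nat.card_congr e.toEquiv]
    have h2 : ∑' G, μ (E f G) ≠ ⊤ := by
      rw [← h1]; exact measure_ne_top _ _
    have h3 := ENNReal.hasSum_toReal h2
    rw [← ENNReal.tsum_toReal_eq (fun G => measure_ne_top _ _), ← h1, hU] at h3
    rw [← hker]
    exact h3
  have h4 := hasSum_sum (s := Finset.univ) fun f _ => hsum f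
  rw [Finset.sum_const, Finset.card_univ, nsmul_eq_mul, ← Nat.card_eq_fintype_card] at h4
  rw [div_eq_mul_inv]
  suffices h8 : ∀ G : X₀ p,
      μ.real {h : M | Nonempty ((M ⧸ Submodule.span ℤ_[p] {h}) ≃ₗ[ℤ_[p]] G.rep.carrier)} *
        surCard p G.rep.carrier B = ∑ f, μ.real (E f G) by
    simp_rw [h8]
    exact h4
  intro G
  -- For each `G` the sum over `f` is exchanged with the sum over cyclic submodules `K`: the `f`
  -- that kill `K` are surjections from `M/K ≅ G`.
  have h5 : ∑ f : S, Nat.card {K : Submodule ℤ_[p] M // Nonempty ((M ⧸ K) ≃ₗ[ℤ_[p]] G.rep.carrier) ∧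
      ((∃ h, K = Submodule.span ℤ_[p] {h}) ∧ K ≤ LinearMap.ker f.1)} =
      Nat.card {K : Submodule ℤ_[p] M // Nonempty ((M ⧸ K) ≃ₗ[ℤ_[p]] G.rep.carrier) ∧
        ((∃ h, K = Submodule.span ℤ_[p] {h}) ∧ True)} * surCard p G.rep.carrier B := by
    let C := {K : Submodule ℤ_[p] M // Nonempty ((M ⧸ K) ≃ₗ[ℤ_[p]] G.rep.carrier) ∧
        ((∃ h, K = Submodule.span ℤ_[p] {h}) ∧ True)}
    have hfC : Finite C := finite_submodule_of_quotient M G.rep.carrier _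
    have : Fintype C := Fintype.ofFinite C
    have hfC' := fun f : S => finite_submodule_of_quotient M G.rep.carrier
      (fun K => (∃ h, K = Submodule.span ℤ_[p] {h}) ∧ K ≤ LinearMap.ker f.1)
    rw [← Nat.card_sigma]
    have e : (Σ f : S, {K : Submodule ℤ_[p] M // Nonempty ((M ⧸ K) ≃ₗ[ℤ_[p]] G.rep.carrier) ∧
      ((∃ h, K = Submodule.span ℤ_[p] {h}) ∧ K ≤ LinearMap.ker f.1)}) ≃
        Σ K : C, {f : S // K.1 ≤ LinearMap.ker f.1} :=
      { toFun := fun x => ⟨⟨x.2.1, x.2.2.1, x.2.2.2.1, trivial⟩, x.1, x.2.2.2.2⟩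
        invFun := fun x => ⟨x.2.1, x.1.1, x.1.2.1, x.1.2.2.1, x.2.2⟩
        left_inv := fun _ => rfl
        right_inv := fun _ => rfl }
    rw [Nat.card_congr e, Nat.card_sigma]
    have h6 : ∀ K : C, Nat.card {f : S // K.1 ≤ LinearMap.ker f.1} =
        surCard p G.rep.carrier B := fun K => by
      rw [card_surjective_le_ker]
      exact surCard_congr K.2.1.some (LinearEquiv.refl _ _)
    rw [Finset.sum_congr rfl fun K _ => h6 K, Finset.sum_const, Finset.card_univ, smul_eq_mul,
      Nat.card_eq_fintype_card]
  have h7 := (measure_span_quotient hM hK G.rep.carrier (fun _ => True)).2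
  simp only [and_true] at h7 h5
  rw [h7, Finset.sum_congr rfl fun f _ => (hE f G).2, ← Finset.sum_mul, ← Nat.cast_sum, h5]
  push_cast
  ring

/-- The expected number of surjections from the quotient by a Haar random element to `B`. -/
theorem hasSum_dProb_mul_surCard [Countable (X₀ p)] (H : X₁ p) (B : Type) [AddCommGroup B]
    [Module ℤ_[p] B] [Finite B] :
    HasSum (fun G : X₀ p => dProb H G * surCard p G.rep.carrier B)
      (surCard p H.rep.carrier B / Nat.card B : ℝ) := by
  obtain ⟨m, μ, hμp, hμ, hK⟩ := exists_haar_measure (p := p) H.rep.carrier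
  have h := hasSum_measure_mul_surCard H.rep.finrank_eq hK B
  simp only [← hμ] at h
  exact h

end CohenLenstra
end
noncomputable section

namespace CohenLenstra

open Module

variable {p : ℕ} [Fact p.Prime]

/-! ### Reversibility -/

theorem exists_comp_eq_of_ker_le {M G N : Type} [AddCommGroup M] [Module ℤ_[p] M] [AddCommGroup G]
    [Module ℤ_[p] G] [AddCommGroup N] [Module ℤ_[p] N] {f : M →ₗ[ℤ_[p]] G}
    (hf : Function.Surjective f) (h : M →ₗ[ℤ_[p]] N) (hk : LinearMap.ker f ≤ LinearMap.ker h) :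
    ∃ g : G →ₗ[ℤ_[p]] N, ∀ x, g (f x) = h x := by
  refine ⟨(LinearMap.ker f).liftQ h hk ∘ₗ (f.quotKerEquivOfSurjective hf).symm.toLinearMap,
    fun x => ?_⟩
  have : (f.quotKerEquivOfSurjective hf).symm (f x) = Submodule.Quotient.mk x := by
    rw [LinearEquiv.symm_apply_eq]; rfl
  simp only [LinearMap.comp_apply, LinearEquiv.coe_coe, this]
  rfl

/-- The torsion of the fibre product consists of the points with second coordinate `0`, which is a
copy of `ker χ`, while the torsion of `ℤ_p × A` is `A`. -/
theorem nonempty_ker_equiv_of_fiberProd {k : ℕ} {G A : Type} [AddCommGroup G] [Module ℤ_[p] G]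
    (hG : ∀ x : G, (p : ℤ_[p]) ^ k • x = 0) [AddCommGroup A] [Module ℤ_[p] A] [Finite A]
    {χ : G →ₗ[ℤ_[p]] Cyc p k} (e : fiberProd χ ≃ₗ[ℤ_[p]] ℤ_[p] × A) :
    Nonempty (A ≃ₗ[ℤ_[p]] LinearMap.ker χ) := by
  obtain ⟨a, ha⟩ := exists_card_eq_pow p A
  have hA := fun x : A => pow_smul_eq_zero_of_card ha le_rfl x
  have h1 : ∀ x : A, (e.symm (0, x)).1.2 = 0 := fun x => by
    have : (p : ℤ_[p]) ^ a • e.symm (0, x) = 0 := by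
      rw [← map_smul, Prod.smul_mk, hA, smul_zero, LinearEquiv.map_eq_zero_iff]
      rfl
    have h2 : (p : ℤ_[p]) ^ a * (e.symm (0, x)).1.2 = 0 := congrArg (fun y => (Subtype.val y).2) this
    exact (mul_eq_zero.1 h2).resolve_left (padic_pow_ne_zero a)
  let F : A →ₗ[ℤ_[p]] LinearMap.ker χ :=
    (fiberProdProj χ ∘ₗ e.symm.toLinearMap ∘ₗ LinearMap.inr ℤ_[p] ℤ_[p] A).codRestrict _ fun x => by
      have := mem_fiberProd.1 (e.symm (0, x)).2
      rw [h1, map_zero] at this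
      exact this
  refine ⟨LinearEquiv.ofBijective F ⟨fun x y hxy => ?_, fun ⟨g, hg⟩ => ?_⟩⟩
  · have h3 : (e.symm (0, x)).1.1 = (e.symm (0, y)).1.1 := congrArg Subtype.val hxy
    have h4 : e.symm (0, x) = e.symm (0, y) :=
      Subtype.ext (Prod.ext h3 ((h1 x).trans (h1 y).symm))
    exact congrArg Prod.snd (e.symm.injective h4)
  · let y : fiberProd χ := ⟨(g, 0), mem_fiberProd.2 (by rw [map_zero]; exact hg)⟩
    have h5 : (p : ℤ_[p]) ^ k • y = 0 := Subtype.ext (Prod.ext (hG g) (mul_zero _))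
    have h6 : (p : ℤ_[p]) ^ k • e y = 0 := by rw [← map_smul, h5, map_zero]
    have h7 : (e y).1 = 0 := by
      have : (p : ℤ_[p]) ^ k * (e y).1 = 0 := congrArg Prod.fst h6
      exact (mul_eq_zero.1 this).resolve_left (padic_pow_ne_zero k)
    refine ⟨(e y).2, Subtype.ext ?_⟩
    change (e.symm (0, (e y).2)).1.1 = g
    have h8 : ((0 : ℤ_[p]), (e y).2) = e y := Prod.ext h7.symm rfl
    rw [h8, e.symm_apply_apply]

/-- The middle module has rank one, so its torsion part determines it up to isomorphism. -/
theorem nonempty_fiberProd_equiv_iff {k : ℕ} (G : FinMod p) (A : FinMod p)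
    (hG : ∀ x : G.carrier, (p : ℤ_[p]) ^ k • x = 0) (χ : G.carrier →ₗ[ℤ_[p]] Cyc p k) :
    Nonempty (fiberProd χ ≃ₗ[ℤ_[p]] ℤ_[p] × A.carrier) ↔
      Nonempty (A.carrier ≃ₗ[ℤ_[p]] LinearMap.ker χ) := by
  constructor
  · rintro ⟨e⟩
    exact nonempty_ker_equiv_of_fiberProd hG e
  · rintro ⟨e⟩
    have : Module.Finite ℤ_[p] (fiberProd χ) := (charExtn G χ).finite_mid
    have hr : finrank ℤ_[p] (fiberProd χ) = 1 := (charExtn G χ).finrank_mid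
    obtain ⟨A', ⟨e'⟩⟩ := exists_equiv_prod (fiberProd χ) hr
    obtain ⟨f⟩ := nonempty_ker_equiv_of_fiberProd hG e'
    exact ⟨e'.trans (LinearEquiv.prodCongr (LinearEquiv.refl _ _) (f.trans e.symm))⟩

section

variable {k n : ℕ} {G A : Type} [AddCommGroup G] [Module ℤ_[p] G]
  [AddCommGroup A] [Module ℤ_[p] A]

/-- The generator of the submodule of order `p^n` of `ℤ_p / p^k`. -/
def cycGen (p : ℕ) [Fact p.Prime] (k n : ℕ) : Cyc p k := Ideal.Quotient.mk _ ((p : ℤ_[p]) ^ (k - n))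

theorem smul_cycGen_eq_zero (hn : n ≤ k) {z : ℤ_[p]} :
    z • cycGen p k n = 0 ↔ (p : ℤ_[p]) ^ n ∣ z := by
  rw [cycGen, smul_mk, mk_eq_zero_iff]
  have h2 : (p : ℤ_[p]) ^ k = p ^ n * p ^ (k - n) := by rw [← pow_add]; congr 1; omega
  rw [h2]
  exact mul_dvd_mul_iff_right (padic_pow_ne_zero _)

/-- The cyclic group `ℤ_p / p^k` has a single subgroup of order `p^n`, its `p^n`-torsion, so the
order of the range of `χ` determines that range. -/
theorem mem_range_iff_exists_smul_cycGen [Finite A] (hc : Nat.card G = p ^ n * Nat.card A)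
    {χ : G →ₗ[ℤ_[p]] Cyc p k} (e : A ≃ₗ[ℤ_[p]] LinearMap.ker χ) :
    n ≤ k ∧ ∀ x, x ∈ LinearMap.range χ ↔ ∃ z : ℤ_[p], x = z • cycGen p k n := by
  have hp : p.Prime := Fact.out
  have hr : Nat.card (LinearMap.range χ) = p ^ n := by
    have h1 := (LinearMap.ker χ).card_eq_card_quotient_mul_card
    rw [Nat.card_congr χ.quotKerEquivRange.toEquiv, ← Nat.card_congr e.toEquiv, hc, mul_comm] at h1
    exact (Nat.eq_of_mul_eq_mul_left Nat.card_pos h1).symm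
  have hn : n ≤ k := by
    have h2 := (LinearMap.range χ).card_eq_card_quotient_mul_card
    rw [hr, card_Cyc] at h2
    exact (Nat.pow_dvd_pow_iff_le_right hp.one_lt).1 (Dvd.intro _ h2.symm)
  refine ⟨hn, fun x => ?_⟩
  have hsub : (LinearMap.range χ : Set (Cyc p k)) = {x | (p : ℤ_[p]) ^ n • x = 0} := by
    refine Set.eq_of_subset_of_ncard_le ?_ ?_ (Set.toFinite _)
    · intro x hx
      exact congrArg Subtype.val
        (pow_smul_eq_zero_of_card hr le_rfl (⟨x, hx⟩ : LinearMap.range χ))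
    · change Nat.card (LinearMap.range χ : Set (Cyc p k)) = p ^ n at hr
      rw [Nat.card_coe_set_eq] at hr
      rw [hr]
      exact (card_Cyc_torsion (p := p) hn).le
  rw [← SetLike.mem_coe, hsub]
  refine (Cyc_pow_smul_eq_zero_iff hn x).trans (exists_congr fun z => ?_)
  rw [cycGen, smul_mk, mul_comm]

/-- A surjection `ℤ_p × A → G` with cyclic kernel determines a character with kernel `A`. -/
theorem exists_character (hG : ∀ x : G, (p : ℤ_[p]) ^ k • x = 0)
    (hc : ∀ m, Nat.card G = p ^ m * Nat.card A → m = n)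
    {f : ℤ_[p] × A →ₗ[ℤ_[p]] G} (hf : Function.Surjective f)
    (hcyc : ∃ h, LinearMap.ker f = Submodule.span ℤ_[p] {h}) :
    ∃ χ : G →ₗ[ℤ_[p]] Cyc p k, Nonempty (A ≃ₗ[ℤ_[p]] LinearMap.ker χ) ∧
      ∀ x, χ (f x) = x.1 • cycGen p k n := by
  obtain ⟨⟨h₁, h₂⟩, hker⟩ := hcyc
  have hmem : ∀ x, f x = 0 ↔ ∃ t : ℤ_[p], t • (h₁, h₂) = x := fun x => by
    rw [← LinearMap.mem_ker, hker, Submodule.mem_span_singleton]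
  -- Since `p^k` kills `G`, the element `p^k (1, 0)` lies in the kernel `⟨(h₁, h₂)⟩`. So `h₁` is
  -- nonzero and equals some `p^m`, `m ≤ k`, up to a unit.
  have hdvd : h₁ ∣ (p : ℤ_[p]) ^ k := by
    have h0 : f ((p : ℤ_[p]) ^ k • (1, 0)) = 0 := by rw [map_smul, hG]
    obtain ⟨t, ht⟩ := (hmem _).1 h0
    have h3 : t * h₁ = (p : ℤ_[p]) ^ k * 1 := congrArg Prod.fst ht
    exact ⟨t, by rw [mul_comm h₁, h3, mul_one]⟩
  have h₁ne : h₁ ≠ 0 := by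
    rintro rfl
    exact padic_pow_ne_zero k (zero_dvd_iff.1 hdvd)
  have hspan : Ideal.span {h₁} ≠ ⊥ := by rw [Ne, Ideal.span_singleton_eq_bot]; exact h₁ne
  obtain ⟨m, hm⟩ := PadicInt.ideal_eq_span_pow_p hspan
  have hmd : ∀ z, (p : ℤ_[p]) ^ m ∣ z ↔ h₁ ∣ z := fun z => by
    rw [← Ideal.mem_span_singleton, ← hm, Ideal.mem_span_singleton]
  have hmk : m ≤ k :=
    (pow_dvd_pow_iff padic_p_ne_zero PadicInt.irreducible_p.not_isUnit).1 ((hmd _).2 hdvd)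
  -- The character sought sends `f (z, a)` to `z` times the generator of order `p^m`. It is well
  -- defined because the first coordinates of the kernel of `f` are the multiples of `h₁`.
  let h : ℤ_[p] × A →ₗ[ℤ_[p]] Cyc p k :=
    (LinearMap.toSpanSingleton ℤ_[p] (Cyc p k) (cycGen p k m)) ∘ₗ LinearMap.fst ℤ_[p] ℤ_[p] A
  have hle : LinearMap.ker f ≤ LinearMap.ker h := by
    intro x hx
    obtain ⟨t, rfl⟩ := (hmem x).1 hx
    change (t * h₁) • cycGen p k m = 0
    rw [smul_cycGen_eq_zero hmk, hmd]
    exact dvd_mul_left _ _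
  obtain ⟨χ, hχ⟩ := exists_comp_eq_of_ker_le hf h hle
  replace hχ : ∀ x, χ (f x) = x.1 • cycGen p k m := hχ
  let F : A →ₗ[ℤ_[p]] LinearMap.ker χ :=
    (f ∘ₗ LinearMap.inr ℤ_[p] ℤ_[p] A).codRestrict _ fun a => by
      rw [LinearMap.mem_ker, LinearMap.comp_apply, hχ]
      exact zero_smul _ _
  have hF : Function.Bijective F := by
    constructor
    · refine (injective_iff_map_eq_zero F).2 fun a ha => ?_
      have h3 : f (0, a) = 0 := congrArg Subtype.val ha
      obtain ⟨t, ht⟩ := (hmem _).1 h3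
      have h4 : t * h₁ = 0 := congrArg Prod.fst ht
      have h5 : t • h₂ = a := congrArg Prod.snd ht
      rw [← h5, (mul_eq_zero.1 h4).resolve_right h₁ne, zero_smul]
    · rintro ⟨g, hg⟩
      obtain ⟨⟨z, a⟩, rfl⟩ := hf g
      rw [LinearMap.mem_ker, hχ, smul_cycGen_eq_zero hmk, hmd] at hg
      obtain ⟨t, rfl⟩ : ∃ t, z = h₁ * t := hg
      refine ⟨a - t • h₂, Subtype.ext ?_⟩
      change f (0, a - t • h₂) = f (h₁ * t, a)
      rw [← sub_eq_zero, ← map_sub, hmem]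
      exact ⟨-t, Prod.ext (by simp; ring) (by simp)⟩
  have e := LinearEquiv.ofBijective F hF
  have hrange : Nat.card (LinearMap.range χ) = p ^ m := by
    have h6 : LinearMap.range χ =
        LinearMap.range (LinearMap.toSpanSingleton ℤ_[p] (Cyc p k) (cycGen p k m)) := by
      ext x
      constructor
      · rintro ⟨g, rfl⟩
        obtain ⟨x, rfl⟩ := hf g
        exact ⟨x.1, (hχ x).symm⟩
      · rintro ⟨z, rfl⟩
        exact ⟨f (z, 0), hχ _⟩
    have h7 : LinearMap.ker (LinearMap.toSpanSingleton ℤ_[p] (Cyc p k) (cycGen p k m)) =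
        Ideal.span {(p : ℤ_[p]) ^ m} := by
      ext z
      rw [LinearMap.mem_ker, LinearMap.toSpanSingleton_apply, smul_cycGen_eq_zero hmk,
        Ideal.mem_span_singleton]
    rw [h6, ← Nat.card_congr (LinearMap.quotKerEquivRange _).toEquiv, h7, card_Cyc]
  have hcard : Nat.card G = p ^ m * Nat.card A := by
    rw [(LinearMap.ker χ).card_eq_card_quotient_mul_card,
      Nat.card_congr χ.quotKerEquivRange.toEquiv, hrange, Nat.card_congr e.toEquiv, mul_comm]
  obtain rfl := hc m hcard
  exact ⟨χ, ⟨e⟩, hχ⟩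

/-- The surjections `ℤ_p × A → G` with cyclic kernel that lie over a given character. -/
theorem card_surjective_over_character [Finite G] [Finite A] (hc : Nat.card G = p ^ n * Nat.card A)
    {χ : G →ₗ[ℤ_[p]] Cyc p k} (e₀ : A ≃ₗ[ℤ_[p]] LinearMap.ker χ) :
    Nat.card {f : {f : ℤ_[p] × A →ₗ[ℤ_[p]] G // Function.Surjective f ∧
        ∃ h, LinearMap.ker f = Submodule.span ℤ_[p] {h}} // ∀ x, χ (f.1 x) = x.1 • cycGen p k n} =
      Nat.card A * Nat.card (A ≃ₗ[ℤ_[p]] A) := by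
  obtain ⟨hnk, hrange⟩ := mem_range_iff_exists_smul_cycGen hc e₀
  obtain ⟨g₀, hg₀⟩ : ∃ g₀, χ g₀ = cycGen p k n := (hrange _).2 ⟨1, (one_smul _ _).symm⟩
  have h1 : Nat.card {g : G // χ g = cycGen p k n} = Nat.card A := by
    rw [Nat.card_congr e₀.toEquiv]
    exact Nat.card_congr
      { toFun := fun g => ⟨g.1 - g₀, by rw [LinearMap.mem_ker, map_sub, g.2, hg₀, sub_self]⟩
        invFun := fun x => ⟨x.1 + g₀, by rw [map_add, hg₀, LinearMap.mem_ker.1 x.2, zero_add]⟩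
        left_inv := fun g => by ext; simp
        right_inv := fun x => by ext; simp }
  have h2 : Nat.card (A ≃ₗ[ℤ_[p]] LinearMap.ker χ) = Nat.card (A ≃ₗ[ℤ_[p]] A) :=
    Nat.card_congr
      { toFun := fun a => a.trans e₀.symm
        invFun := fun a => a.trans e₀
        left_inv := fun a => by ext; simp
        right_inv := fun a => by ext; simp }
  rw [← h1, ← h2, ← Nat.card_prod]
  -- The surjection `f` is recovered from `f (1, 0)`, which runs through a coset of `ker χ`, and
  -- from its restriction to `A`, an isomorphism onto `ker χ`.
  refine card_eq_of_rel (fun f x => ∀ z a, f.1.1 (z, a) = z • x.1.1 + (x.2 a : G)) ?_ ?_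
  · rintro ⟨⟨f, hf, ⟨⟨h₁, h₂⟩, hker⟩⟩, hχ⟩
    have hmem : ∀ x, f x = 0 ↔ ∃ t : ℤ_[p], t • (h₁, h₂) = x := fun x => by
      rw [← LinearMap.mem_ker, hker, Submodule.mem_span_singleton]
    have h₁ne : h₁ ≠ 0 := by
      rintro rfl
      obtain ⟨b, hb⟩ := exists_card_eq_pow p G
      have h0 : f ((p : ℤ_[p]) ^ b • (1, 0)) = 0 := by
        rw [map_smul, pow_smul_eq_zero_of_card hb le_rfl]
      obtain ⟨t, ht⟩ := (hmem _).1 h0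
      have h3 : t * 0 = (p : ℤ_[p]) ^ b * 1 := congrArg Prod.fst ht
      rw [mul_zero, mul_one] at h3
      exact padic_pow_ne_zero b h3.symm
    replace hχ : ∀ x, χ (f x) = x.1 • cycGen p k n := hχ
    let F : A →ₗ[ℤ_[p]] LinearMap.ker χ :=
      (f ∘ₗ LinearMap.inr ℤ_[p] ℤ_[p] A).codRestrict _ fun a => by
        rw [LinearMap.mem_ker, LinearMap.comp_apply, hχ]
        exact zero_smul _ _
    have hFi : Function.Injective F := by
      refine (injective_iff_map_eq_zero F).2 fun a ha => ?_
      have h3 : f (0, a) = 0 := congrArg Subtype.val ha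
      obtain ⟨t, ht⟩ := (hmem _).1 h3
      have h4 : t * h₁ = 0 := congrArg Prod.fst ht
      have h5 : t • h₂ = a := congrArg Prod.snd ht
      rw [← h5, (mul_eq_zero.1 h4).resolve_right h₁ne, zero_smul]
    have hF : Function.Bijective F :=
      (Nat.bijective_iff_injective_and_card F).2 ⟨hFi, Nat.card_congr e₀.toEquiv⟩
    have hg : χ (f (1, 0)) = cycGen p k n := by rw [hχ]; exact one_smul _ _
    refine ⟨⟨⟨f (1, 0), hg⟩, LinearEquiv.ofBijective F hF⟩, fun z a => ?_, ?_⟩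
    · change f (z, a) = z • f (1, 0) + f (0, a)
      rw [← map_smul, ← map_add]
      congr 1
      simp
    · rintro ⟨⟨g, hg'⟩, e⟩ h
      have h3 : g = f (1, 0) := by
        have := h 1 0
        simp only [one_smul, map_zero, ZeroMemClass.coe_zero, add_zero] at this
        exact this.symm
      subst h3
      congr 1
      refine LinearEquiv.ext fun a => Subtype.ext ?_
      have := h 0 a
      simp only [zero_smul, zero_add] at this
      exact this.symm
  · rintro ⟨⟨g, hg⟩, e⟩
    let f : ℤ_[p] × A →ₗ[ℤ_[p]] G := (LinearMap.toSpanSingleton ℤ_[p] G g).coprod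
      ((LinearMap.ker χ).subtype ∘ₗ e.toLinearMap)
    have hfa : ∀ z a, f (z, a) = z • g + (e a : G) := fun z a => rfl
    have he : ∀ a, χ (e a : G) = 0 := fun a => (e a).2
    have hχ : ∀ x : ℤ_[p] × A, χ (f x) = x.1 • cycGen p k n := by
      rintro ⟨z, a⟩
      rw [hfa, map_add, map_smul, hg, he, add_zero]
    have hsurj : Function.Surjective f := by
      intro x
      obtain ⟨z, hz⟩ := (hrange (χ x)).1 ⟨x, rfl⟩
      have h3 : x - z • g ∈ LinearMap.ker χ := by
        rw [LinearMap.mem_ker, map_sub, map_smul, hg, hz, sub_self]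
      refine ⟨(z, e.symm ⟨_, h3⟩), ?_⟩
      rw [hfa, e.apply_symm_apply]
      exact add_sub_cancel _ _
    have hpg : (p : ℤ_[p]) ^ n • g ∈ LinearMap.ker χ := by
      rw [LinearMap.mem_ker, map_smul, hg, smul_cycGen_eq_zero hnk]
    -- Since `z • g` lies in `ker χ` exactly when `p^n ∣ z`, the relation of smallest first
    -- coordinate expresses `p^n g` through `A` and generates the kernel.
    have hker : LinearMap.ker f =
        Submodule.span ℤ_[p] {((p : ℤ_[p]) ^ n, - e.symm ⟨_, hpg⟩)} := by
      ext ⟨z, a⟩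
      rw [LinearMap.mem_ker, Submodule.mem_span_singleton, hfa]
      constructor
      · intro h0
        have h3 : z • cycGen p k n = 0 := by
          rw [← hχ (z, a), hfa, h0, map_zero]
        obtain ⟨t, rfl⟩ := (smul_cycGen_eq_zero hnk).1 h3
        refine ⟨t, Prod.ext (mul_comm _ _) (e.injective (Subtype.ext ?_))⟩
        change (e (t • - e.symm ⟨_, hpg⟩) : G) = e a
        rw [map_smul, map_neg, e.apply_symm_apply]
        change t • - ((p : ℤ_[p]) ^ n • g) = e a
        rw [smul_neg, smul_smul, mul_comm t]
        exact neg_eq_of_add_eq_zero_right h0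
      · rintro ⟨t, ht⟩
        have h3 : t * (p : ℤ_[p]) ^ n = z := congrArg Prod.fst ht
        have h4 : t • - e.symm ⟨_, hpg⟩ = a := congrArg Prod.snd ht
        rw [← h3, ← h4, map_smul, map_neg, e.apply_symm_apply]
        change (t * (p : ℤ_[p]) ^ n) • g + t • - ((p : ℤ_[p]) ^ n • g) = 0
        rw [smul_neg, smul_smul, add_neg_cancel]
    refine ⟨⟨⟨f, hsurj, _, hker⟩, hχ⟩, hfa, ?_⟩
    rintro ⟨⟨f', h3, h4⟩, h5⟩ h6
    refine Subtype.ext (Subtype.ext (LinearMap.ext ?_))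
    rintro ⟨z, a⟩
    exact (h6 z a).trans (hfa z a).symm

/-- Each surjection lies over exactly one character and all fibres have the same size. The left side
is also the number of cyclic submodules with quotient `G`, times `#Aut G`; comparing the two is
detailed balance. -/
theorem card_surjective_cyclic_ker [Finite G] [Finite A] (hG : ∀ x : G, (p : ℤ_[p]) ^ k • x = 0) :
    Nat.card {f : ℤ_[p] × A →ₗ[ℤ_[p]] G // Function.Surjective f ∧
        ∃ h, LinearMap.ker f = Submodule.span ℤ_[p] {h}} =
      Nat.card {χ : G →ₗ[ℤ_[p]] Cyc p k // Nonempty (A ≃ₗ[ℤ_[p]] LinearMap.ker χ)} *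
        (Nat.card A * Nat.card (A ≃ₗ[ℤ_[p]] A)) := by
  classical
  have hp : p.Prime := Fact.out
  obtain ⟨a, ha⟩ := exists_card_eq_pow p A
  obtain ⟨b, hb⟩ := exists_card_eq_pow p G
  have hc : ∀ m, Nat.card G = p ^ m * Nat.card A → m = b - a := fun m hm => by
    rw [ha, hb, ← pow_add] at hm
    have := Nat.pow_right_injective hp.two_le hm
    omega
  have : Fintype {χ : G →ₗ[ℤ_[p]] Cyc p k // Nonempty (A ≃ₗ[ℤ_[p]] LinearMap.ker χ)} :=
    Fintype.ofFinite _
  rw [card_eq_sum_of_rel (fun (f : {f : ℤ_[p] × A →ₗ[ℤ_[p]] G // Function.Surjective f ∧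
        ∃ h, LinearMap.ker f = Submodule.span ℤ_[p] {h}})
      (χ : {χ : G →ₗ[ℤ_[p]] Cyc p k // Nonempty (A ≃ₗ[ℤ_[p]] LinearMap.ker χ)}) =>
        ∀ x, χ.1 (f.1 x) = x.1 • cycGen p k (b - a))]
  · rw [Finset.sum_congr rfl fun χ _ => ?_, Finset.sum_const, Finset.card_univ, smul_eq_mul,
      Nat.card_eq_fintype_card]
    obtain ⟨χ, ⟨e⟩⟩ := χ
    refine card_surjective_over_character ?_ e
    have h1 := (LinearMap.ker χ).card_eq_card_quotient_mul_card
    rw [← Nat.card_congr e.toEquiv] at h1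
    obtain ⟨c, hcc⟩ := exists_card_eq_pow p (G ⧸ LinearMap.ker χ)
    rw [hcc, mul_comm] at h1
    rw [← hc c h1, h1]
  · rintro ⟨f, hf, hcyc⟩
    obtain ⟨χ, he, hχ⟩ := exists_character hG hc hf hcyc
    refine ⟨⟨χ, he⟩, hχ, ?_⟩
    rintro ⟨χ', he'⟩ h
    refine Subtype.ext (LinearMap.ext fun g => ?_)
    obtain ⟨x, rfl⟩ := hf g
    exact (h x).trans (hχ x).symm

end

/-- Detailed balance, up to a weight that depends on the module of rank one only. -/
theorem exists_reversible (p : ℕ) [Fact p.Prime] : ∃ w : X₁ p → ℝ, (∀ H, 0 < w H) ∧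
    ∀ (G : X₀ p) (H : X₁ p), (G.cardAut : ℝ)⁻¹ * dStarProb G H = w H * dProb H G := by
  have hp : (1 : ℝ) < p := by exact_mod_cast (Fact.out : p.Prime).one_lt
  have hp' : 0 < 1 - (p : ℝ)⁻¹ := sub_pos.2 (inv_lt_one_of_one_lt₀ hp)
  choose A hA using fun H : X₁ p => exists_equiv_prod H.rep.carrier H.rep.finrank_eq
  have hAut : ∀ (M : Type) [AddCommGroup M] [Module ℤ_[p] M] [Finite M],
      (0 : ℝ) < Nat.card (M ≃ₗ[ℤ_[p]] M) := fun M _ _ _ => by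
    have : Nonempty (M ≃ₗ[ℤ_[p]] M) := ⟨LinearEquiv.refl _ _⟩
    exact_mod_cast Nat.card_pos
  have hCard : ∀ (M : Type) [AddCommGroup M] [Finite M], (0 : ℝ) < Nat.card M :=
    fun M _ _ => by exact_mod_cast Nat.card_pos
  -- With `A` the torsion part of `H`, the weight is the inverse of `(1 - p⁻¹) |A| #Aut A`. The
  -- factor `1 - p⁻¹` is the one in `dProb_eq`, and `|A| #Aut A` is the size of the fibre over a
  -- character.
  refine ⟨fun H => ((1 - (p : ℝ)⁻¹) * (Nat.card (A H).carrier *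
    Nat.card ((A H).carrier ≃ₗ[ℤ_[p]] (A H).carrier)))⁻¹, fun H => ?_, fun G H => ?_⟩
  · exact inv_pos.2 (mul_pos hp' (mul_pos (hCard _) (hAut _)))
  obtain ⟨e⟩ := hA H
  obtain ⟨k, hk⟩ := exists_card_eq_pow p G.rep.carrier
  have hG := fun x : G.rep.carrier => pow_smul_eq_zero_of_card hk le_rfl x
  have h1 := card_surjective_cyclic_ker (A := (A H).carrier) hG
  have h2 := card_surjective_ker (p := p) H.rep.carrier G.rep.carrier
    (fun K => ∃ h, K = Submodule.span ℤ_[p] {h})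
  have h3 : Nat.card {f : H.rep.carrier →ₗ[ℤ_[p]] G.rep.carrier // Function.Surjective f ∧
        ∃ h, LinearMap.ker f = Submodule.span ℤ_[p] {h}} =
      Nat.card {f : ℤ_[p] × (A H).carrier →ₗ[ℤ_[p]] G.rep.carrier // Function.Surjective f ∧
        ∃ h, LinearMap.ker f = Submodule.span ℤ_[p] {h}} := by
    refine Nat.card_congr ((e.arrowCongr (LinearEquiv.refl ℤ_[p] G.rep.carrier)).toEquiv.subtypeEquiv
      fun f => ?_)
    have h4 : (e.arrowCongr (LinearEquiv.refl ℤ_[p] G.rep.carrier)) f = f ∘ₗ e.symm.toLinearMap := by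
      ext <;> simp
    change _ ↔ Function.Surjective ((e.arrowCongr (LinearEquiv.refl ℤ_[p] G.rep.carrier)) f) ∧
      ∃ h, LinearMap.ker ((e.arrowCongr (LinearEquiv.refl ℤ_[p] G.rep.carrier)) f) = _
    rw [h4]
    have h5 : LinearMap.ker (f ∘ₗ e.symm.toLinearMap) = (LinearMap.ker f).map e.toLinearMap := by
      rw [LinearMap.ker_comp]
      exact (Submodule.map_equiv_eq_comap_symm e _).symm
    rw [h5]
    refine and_congr ?_ ?_
    · exact (e.symm.surjective.of_comp_iff f).symm
    · constructor
      · rintro ⟨h, hh⟩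
        exact ⟨e h, by rw [hh, Submodule.map_span, Set.image_singleton]; rfl⟩
      · rintro ⟨h, hh⟩
        refine ⟨e.symm h, ?_⟩
        have := congrArg (Submodule.map e.symm.toLinearMap) hh
        rw [← Submodule.map_comp, Submodule.map_span, Set.image_singleton] at this
        simpa using this
  have h6 : Nat.card {χ : G.rep.carrier →ₗ[ℤ_[p]] Cyc p k //
        Nonempty (fiberProd χ ≃ₗ[ℤ_[p]] H.rep.carrier)} =
      Nat.card {χ : G.rep.carrier →ₗ[ℤ_[p]] Cyc p k //
        Nonempty ((A H).carrier ≃ₗ[ℤ_[p]] LinearMap.ker χ)} := by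
    refine Nat.card_congr (Equiv.subtypeEquivRight fun χ => ?_)
    rw [← nonempty_fiberProd_equiv_iff G.rep (A H) hG χ]
    exact ⟨fun ⟨f⟩ => ⟨f.trans e⟩, fun ⟨f⟩ => ⟨f.trans e.symm⟩⟩
  rw [dStarProb_eq G hG, dProb_eq, h6]
  rw [← h3, h2] at h1
  have h7 := congrArg (Nat.cast (R := ℝ)) h1
  push_cast at h7
  have ha := hAut G.rep.carrier
  have hb := hAut (A H).carrier
  have hc := hCard (A H).carrier
  have hd : (0 : ℝ) < G.card := hCard G.rep.carrier
  change (0 : ℝ) < G.cardAut at ha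
  change (_ : ℝ) * G.cardAut = _ at h7
  have hne := hp'.ne'
  rw [inv_mul_eq_div, inv_mul_eq_div, div_eq_div_iff ha.ne' (mul_pos hp' (mul_pos hc hb)).ne']
  rw [div_mul_eq_mul_div, mul_div_assoc', div_mul_eq_mul_div]
  congr 1
  linear_combination (-(1 - (p : ℝ)⁻¹)) * h7

end CohenLenstra
end
noncomputable section

namespace CohenLenstra

open Module

variable {p : ℕ} [Fact p.Prime]

/-! ### The constant `c₀` -/

theorem one_lt_p (p : ℕ) [Fact p.Prime] : (1 : ℝ) < p := by
  exact_mod_cast (Fact.out : p.Prime).one_lt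

theorem p_pos (p : ℕ) [Fact p.Prime] : (0 : ℝ) < p := zero_lt_one.trans (one_lt_p p)

theorem one_sub_pow_pos (p : ℕ) [Fact p.Prime] (j : ℕ) : 0 < 1 - 1 / (p : ℝ) ^ (j + 1) := by
  rw [sub_pos, div_lt_one (pow_pos (p_pos p) _)]
  exact one_lt_pow₀ (one_lt_p p) (Nat.succ_ne_zero j)

theorem one_sub_pow_le_one (p : ℕ) [Fact p.Prime] (j : ℕ) : 1 - 1 / (p : ℝ) ^ (j + 1) ≤ 1 := by
  have := p_pos p
  rw [sub_le_self_iff]; positivity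

theorem multipliable_c₀ (p : ℕ) [Fact p.Prime] :
    (Multipliable fun j : ℕ => 1 - 1 / (p : ℝ) ^ (j + 1)) ∧
      ∏' j : ℕ, (1 - 1 / (p : ℝ) ^ (j + 1)) ≠ 0 := by
  have hs : Summable fun j : ℕ => ‖-(1 / (p : ℝ) ^ (j + 1))‖ := by
    have h1 : Summable fun j : ℕ => (1 / (p : ℝ)) ^ j :=
      summable_geometric_of_lt_one (by have := p_pos p; positivity)
        ((div_lt_one (p_pos p)).2 (one_lt_p p))
    have h2 := (summable_nat_add_iff 1).2 h1
    refine h2.congr fun j => ?_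
    rw [norm_neg, Real.norm_of_nonneg (by have := p_pos p; positivity), one_div_pow]
  simp_rw [sub_eq_add_neg]
  refine ⟨multipliable_one_add_of_summable hs, tprod_one_add_ne_zero_of_summable (fun j => ?_) hs⟩
  rw [← sub_eq_add_neg]
  exact (one_sub_pow_pos p j).ne'

theorem c₀_le_prod (p : ℕ) [Fact p.Prime] (n : ℕ) :
    c₀ p ≤ ∏ j ∈ Finset.range n, (1 - 1 / (p : ℝ) ^ (j + 1)) := by
  refine Antitone.le_of_tendsto (antitone_nat_of_succ_le fun n => ?_)
    (multipliable_c₀ p).1.hasProd.tendsto_prod_nat n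
  rw [Finset.prod_range_succ]
  exact mul_le_of_le_one_right (Finset.prod_nonneg fun j _ => (one_sub_pow_pos p j).le)
    (one_sub_pow_le_one p n)

theorem c₀_pos (p : ℕ) [Fact p.Prime] : 0 < c₀ p := by
  refine lt_of_le_of_ne ?_ (multipliable_c₀ p).2.symm
  exact ge_of_tendsto' (multipliable_c₀ p).1.hasProd.tendsto_prod_nat
    fun n => Finset.prod_nonneg fun j _ => (one_sub_pow_pos p j).le

/-! ### The submodule `pM` -/

/-- The submodule `pM`. -/
def pRange (p : ℕ) [Fact p.Prime] (M : Type*) [AddCommGroup M] [Module ℤ_[p] M] :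
    Submodule ℤ_[p] M := LinearMap.range (LinearMap.lsmul ℤ_[p] M (p : ℤ_[p]))

theorem smul_mem_pRange {M : Type*} [AddCommGroup M] [Module ℤ_[p] M] (x : M) :
    (p : ℤ_[p]) • x ∈ pRange p M := ⟨x, rfl⟩

theorem map_pRange {M N : Type*} [AddCommGroup M] [Module ℤ_[p] M] [AddCommGroup N]
    [Module ℤ_[p] N] {f : M →ₗ[ℤ_[p]] N} (hf : Function.Surjective f) :
    (pRange p M).map f = pRange p N := by
  ext y
  constructor
  · rintro ⟨_, ⟨x, rfl⟩, rfl⟩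
    exact ⟨f x, (map_smul f _ _).symm⟩
  · rintro ⟨z, rfl⟩
    obtain ⟨x, rfl⟩ := hf z
    exact ⟨_, ⟨x, rfl⟩, map_smul f _ _⟩

theorem nonempty_pRange_equiv {M N : Type*} [AddCommGroup M] [Module ℤ_[p] M]
    [AddCommGroup N] [Module ℤ_[p] N] (e : M ≃ₗ[ℤ_[p]] N) :
    Nonempty (pRange p M ≃ₗ[ℤ_[p]] pRange p N) :=
  ⟨(e.submoduleMap (pRange p M)).trans (LinearEquiv.ofEq _ _ (map_pRange e.surjective))⟩

/-- Nakayama's lemma. -/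
theorem eq_top_of_sup_pRange {G : Type*} [AddCommGroup G] [Module ℤ_[p] G] [Finite G]
    (N : Submodule ℤ_[p] G) (h : N ⊔ pRange p G = ⊤) : N = ⊤ := by
  obtain ⟨k, hk⟩ := exists_card_eq_pow p G
  have key : ∀ j : ℕ, ∀ x : G, ∃ y : G, x - (p : ℤ_[p]) ^ j • y ∈ N := by
    intro j
    induction j with
    | zero => intro x; exact ⟨x, by simp⟩
    | succ j ih =>
      intro x
      obtain ⟨y, hy⟩ := ih x
      have hm : y ∈ N ⊔ pRange p G := h ▸ Submodule.mem_top
      obtain ⟨a, ha, _, ⟨z, rfl⟩, rfl⟩ := Submodule.mem_sup.1 hm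
      refine ⟨z, ?_⟩
      have := N.add_mem hy (N.smul_mem ((p : ℤ_[p]) ^ j) ha)
      convert this using 1
      simp only [LinearMap.lsmul_apply, smul_add, pow_succ, mul_smul]
      abel
  rw [eq_top_iff]
  intro x _
  obtain ⟨y, hy⟩ := key k x
  rwa [pow_smul_eq_zero_of_card hk le_rfl, sub_zero] at hy

/-! ### Generating tuples -/

/-- The number of generating `n`-tuples. -/
def genCard (p : ℕ) [Fact p.Prime] (n : ℕ) (G : Type*) [AddCommGroup G] [Module ℤ_[p] G] : ℕ :=
  Nat.card {x : Fin n → G // Submodule.span ℤ_[p] (Set.range x) = ⊤}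

theorem genCard_le (n : ℕ) (G : Type*) [AddCommGroup G] [Module ℤ_[p] G] [Finite G] :
    genCard p n G ≤ Nat.card G ^ n := by
  have := Nat.card_le_card_of_injective
    (Subtype.val : {x : Fin n → G // Submodule.span ℤ_[p] (Set.range x) = ⊤} → _)
    Subtype.val_injective
  simpa [Nat.card_pi, genCard] using this

/-- All fibres of a surjective homomorphism have the same size; a set-theoretic section `s` makes
this an explicit bijection. -/
theorem card_subtype_comp_mul {A B : Type*} [Finite A] [Finite B] [AddGroup A] [AddGroup B]
    (Φ : A →+ B) (hΦ : Function.Surjective Φ) (S : B → Prop) :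
    Nat.card {a // S (Φ a)} * Nat.card B = Nat.card {b // S b} * Nat.card A := by
  obtain ⟨s, hs⟩ := hΦ.hasRightInverse
  rw [← Nat.card_prod, ← Nat.card_prod]
  exact Nat.card_congr
    { toFun := fun x => (⟨Φ x.1.1, x.1.2⟩, x.1.1 - s (Φ x.1.1) + s x.2)
      invFun := fun y => (⟨y.2 - s (Φ y.2) + s y.1.1, by simpa [hs _] using y.1.2⟩, Φ y.2)
      left_inv := fun x => by
        ext <;> simp [hs _]
      right_inv := fun y => by
        ext <;> simp [hs _] }

theorem span_range_eq_top_iff {n : ℕ} {G : Type*} [AddCommGroup G] [Module ℤ_[p] G] [Finite G]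
    (x : Fin n → G) : Submodule.span ℤ_[p] (Set.range x) = ⊤ ↔
      Submodule.span ℤ_[p] (Set.range fun i => (pRange p G).mkQ (x i)) = ⊤ := by
  have h1 : Submodule.span ℤ_[p] (Set.range fun i => (pRange p G).mkQ (x i)) =
      (Submodule.span ℤ_[p] (Set.range x)).map (pRange p G).mkQ := by
    rw [Submodule.map_span, ← Set.range_comp]; rfl
  rw [h1]
  constructor
  · intro h
    rw [h, Submodule.map_top, Submodule.range_mkQ]
  · intro h
    refine eq_top_of_sup_pRange _ ?_
    have := congrArg (Submodule.comap (pRange p G).mkQ) h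
    rwa [Submodule.comap_map_mkQ, Submodule.comap_top, sup_comm] at this

theorem card_linearIndependent_zmod (V : Type*) [AddCommGroup V] [Module (ZMod p) V] [Finite V]
    {r : ℕ} (hr : Nat.card V = p ^ r) :
    (Nat.card {s : Fin r → V // LinearIndependent (ZMod p) s} : ℝ) =
      (Nat.card V : ℝ) ^ r * ∏ j ∈ Finset.range r, (1 - 1 / (p : ℝ) ^ (j + 1)) := by
  have hp : p.Prime := Fact.out
  have : Fintype V := Fintype.ofFinite V
  have hfr : finrank (ZMod p) V = r := by
    have h1 := FiniteField.pow_finrank_eq_natCard p V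
    exact Nat.pow_right_injective hp.two_le (h1.trans hr)
  rw [card_linearIndependent hfr.ge, hfr, ZMod.card, hr,
    Fin.prod_univ_eq_prod_range (fun i => p ^ r - p ^ i),
    ← Finset.prod_range_reflect (fun j => 1 - 1 / (p : ℝ) ^ (j + 1)), Nat.cast_prod,
    show ((p ^ r : ℕ) : ℝ) ^ r = ∏ _i ∈ Finset.range r, (p : ℝ) ^ r by simp,
    ← Finset.prod_mul_distrib]
  refine Finset.prod_congr rfl fun i hi => ?_
  have hi := Finset.mem_range.1 hi
  have hp0 := p_pos p
  rw [Nat.cast_sub (Nat.pow_le_pow_right hp.pos hi.le), mul_sub, mul_one, Nat.cast_pow,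
    Nat.cast_pow, show r - 1 - i + 1 = r - i by omega, mul_one_div, pow_sub₀ _ hp0.ne' hi.le]
  field_simp

theorem span_eq_top_of_linearIndependent_zmod {V : Type*} [AddCommGroup V] [Module (ZMod p) V]
    [Module ℤ_[p] V] [Finite V] {r : ℕ} (hr : Nat.card V = p ^ r) {s : Fin r → V}
    (hs : LinearIndependent (ZMod p) s) : Submodule.span ℤ_[p] (Set.range s) = ⊤ := by
  have hp : p.Prime := Fact.out
  have hfr : finrank (ZMod p) V = r := by
    have h1 := FiniteField.pow_finrank_eq_natCard p V
    exact Nat.pow_right_injective hp.two_le (h1.trans hr)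
  have h3 : Submodule.span (ZMod p) (Set.range s) = ⊤ :=
    hs.span_eq_top_of_card_eq_finrank' (by rw [hfr, Fintype.card_fin])
  rw [eq_top_iff]
  intro v _
  have hv : v ∈ Submodule.span (ZMod p) (Set.range s) := by rw [h3]; exact Submodule.mem_top
  clear * - hv
  induction hv using Submodule.span_induction with
  | mem x hx => exact Submodule.subset_span hx
  | zero => exact zero_mem _
  | add x y _ _ hx hy => exact add_mem hx hy
  | smul c x _ hx =>
    rw [← ZMod.natCast_zmod_val c, Nat.cast_smul_eq_nsmul]
    exact nsmul_mem hx _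

/-- The proportion of generating tuples of a vector space over `𝔽_p`. -/
theorem c₀_mul_le_genCard_of_p_smul {V : Type*} [AddCommGroup V] [Module ℤ_[p] V] [Finite V]
    (hV : ∀ x : V, (p : ℤ_[p]) • x = 0) {r : ℕ} (hr : Nat.card V = p ^ r) :
    c₀ p * (Nat.card V : ℝ) ^ r ≤ genCard p r V := by
  let _ : Module (ZMod p) V := AddCommGroup.zmodModule fun x => by
    rw [← Nat.cast_smul_eq_nsmul ℤ_[p]]; exact hV x
  have h2 : Nat.card {s : Fin r → V // LinearIndependent (ZMod p) s} ≤ genCard p r V :=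
    Nat.card_le_card_of_injective
      (fun s => ⟨s.1, span_eq_top_of_linearIndependent_zmod hr s.2⟩)
      fun s t h => Subtype.ext (congrArg (fun z => z.1) h)
  have h3 := card_linearIndependent_zmod V hr
  calc c₀ p * (Nat.card V : ℝ) ^ r
      ≤ (∏ j ∈ Finset.range r, (1 - 1 / (p : ℝ) ^ (j + 1))) * (Nat.card V : ℝ) ^ r := by
        gcongr; exact c₀_le_prod p r
    _ ≤ genCard p r V := by rw [mul_comm, ← h3]; exact_mod_cast h2

/-- By Nakayama it suffices that the first `r` entries form a generating tuple of `G/pG`, an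
`𝔽_p`-space of dimension `r`, and a proportion of at least `c₀` of the tuples does so. The bound is
uniform in `G` and `n`. -/
theorem c₀_mul_le_genCard {G : Type*} [AddCommGroup G] [Module ℤ_[p] G] [Finite G] {r n : ℕ}
    (hr : Nat.card (G ⧸ pRange p G) = p ^ r) (hn : r ≤ n) :
    c₀ p * (Nat.card G : ℝ) ^ n ≤ genCard p n G := by
  let V := G ⧸ pRange p G
  have hV : ∀ x : V, (p : ℤ_[p]) • x = 0 := fun x => by
    obtain ⟨y, rfl⟩ := (pRange p G).mkQ_surjective x
    rw [← map_smul, Submodule.mkQ_apply, Submodule.Quotient.mk_eq_zero]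
    exact smul_mem_pRange y
  have h0 := c₀_mul_le_genCard_of_p_smul hV hr
  let Φ : (Fin n → G) →+ (Fin r → V) :=
    { toFun := fun x i => (pRange p G).mkQ (x (Fin.castLE hn i))
      map_zero' := by ext; simp
      map_add' := fun x y => by ext; simp }
  have hΦ : Function.Surjective Φ := fun v => by
    choose y hy using fun i => (pRange p G).mkQ_surjective (v i)
    refine ⟨fun j => if h : (j : ℕ) < r then y ⟨j, h⟩ else 0, ?_⟩
    ext i
    simp [Φ, ← hy i]
  have h1 := card_subtype_comp_mul Φ hΦ fun v => Submodule.span ℤ_[p] (Set.range v) = ⊤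
  have h2 : Nat.card {a // Submodule.span ℤ_[p] (Set.range (Φ a)) = ⊤} ≤ genCard p n G := by
    have hle : ∀ a : {a // Submodule.span ℤ_[p] (Set.range (Φ a)) = ⊤},
        Submodule.span ℤ_[p] (Set.range a.1) = ⊤ := fun a => by
      rw [span_range_eq_top_iff, eq_top_iff]
      refine a.2.ge.trans (Submodule.span_mono ?_)
      rintro _ ⟨i, rfl⟩
      exact ⟨_, rfl⟩
    exact Nat.card_le_card_of_injective (fun a => ⟨a.1, hle a⟩)
      fun s t h => Subtype.ext (congrArg (fun z => z.1) h)
  rw [Nat.card_fun, Nat.card_fun, Nat.card_fin, Nat.card_fin] at h1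
  have h3 : (0 : ℝ) < (Nat.card V : ℝ) ^ r := by
    have := Nat.card_pos (α := V); positivity
  refine le_of_mul_le_mul_right ?_ h3
  calc c₀ p * (Nat.card G : ℝ) ^ n * (Nat.card V : ℝ) ^ r
      = (c₀ p * (Nat.card V : ℝ) ^ r) * (Nat.card G : ℝ) ^ n := by ring
    _ ≤ genCard p r V * (Nat.card G : ℝ) ^ n := by gcongr
    _ = Nat.card {a // Submodule.span ℤ_[p] (Set.range (Φ a)) = ⊤} * (Nat.card V : ℝ) ^ r := by
        exact_mod_cast h1.symm
    _ ≤ genCard p n G * (Nat.card V : ℝ) ^ r := by gcongr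

/-- Generating tuples are surjections from a free module. -/
theorem surCard_free (n : ℕ) (G : Type*) [AddCommGroup G] [Module ℤ_[p] G] :
    surCard p (Fin n → ℤ_[p]) G = genCard p n G := by
  let b := Pi.basisFun ℤ_[p] (Fin n)
  refine (Nat.card_congr ((b.constr ℤ_[p]).toEquiv.subtypeEquiv fun x => ?_)).symm
  rw [← LinearMap.range_eq_top]
  change _ ↔ LinearMap.range (b.constr ℤ_[p] x) = ⊤
  rw [b.constr_range]

end CohenLenstra
end
noncomputable section

namespace CohenLenstra

open Module

variable {p : ℕ} [Fact p.Prime]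

/-! ### Summability of the moments -/

theorem homCard_le_pow {M S : Type*} [AddCommGroup M] [Module ℤ_[p] M] [AddCommGroup S]
    [Module ℤ_[p] S] [Finite S] {n : ℕ} {x : Fin n → M}
    (hx : Submodule.span ℤ_[p] (Set.range x) = ⊤) :
    Nat.card (M →ₗ[ℤ_[p]] S) ≤ Nat.card S ^ n := by
  have h := Nat.card_le_card_of_injective (fun (f : M →ₗ[ℤ_[p]] S) i => f (x i))
    fun f g h => LinearMap.ext_on_range hx fun i => congrFun h i
  simpa [Nat.card_pi] using h

theorem card_quotient_pRange (G : Type*) [AddCommGroup G] [Module ℤ_[p] G] [Finite G] :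
    Nat.card (G ⧸ pRange p G) = Nat.card {x : G // (p : ℤ_[p]) • x = 0} :=
  (card_ker_eq_card_quotient_range (LinearMap.lsmul ℤ_[p] G (p : ℤ_[p]))).symm

theorem cardAut_pos (G : X₀ p) : 0 < (G.cardAut : ℝ) := by
  have : 0 < Nat.card (G.rep.carrier ≃ₗ[ℤ_[p]] G.rep.carrier) := Nat.card_pos
  exact_mod_cast this

theorem card_pos (G : X₀ p) : 0 < (G.card : ℝ) := by
  have : 0 < Nat.card G.rep.carrier := Nat.card_pos
  exact_mod_cast this

/-- The free module of rank `N` over `ℤ_p / p^N`. -/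
abbrev FreeCyc (p : ℕ) [Fact p.Prime] (N : ℕ) : Type := Fin N → Cyc p N

/-- The rank does not grow on submodules, because `|K/pK| = |K[p]|` and `K[p]` sits inside the
`p`-torsion of the free module, of order `p^N`. -/
theorem card_quotient_pRange_submodule_le {N : ℕ} (hN : 1 ≤ N) (K : Submodule ℤ_[p] (FreeCyc p N)) :
    Nat.card (K ⧸ pRange p K) ≤ p ^ N := by
  have h1 : Nat.card {x : FreeCyc p N // (p : ℤ_[p]) • x = 0} = p ^ N := by
    rw [Nat.card_congr (β := Fin N → {x : Cyc p N // (p : ℤ_[p]) ^ 1 • x = 0})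
      { toFun := fun x i => ⟨x.1 i, by rw [pow_one]; exact congrFun x.2 i⟩
        invFun := fun y => ⟨fun i => (y i).1, funext fun i => by
          have h := (y i).2
          have h2 : (p : ℤ_[p]) ^ 1 = p := pow_one _
          exact (congrArg (fun a : ℤ_[p] => a • (y i).1) h2).symm.trans h⟩
        left_inv := fun x => rfl
        right_inv := fun x => rfl }, Nat.card_fun, card_Cyc_torsion hN, Nat.card_fin, pow_one]
  rw [card_quotient_pRange, ← h1]
  refine Nat.card_le_card_of_injective (fun x => ⟨x.1.1, ?_⟩) fun x y h => ?_
  · exact congrArg Subtype.val x.2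
  · exact Subtype.ext (Subtype.ext (congrArg (fun z => z.1) h))

theorem c₀_mul_card_pow_le_genCard {G : Type*} [AddCommGroup G] [Module ℤ_[p] G] [Finite G] {n : ℕ}
    (hn : Nat.card (G ⧸ pRange p G) ≤ p ^ n) : c₀ p * (Nat.card G : ℝ) ^ n ≤ genCard p n G := by
  obtain ⟨r, hr⟩ := exists_card_eq_pow p (G ⧸ pRange p G)
  refine c₀_mul_le_genCard hr ?_
  rw [hr] at hn
  exact (Nat.pow_le_pow_iff_right (Fact.out : p.Prime).one_lt).1 hn

theorem genCard_le_surCard {N : ℕ} {G : Type*} [AddCommGroup G] [Module ℤ_[p] G] [Finite G]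
    (hG : ∀ x : G, (p : ℤ_[p]) ^ N • x = 0) : genCard p N G ≤ surCard p (FreeCyc p N) G := by
  let f : (Fin N → G) → (FreeCyc p N →ₗ[ℤ_[p]] G) := fun x =>
    LinearMap.lsum ℤ_[p] (fun _ : Fin N => Cyc p N) ℤ_[p] fun i =>
      Submodule.liftQSpanSingleton ((p : ℤ_[p]) ^ N) (LinearMap.toSpanSingleton ℤ_[p] G (x i))
        (by simpa using hG (x i))
  have hf : ∀ x i, f x (Pi.single i (Ideal.Quotient.mk _ 1)) = x i := fun x i => by
    simp only [f, LinearMap.lsum_piSingle]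
    change LinearMap.toSpanSingleton ℤ_[p] G (x i) 1 = x i
    simp
  refine Nat.card_le_card_of_injective (fun x => ⟨f x.1, ?_⟩) fun x y h => ?_
  · rw [← LinearMap.range_eq_top, eq_top_iff]
    refine x.2.ge.trans (Submodule.span_le.2 ?_)
    rintro _ ⟨i, rfl⟩
    exact ⟨_, hf x.1 i⟩
  · have h1 : f x.1 = f y.1 := congrArg (fun z => z.1) h
    refine Subtype.ext (funext fun i => ?_)
    rw [← hf x.1 i, h1, hf]

/-- This bounds `1/#Aut G` by the number of submodules of one fixed finite module with quotient `G`,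
so that sums over `G` become sums over submodules. -/
theorem c₀_mul_le_card_submodule (G : X₀ p) {N : ℕ} (hN : G.card ≤ p ^ N) :
    c₀ p * (G.card : ℝ) ^ N ≤
      Nat.card {K : Submodule ℤ_[p] (FreeCyc p N) //
        Nonempty ((FreeCyc p N ⧸ K) ≃ₗ[ℤ_[p]] G.rep.carrier)} * G.cardAut := by
  have h1 : Nat.card (G.rep.carrier ⧸ pRange p G.rep.carrier) ≤ p ^ N :=
    (Nat.card_le_card_of_surjective _ (Submodule.mkQ_surjective _)).trans hN
  obtain ⟨k, hk⟩ := exists_card_eq_pow p G.rep.carrier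
  have hkN : k ≤ N := by
    rw [X₀.card, hk] at hN
    exact (Nat.pow_le_pow_iff_right (Fact.out : p.Prime).one_lt).1 hN
  have h2 := c₀_mul_card_pow_le_genCard h1
  have h3 := genCard_le_surCard (pow_smul_eq_zero_of_card hk hkN)
  rw [surCard_eq] at h3
  refine h2.trans ?_
  exact_mod_cast h3

theorem genCard_submodule {n : ℕ} {P : Type*} [AddCommGroup P] [Module ℤ_[p] P]
    (K : Submodule ℤ_[p] P) :
    genCard p n K = Nat.card {x : Fin n → P // Submodule.span ℤ_[p] (Set.range x) = K} := by
  have key : ∀ x : Fin n → K, (Submodule.span ℤ_[p] (Set.range x)).map K.subtype =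
      Submodule.span ℤ_[p] (Set.range fun i => (x i : P)) := fun x => by
    rw [Submodule.map_span, ← Set.range_comp]; rfl
  have key2 : ∀ x : Fin n → K, Submodule.span ℤ_[p] (Set.range x) = ⊤ ↔
      Submodule.span ℤ_[p] (Set.range fun i => (x i : P)) = K := fun x => by
    rw [← key, ← (Submodule.map_injective_of_injective K.injective_subtype).eq_iff,
      Submodule.map_subtype_top]
  exact Nat.card_congr
    { toFun := fun x => ⟨fun i => (x.1 i : P), (key2 x.1).1 x.2⟩
      invFun := fun y => ⟨fun i => ⟨y.1 i, y.2.le (Submodule.subset_span ⟨i, rfl⟩)⟩,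
        (key2 _).2 y.2⟩
      left_inv := fun x => rfl
      right_inv := fun y => rfl }

/-- Each `n`-tuple in `W` generates exactly one submodule `K ≤ W`. -/
theorem sum_genCard_le {n : ℕ} {P : Type*} [AddCommGroup P] [Module ℤ_[p] P] [Finite P]
    [Fintype (Submodule ℤ_[p] P)] [DecidableRel fun K W : Submodule ℤ_[p] P => K ≤ W]
    (W : Submodule ℤ_[p] P) :
    ∑ K with K ≤ W, genCard p n K = Nat.card W ^ n := by
  classical
  have := Fintype.ofFinite P
  have h1 : Nat.card (Fin n → W) =
      Nat.card {x : Fin n → P // Submodule.span ℤ_[p] (Set.range x) ≤ W} :=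
    Nat.card_congr
      { toFun := fun x => ⟨fun i => (x i : P), by
          rw [Submodule.span_le]; rintro _ ⟨i, rfl⟩; exact (x i).2⟩
        invFun := fun y i => ⟨y.1 i, y.2 (Submodule.subset_span ⟨i, rfl⟩)⟩
        left_inv := fun x => rfl
        right_inv := fun y => rfl }
  rw [Nat.card_fun, Nat.card_fin] at h1
  rw [h1, Nat.card_eq_fintype_card, Fintype.card_subtype, Finset.card_eq_sum_card_fiberwise
    (f := fun x : Fin n → P => Submodule.span ℤ_[p] (Set.range x))
    (t := Finset.univ.filter fun K => K ≤ W) (fun x hx => by simpa using hx)]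
  refine Finset.sum_congr rfl fun K hK => ?_
  rw [genCard_submodule, Nat.card_eq_fintype_card, Fintype.card_subtype, Finset.filter_filter]
  congr 1
  ext x
  simp only [Finset.mem_filter, Finset.mem_univ, true_and] at hK ⊢
  exact ⟨fun h => ⟨h.trans_le hK, h⟩, fun h => h.2⟩

theorem sum_card_pow_le {N : ℕ} (hN : 1 ≤ N) [Fintype (Submodule ℤ_[p] (FreeCyc p N))]
    [DecidableRel fun K W : Submodule ℤ_[p] (FreeCyc p N) => K ≤ W]
    (W : Submodule ℤ_[p] (FreeCyc p N)) :
    ∑ K with K ≤ W, (Nat.card K : ℝ) ^ N ≤ (c₀ p)⁻¹ * (Nat.card W : ℝ) ^ N := by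
  rw [le_inv_mul_iff₀ (c₀_pos p), Finset.mul_sum]
  calc ∑ K with K ≤ W, c₀ p * (Nat.card K : ℝ) ^ N
      ≤ ∑ K with K ≤ W, (genCard p N K : ℝ) := Finset.sum_le_sum fun K _ =>
        c₀_mul_card_pow_le_genCard (card_quotient_pRange_submodule_le hN K)
    _ = (Nat.card W : ℝ) ^ N := by exact_mod_cast sum_genCard_le W

theorem FreeCyc_span (N : ℕ) : ∃ x : Fin N → FreeCyc p N,
    Submodule.span ℤ_[p] (Set.range x) = ⊤ := by
  refine ⟨fun i => Pi.single i (Ideal.Quotient.mk _ 1), ?_⟩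
  rw [eq_top_iff]
  intro y _
  have h : y = ∑ i, Pi.single i (y i) := (Finset.univ_sum_single y).symm
  rw [h]
  refine sum_mem fun i _ => ?_
  obtain ⟨z, hz⟩ := Ideal.Quotient.mk_surjective (y i)
  have h2 : Pi.single i (y i) = z • (Pi.single i (Ideal.Quotient.mk _ 1) : FreeCyc p N) := by
    rw [← Pi.single_smul, smul_mk, mul_one, hz]
  rw [h2]
  exact Submodule.smul_mem _ _ (Submodule.subset_span ⟨i, rfl⟩)

/-- Sort `f` by its image `S`. The source has `N` generators, so at most `|S|^N` maps have image `S`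
and each `S` contributes at most `1`. -/
theorem sum_inv_card_range_pow_le (N : ℕ) (B : Type*) [AddCommGroup B] [Module ℤ_[p] B] [Finite B]
    [Fintype (FreeCyc p N →ₗ[ℤ_[p]] B)] :
    ∑ f : FreeCyc p N →ₗ[ℤ_[p]] B, ((Nat.card (LinearMap.range f) : ℝ) ^ N)⁻¹ ≤
      Nat.card (Submodule ℤ_[p] B) := by
  classical
  have := Fintype.ofFinite (Submodule ℤ_[p] B)
  obtain ⟨x, hx⟩ := FreeCyc_span (p := p) N
  rw [← Finset.sum_fiberwise (s := Finset.univ) (g := fun f => LinearMap.range f),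
    Nat.card_eq_fintype_card, ← Finset.card_univ, Finset.card_eq_sum_ones, Nat.cast_sum]
  refine Finset.sum_le_sum fun S _ => ?_
  have h1 : ∀ f ∈ Finset.univ.filter fun f : FreeCyc p N →ₗ[ℤ_[p]] B => LinearMap.range f = S,
      ((Nat.card (LinearMap.range f) : ℝ) ^ N)⁻¹ = ((Nat.card S : ℝ) ^ N)⁻¹ := fun f hf => by
    rw [(Finset.mem_filter.1 hf).2]
  rw [Finset.sum_congr rfl h1, Finset.sum_const, nsmul_eq_mul, Nat.cast_one]
  have hpos : (0 : ℝ) < (Nat.card S : ℝ) ^ N := by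
    have := Nat.card_pos (α := S); positivity
  rw [mul_inv_le_iff₀ hpos, one_mul]
  have h2 : (Finset.univ.filter fun f : FreeCyc p N →ₗ[ℤ_[p]] B => LinearMap.range f = S).card ≤
      Nat.card (FreeCyc p N →ₗ[ℤ_[p]] S) := by
    rw [← Fintype.card_subtype, ← Nat.card_eq_fintype_card]
    refine Nat.card_le_card_of_injective
      (fun f => f.1.codRestrict S fun c => f.2.le ⟨c, rfl⟩) fun f g h => ?_
    refine Subtype.ext (LinearMap.ext fun c => ?_)
    exact congrArg Subtype.val (LinearMap.congr_fun h c)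
  exact_mod_cast h2.trans (homCard_le_pow hx)

/-- Choose `N` so large that all `G ∈ s` are quotients of `P = (ℤ_p/p^N)^N`. The sum is then at most
`c₀⁻¹` times the sum of `#Hom(P/K, B) / |P/K|^N` over `K`, which equals the sum of `(|K|/|P|)^N`
over pairs `K ≤ ker f`, `f : P → B`. Summing over `K` costs another `c₀⁻¹` and leaves `∑_f |im
f|^(-N)`. The bound obtained does not depend on `N`. -/
theorem sum_homCard_div_cardAut_le (B : Type) [AddCommGroup B] [Module ℤ_[p] B] [Finite B]
    (s : Finset (X₀ p)) :
    ∑ G ∈ s, (Nat.card (G.rep.carrier →ₗ[ℤ_[p]] B) : ℝ) / G.cardAut ≤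
      (c₀ p)⁻¹ * ((c₀ p)⁻¹ * Nat.card (Submodule ℤ_[p] B)) := by
  classical
  obtain ⟨N, hN1, hN⟩ : ∃ N, 1 ≤ N ∧ ∀ G ∈ s, G.card ≤ p ^ N := by
    refine ⟨1 + ∑ G ∈ s, G.card, by omega, fun G hG => ?_⟩
    have h1 : G.card ≤ ∑ G ∈ s, G.card := Finset.single_le_sum (fun _ _ => Nat.zero_le _) hG
    exact (Nat.lt_pow_self (Fact.out : p.Prime).one_lt).le.trans
      (Nat.pow_le_pow_right (Fact.out : p.Prime).pos (h1.trans (by omega)))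
  let P := FreeCyc p N
  have := Fintype.ofFinite (Submodule ℤ_[p] P)
  have := Fintype.ofFinite (P →ₗ[ℤ_[p]] B)
  have hc := c₀_pos p
  have hPpos : (0 : ℝ) < Nat.card P := by exact_mod_cast Nat.card_pos
  let h : Submodule ℤ_[p] P → ℝ := fun K =>
    (Nat.card ((P ⧸ K) →ₗ[ℤ_[p]] B) : ℝ) / (Nat.card (P ⧸ K) : ℝ) ^ N
  have hh0 : ∀ K, 0 ≤ h K := fun K => by positivity
  have hbound : ∀ G ∈ s, (Nat.card (G.rep.carrier →ₗ[ℤ_[p]] B) : ℝ) / G.cardAut ≤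
      (c₀ p)⁻¹ * ∑ K : Submodule ℤ_[p] P, if cls p (P ⧸ K) = G then h K else 0 := fun G hG => by
    have h1 := c₀_mul_le_card_submodule G (hN G hG)
    have h2 : ∑ K : Submodule ℤ_[p] P, (if cls p (P ⧸ K) = G then h K else 0) =
        Nat.card {K : Submodule ℤ_[p] P // Nonempty ((P ⧸ K) ≃ₗ[ℤ_[p]] G.rep.carrier)} *
          ((Nat.card (G.rep.carrier →ₗ[ℤ_[p]] B) : ℝ) / (G.card : ℝ) ^ N) := by
      rw [← Finset.sum_filter, Nat.card_eq_fintype_card, Fintype.card_subtype, ← nsmul_eq_mul,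
        ← Finset.sum_const]
      refine Finset.sum_congr (Finset.filter_congr fun K _ => cls_eq_iff _ _) fun K hK => ?_
      obtain ⟨e⟩ := (Finset.mem_filter.1 hK).2
      simp only [h]
      rw [homCard_congr e (LinearEquiv.refl _ B), Nat.card_congr e.toEquiv]
      rfl
    have h3 := cardAut_pos G
    have h4 := card_pos G
    rw [h2, le_inv_mul_iff₀ hc, mul_div_assoc', div_le_iff₀ h3, mul_div_assoc', div_mul_eq_mul_div,
      le_div_iff₀ (by positivity)]
    calc c₀ p * (Nat.card (G.rep.carrier →ₗ[ℤ_[p]] B) : ℝ) * (G.card : ℝ) ^ N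
        = (Nat.card (G.rep.carrier →ₗ[ℤ_[p]] B) : ℝ) * (c₀ p * (G.card : ℝ) ^ N) := by ring
      _ ≤ (Nat.card (G.rep.carrier →ₗ[ℤ_[p]] B) : ℝ) * _ :=
          mul_le_mul_of_nonneg_left h1 (by positivity)
      _ = _ := by ring
  have hinner : ∑ G ∈ s, ∑ K : Submodule ℤ_[p] P, (if cls p (P ⧸ K) = G then h K else 0) ≤
      ∑ K, h K := by
    rw [Finset.sum_comm]
    refine Finset.sum_le_sum fun K _ => ?_
    rw [Finset.sum_ite_eq]
    split_ifs
    · exact le_rfl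
    · exact hh0 K
  have hfib : ∑ K, h K = ∑ f : P →ₗ[ℤ_[p]] B,
      ∑ K with K ≤ LinearMap.ker f, (Nat.card K : ℝ) ^ N / (Nat.card P : ℝ) ^ N := by
    simp_rw [Finset.sum_filter]
    rw [Finset.sum_comm]
    refine Finset.sum_congr rfl fun K _ => ?_
    rw [← Finset.sum_filter, Finset.sum_const, nsmul_eq_mul]
    simp only [h]
    have e1 : Nat.card ((P ⧸ K) →ₗ[ℤ_[p]] B) =
        (Finset.univ.filter fun f : P →ₗ[ℤ_[p]] B => K ≤ LinearMap.ker f).card := by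
      rw [← Fintype.card_subtype, ← Nat.card_eq_fintype_card]
      exact Nat.card_congr
        { toFun := fun f => ⟨f ∘ₗ K.mkQ, by
            intro x hx
            simp [(Submodule.Quotient.mk_eq_zero K).2 hx]⟩
          invFun := fun f => K.liftQ f.1 f.2
          left_inv := fun f => by ext; simp
          right_inv := fun f => by ext; simp }
    have e2 := K.card_eq_card_quotient_mul_card
    have e3 : (0 : ℝ) < Nat.card (P ⧸ K) := by exact_mod_cast Nat.card_pos
    have e4 : (0 : ℝ) < Nat.card K := by exact_mod_cast Nat.card_pos
    rw [e1, e2, Nat.cast_mul, mul_pow, div_eq_mul_inv]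
    congr 1
    field_simp
  have htotal : ∑ K, h K ≤ (c₀ p)⁻¹ * Nat.card (Submodule ℤ_[p] B) := by
    rw [hfib]
    calc _ ≤ ∑ f : P →ₗ[ℤ_[p]] B,
          (c₀ p)⁻¹ * ((Nat.card (LinearMap.range f) : ℝ) ^ N)⁻¹ := by
          refine Finset.sum_le_sum fun f _ => ?_
          rw [← Finset.sum_div]
          have e1 := sum_card_pow_le hN1 (LinearMap.ker f)
          have e2 := (LinearMap.ker f).card_eq_card_quotient_mul_card
          rw [Nat.card_congr f.quotKerEquivRange.toEquiv] at e2
          have e3 : (0 : ℝ) < Nat.card (LinearMap.range f) := by exact_mod_cast Nat.card_pos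
          have e4 : (0 : ℝ) < Nat.card (LinearMap.ker f) := by exact_mod_cast Nat.card_pos
          refine (div_le_div_of_nonneg_right e1 (by positivity)).trans (le_of_eq ?_)
          rw [e2, Nat.cast_mul, mul_pow]
          field_simp
          rfl
      _ ≤ _ := by
          rw [← Finset.mul_sum]
          exact mul_le_mul_of_nonneg_left (sum_inv_card_range_pow_le N B) (by positivity)
  calc _ ≤ ∑ G ∈ s, (c₀ p)⁻¹ * ∑ K : Submodule ℤ_[p] P, (if cls p (P ⧸ K) = G then h K else 0) :=
        Finset.sum_le_sum hbound
    _ ≤ _ := by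
        rw [← Finset.mul_sum]
        exact mul_le_mul_of_nonneg_left (hinner.trans htotal) (by positivity)

theorem summable_homCard_div_cardAut (B : Type) [AddCommGroup B] [Module ℤ_[p] B] [Finite B] :
    Summable fun G : X₀ p => (Nat.card (G.rep.carrier →ₗ[ℤ_[p]] B) : ℝ) / G.cardAut :=
  summable_of_sum_le (fun G => by positivity) (sum_homCard_div_cardAut_le B)

/-- A summable family of positive terms has a countable index set. -/
instance countable_X₀ : Countable (X₀ p) := by
  have h := (summable_homCard_div_cardAut (p := p) PUnit).countable_support
  rw [Function.support_eq_univ fun G => ?_] at h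
  · exact Set.countable_univ_iff.1 h
  · have := cardAut_pos G
    have h2 : 0 < Nat.card (G.rep.carrier →ₗ[ℤ_[p]] PUnit) := Nat.card_pos
    positivity

/-- All these `G` are quotients of the single finite module `FreeCyc p n`, because `n ≤ p^n`. -/
theorem finite_card_le (n : ℕ) : {G : X₀ p | G.card ≤ n}.Finite := by
  have hsub : {G : X₀ p | G.card ≤ n} ⊆
      Set.range fun K : Submodule ℤ_[p] (FreeCyc p n) => cls p (FreeCyc p n ⧸ K) := by
    intro G hG
    have hG' : G.card ≤ p ^ n := le_trans hG (Nat.lt_pow_self (Fact.out : p.Prime).one_lt).le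
    have h1 := c₀_mul_le_card_submodule G hG'
    have h2 : 0 < c₀ p * (G.card : ℝ) ^ n := mul_pos (c₀_pos p) (pow_pos (card_pos G) _)
    have h3 : Nat.card {K : Submodule ℤ_[p] (FreeCyc p n) //
        Nonempty ((FreeCyc p n ⧸ K) ≃ₗ[ℤ_[p]] G.rep.carrier)} ≠ 0 := fun h0 => by
      rw [h0, Nat.cast_zero, zero_mul] at h1
      exact absurd h1 h2.not_ge
    obtain ⟨K, hK⟩ := (Nat.card_ne_zero.1 h3).1
    exact ⟨K, (cls_eq_iff _ _).2 hK⟩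
  exact (Set.finite_range _).subset hsub

/-! ### Summation over the groups `G` with given rank and given `pG` -/

theorem card_free_quotient_pRange (n : ℕ) :
    Nat.card ((Fin n → ℤ_[p]) ⧸ pRange p (Fin n → ℤ_[p])) = p ^ n := by
  let φ : (Fin n → ℤ_[p]) →ₗ[ℤ_[p]] (Fin n → Cyc p 1) :=
    LinearMap.pi fun i => (Submodule.mkQ _) ∘ₗ LinearMap.proj i
  have hφ : Function.Surjective φ := fun y => by
    choose x hx using fun i => Ideal.Quotient.mk_surjective (y i)
    exact ⟨x, funext hx⟩
  have hk : LinearMap.ker φ = pRange p (Fin n → ℤ_[p]) := by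
    ext x
    rw [LinearMap.mem_ker, funext_iff]
    constructor
    · intro h
      choose y hy using fun i => mk_eq_zero_iff.1 (h i)
      exact ⟨y, funext fun i => ((hy i).trans (by rw [pow_one]; rfl)).symm⟩
    · rintro ⟨y, rfl⟩ i
      exact mk_eq_zero_iff.2 ⟨y i, by rw [pow_one]; rfl⟩
  rw [← hk, Nat.card_congr (φ.quotKerEquivOfSurjective hφ).toEquiv, Nat.card_fun, card_Cyc,
    Nat.card_fin, pow_one]

/-- A surjection from `ℤ_p^n` to a module of rank `n` is an isomorphism modulo `p`. -/
theorem le_pRange_of_card {n : ℕ} {G : Type} [AddCommGroup G] [Module ℤ_[p] G] [Finite G]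
    (hG : Nat.card (G ⧸ pRange p G) = p ^ n) {K : Submodule ℤ_[p] (Fin n → ℤ_[p])}
    (e : ((Fin n → ℤ_[p]) ⧸ K) ≃ₗ[ℤ_[p]] G) : K ≤ pRange p (Fin n → ℤ_[p]) := by
  let F := Fin n → ℤ_[p]
  let g : F →ₗ[ℤ_[p]] G := e.toLinearMap ∘ₗ K.mkQ
  have hg : Function.Surjective g := e.surjective.comp K.mkQ_surjective
  let ψ : (F ⧸ pRange p F) →ₗ[ℤ_[p]] (G ⧸ pRange p G) :=
    Submodule.mapQ _ _ g (Submodule.map_le_iff_le_comap.1 (map_pRange hg).le)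
  have hψ : Function.Surjective ψ := fun y => by
    obtain ⟨y, rfl⟩ := Submodule.mkQ_surjective _ y
    obtain ⟨x, rfl⟩ := hg y
    exact ⟨Submodule.Quotient.mk x, rfl⟩
  have hcard := card_free_quotient_pRange (p := p) n
  have hfin : Finite (F ⧸ pRange p F) := Nat.finite_of_card_ne_zero (by
    rw [hcard]; exact pow_ne_zero _ (Fact.out : p.Prime).ne_zero)
  have hinj : Function.Injective ψ :=
    (Nat.bijective_iff_surjective_and_card ψ).2 ⟨hψ, hcard.trans hG.symm⟩ |>.1
  intro x hx
  have h1 : ψ (Submodule.Quotient.mk x) = ψ 0 := by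
    have h2 : g x = 0 := by
      simp [g, (Submodule.Quotient.mk_eq_zero K).2 hx]
    rw [map_zero]
    change (Submodule.Quotient.mk (g x) : G ⧸ pRange p G) = 0
    rw [h2, Submodule.Quotient.mk_zero]
  exact (Submodule.Quotient.mk_eq_zero _).1 (hinj h1)

/-- Realise `G` as `F/K` with `F = ℤ_p^n`. Then `K ≤ pF`, and `K ↦ p⁻¹K` is an injection into the
submodules of `F` with quotient `pG ≅ G'`. There are at least `c₀ |G|^n / #Aut G` such `K` for each
`G`, where `|G| = p^n |G'|`, and at most `|G'|^n / #Aut G'` images; the ratio leaves the decisive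
factor `p^(-n²)`. -/
theorem sum_inv_cardAut_le (n : ℕ) (G' : X₀ p) (s : Finset (X₀ p))
    (hs : ∀ G ∈ s, Nat.card (G.rep.carrier ⧸ pRange p G.rep.carrier) = p ^ n ∧
      cls p (pRange p G.rep.carrier) = G') :
    ∑ G ∈ s, (G.cardAut : ℝ)⁻¹ ≤ (c₀ p)⁻¹ * ((p : ℝ) ^ (n * n))⁻¹ * (G'.cardAut : ℝ)⁻¹ := by
  classical
  let F := Fin n → ℤ_[p]
  let T : X₀ p → Type := fun G => {K : Submodule ℤ_[p] F // Nonempty ((F ⧸ K) ≃ₗ[ℤ_[p]] G.rep.carrier)}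
  have hT : ∀ G, Finite (T G) := fun G => by
    have := finite_submodule_of_quotient (p := p) F G.rep.carrier
      fun _ => True
    simpa only [and_true] using this
  have hTaut : ∀ G, Nat.card (T G) * G.cardAut = genCard p n G.rep.carrier := fun G => by
    rw [← surCard_free, surCard_eq]; rfl
  have hcard : ∀ G ∈ s, (G.card : ℝ) = p ^ n * G'.card := fun G hG => by
    have h1 := (pRange p G.rep.carrier).card_eq_card_quotient_mul_card
    obtain ⟨h2, rfl⟩ := hs G hG
    rw [h2] at h1
    rw [card_cls, X₀.card, h1]
    push_cast
    ring
  have hc := c₀_pos p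
  have hp0 := p_pos p
  have hG' := card_pos G'
  have hbound : ∀ G ∈ s, (G.cardAut : ℝ)⁻¹ ≤
      (c₀ p)⁻¹ * ((p : ℝ) ^ (n * n))⁻¹ * ((G'.card : ℝ) ^ n)⁻¹ * Nat.card (T G) := fun G hG => by
    have h1 := c₀_mul_card_pow_le_genCard (hs G hG).1.le
    rw [← hTaut] at h1
    change c₀ p * (G.card : ℝ) ^ n ≤ _ at h1
    rw [hcard G hG, mul_pow, ← pow_mul, Nat.cast_mul] at h1
    have h3 := cardAut_pos G
    rw [← mul_inv, ← mul_inv, inv_mul_eq_div, le_div_iff₀ (by positivity), inv_mul_le_iff₀ h3]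
    linarith
  have hinner : ∑ G ∈ s, Nat.card (T G) ≤ Nat.card (T G') := by
    have h1 : Nat.card (Σ G : s, T G.1) = ∑ G ∈ s, Nat.card (T G) := by
      rw [Nat.card_sigma, ← Finset.sum_coe_sort s fun G => Nat.card (T G)]
    rw [← h1]
    let m : F →ₗ[ℤ_[p]] F := LinearMap.lsmul ℤ_[p] F (p : ℤ_[p])
    have hle : ∀ x : Σ G : s, T G.1, x.2.1 ≤ LinearMap.range m := fun x =>
      le_pRange_of_card (hs x.1.1 x.1.2).1 x.2.2.some
    have hmem : ∀ x : Σ G : s, T G.1,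
        Nonempty ((F ⧸ x.2.1.comap m) ≃ₗ[ℤ_[p]] G'.rep.carrier) := fun x => by
      let g : F →ₗ[ℤ_[p]] F ⧸ x.2.1 := x.2.1.mkQ ∘ₗ m
      have hk : LinearMap.ker g = x.2.1.comap m := by
        rw [LinearMap.ker_comp, Submodule.ker_mkQ]
      have hr : LinearMap.range g = pRange p (F ⧸ x.2.1) := by
        rw [LinearMap.range_comp]
        exact map_pRange x.2.1.mkQ_surjective
      have e₁ := g.quotKerEquivRange
      rw [hk, hr] at e₁
      obtain ⟨e₂⟩ := nonempty_pRange_equiv x.2.2.some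
      obtain ⟨e₃⟩ := (cls_eq_iff _ _).1 (hs x.1.1 x.1.2).2
      exact ⟨(e₁.trans e₂).trans e₃⟩
    refine Nat.card_le_card_of_injective (fun x => ⟨x.2.1.comap m, hmem x⟩) fun x y h => ?_
    have h2 : x.2.1.comap m = y.2.1.comap m := congrArg (fun z => z.1) h
    have h3 : x.2.1 = y.2.1 := by
      rw [← Submodule.map_comap_eq_self (hle x), h2, Submodule.map_comap_eq_self (hle y)]
    obtain ⟨⟨G₁, hG₁⟩, ⟨K₁, ⟨e₁⟩⟩⟩ := x
    obtain ⟨⟨G₂, hG₂⟩, ⟨K₂, ⟨e₂⟩⟩⟩ := y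
    simp only at h3
    subst h3
    have h4 : G₁ = G₂ := by
      rw [← cls_rep G₁, cls_eq_iff]
      exact ⟨e₁.symm.trans e₂⟩
    subst h4
    rfl
  calc ∑ G ∈ s, (G.cardAut : ℝ)⁻¹
      ≤ ∑ G ∈ s, (c₀ p)⁻¹ * ((p : ℝ) ^ (n * n))⁻¹ * ((G'.card : ℝ) ^ n)⁻¹ * Nat.card (T G) :=
        Finset.sum_le_sum hbound
    _ = (c₀ p)⁻¹ * ((p : ℝ) ^ (n * n))⁻¹ * ((G'.card : ℝ) ^ n)⁻¹ * (∑ G ∈ s, Nat.card (T G) : ℕ) := by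
        rw [← Finset.mul_sum, Nat.cast_sum]
    _ ≤ (c₀ p)⁻¹ * ((p : ℝ) ^ (n * n))⁻¹ * ((G'.card : ℝ) ^ n)⁻¹ * Nat.card (T G') := by
        gcongr
    _ ≤ (c₀ p)⁻¹ * ((p : ℝ) ^ (n * n))⁻¹ * (G'.cardAut : ℝ)⁻¹ := by
        rw [mul_assoc]
        refine mul_le_mul_of_nonneg_left ?_ (by positivity)
        have h1 := genCard_le (p := p) n G'.rep.carrier
        rw [← hTaut] at h1
        have h2 := cardAut_pos G'
        rw [inv_mul_le_iff₀ (by positivity), ← div_eq_mul_inv, le_div_iff₀ h2]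
        exact_mod_cast h1

end CohenLenstra
end
noncomputable section

namespace CohenLenstra

open Module

variable {p : ℕ} [Fact p.Prime]

/-! ### Polynomial statistics of kernels as moments -/

/-- The span of the functions `G ↦ #Sur(G, B)`. -/
def momentSpan (p : ℕ) [Fact p.Prime] : Submodule ℝ (X₀ p → ℝ) :=
  Submodule.span ℝ (Set.range fun (B : X₀ p) (G : X₀ p) =>
    (surCard p G.rep.carrier B.rep.carrier : ℝ))

theorem nonempty_ker_quotient_equiv {G A : Type} [AddCommGroup G] [Module ℤ_[p] G] [AddCommGroup A]
    [Module ℤ_[p] A] (L : Submodule ℤ_[p] G) (f : (G ⧸ L) →ₗ[ℤ_[p]] A) :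
    Nonempty ((LinearMap.ker (f ∘ₗ L.mkQ) ⧸ L.comap (LinearMap.ker (f ∘ₗ L.mkQ)).subtype)
      ≃ₗ[ℤ_[p]] LinearMap.ker f) := by
  let g : LinearMap.ker (f ∘ₗ L.mkQ) →ₗ[ℤ_[p]] LinearMap.ker f :=
    (L.mkQ ∘ₗ (LinearMap.ker (f ∘ₗ L.mkQ)).subtype).codRestrict _ fun x => x.2
  have hg : Function.Surjective g := by
    rintro ⟨y, hy⟩
    obtain ⟨x, rfl⟩ := L.mkQ_surjective y
    exact ⟨⟨x, hy⟩, rfl⟩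
  have hk : LinearMap.ker g = L.comap (LinearMap.ker (f ∘ₗ L.mkQ)).subtype := by
    ext x
    rw [LinearMap.mem_ker, Submodule.mem_comap, ← Submodule.Quotient.mk_eq_zero L]
    exact Subtype.ext_iff
  exact ⟨(Submodule.quotEquivOfEq _ _ hk.symm).trans (g.quotKerEquivOfSurjective hg)⟩

/-- The number of surjections with a given isomorphism class of the kernel. -/
def surKerCard (p : ℕ) [Fact p.Prime] (B A S : Type) [AddCommGroup B] [Module ℤ_[p] B]
    [AddCommGroup A] [Module ℤ_[p] A] [AddCommGroup S] [Module ℤ_[p] S] : ℕ :=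
  Nat.card {f : B →ₗ[ℤ_[p]] A // Function.Surjective f ∧
    Nonempty (LinearMap.ker f ≃ₗ[ℤ_[p]] S)}

theorem surKerCard_congr {B B' A S : Type} [AddCommGroup B] [Module ℤ_[p] B]
    [AddCommGroup B'] [Module ℤ_[p] B'] [AddCommGroup A] [Module ℤ_[p] A] [AddCommGroup S]
    [Module ℤ_[p] S] (e : B ≃ₗ[ℤ_[p]] B') : surKerCard p B A S = surKerCard p B' A S := by
  have key : ∀ {B B' : Type} [AddCommGroup B] [Module ℤ_[p] B] [AddCommGroup B'] [Module ℤ_[p] B']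
      (e : B ≃ₗ[ℤ_[p]] B') (f : B →ₗ[ℤ_[p]] A),
      (Function.Surjective f ∧ Nonempty (LinearMap.ker f ≃ₗ[ℤ_[p]] S)) →
      (Function.Surjective (f ∘ₗ e.symm.toLinearMap) ∧
        Nonempty (LinearMap.ker (f ∘ₗ e.symm.toLinearMap) ≃ₗ[ℤ_[p]] S)) := by
    rintro B B' _ _ _ _ e f ⟨hf, ⟨g⟩⟩
    have hk : (LinearMap.ker (f ∘ₗ e.symm.toLinearMap)).map e.symm.toLinearMap =
        LinearMap.ker f := ?_
    · exact ⟨hf.comp e.symm.surjective,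
        ⟨((e.symm.submoduleMap _).trans (LinearEquiv.ofEq _ _ hk)).trans g⟩⟩
    rw [LinearMap.ker_comp]
    exact Submodule.map_comap_eq_of_surjective e.symm.surjective _
  exact Nat.card_congr
    { toFun := fun f => ⟨f.1 ∘ₗ e.symm.toLinearMap, key e f.1 f.2⟩
      invFun := fun f => ⟨f.1 ∘ₗ e.toLinearMap, key e.symm f.1 f.2⟩
      left_inv := fun f => Subtype.ext (LinearMap.ext fun x => by simp)
      right_inv := fun f => Subtype.ext (LinearMap.ext fun x => by simp) }

theorem card_of_surKerCard_ne_zero {B A S : Type} [AddCommGroup B] [Module ℤ_[p] B]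
    [AddCommGroup A] [Module ℤ_[p] A] [AddCommGroup S] [Module ℤ_[p] S]
    (h : surKerCard p B A S ≠ 0) : Nat.card B = Nat.card S * Nat.card A := by
  obtain ⟨f, hf, ⟨e⟩⟩ := (Nat.card_ne_zero.1 h).1
  rw [(LinearMap.ker f).card_eq_card_quotient_mul_card, Nat.card_congr e.toEquiv,
    Nat.card_congr (f.quotKerEquivOfSurjective hf).toEquiv]

/-- For `L ≤ ker f`, the surjection `f` descends to `G/L` with kernel `(ker f)/L`. Both sides count
the pairs `(f, L)` with this kernel isomorphic to `S`. -/
theorem sum_card_submodule_ker (G A S : Type) [AddCommGroup G] [Module ℤ_[p] G] [Finite G]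
    [AddCommGroup A] [Module ℤ_[p] A] [AddCommGroup S] [Module ℤ_[p] S] [Finite A]
    [Fintype {f : G →ₗ[ℤ_[p]] A // Function.Surjective f}] [Fintype (Submodule ℤ_[p] G)] :
    ∑ f : {f : G →ₗ[ℤ_[p]] A // Function.Surjective f},
      Nat.card {L : Submodule ℤ_[p] (LinearMap.ker f.1) //
        Nonempty ((LinearMap.ker f.1 ⧸ L) ≃ₗ[ℤ_[p]] S)} =
    ∑ L : Submodule ℤ_[p] G, surKerCard p (G ⧸ L) A S := by
  let R : {f : G →ₗ[ℤ_[p]] A // Function.Surjective f} → Submodule ℤ_[p] G → Prop := fun f L =>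
    L ≤ LinearMap.ker f.1 ∧
      Nonempty ((LinearMap.ker f.1 ⧸ L.comap (LinearMap.ker f.1).subtype) ≃ₗ[ℤ_[p]] S)
  have h1 : ∀ f : {f : G →ₗ[ℤ_[p]] A // Function.Surjective f},
      Nat.card {L : Submodule ℤ_[p] (LinearMap.ker f.1) //
        Nonempty ((LinearMap.ker f.1 ⧸ L) ≃ₗ[ℤ_[p]] S)} = Nat.card {L // R f L} := fun f => by
    have hc : ∀ L : Submodule ℤ_[p] (LinearMap.ker f.1),
        (L.map (LinearMap.ker f.1).subtype).comap (LinearMap.ker f.1).subtype = L := fun L =>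
      Submodule.comap_map_eq_of_injective (LinearMap.ker f.1).injective_subtype L
    refine Nat.card_congr
      { toFun := fun L => ⟨L.1.map (LinearMap.ker f.1).subtype, Submodule.map_subtype_le _ _, ?_⟩
        invFun := fun L => ⟨L.1.comap (LinearMap.ker f.1).subtype, L.2.2⟩
        left_inv := fun L => Subtype.ext (hc L.1)
        right_inv := fun L => Subtype.ext ?_ }
    · rw [hc]; exact L.2
    · refine (Submodule.map_comap_subtype _ _).trans ?_
      exact inf_eq_right.2 L.2.1
  have h2 : ∀ L : Submodule ℤ_[p] G, surKerCard p (G ⧸ L) A S = Nat.card {f // R f L} := fun L => by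
    refine Nat.card_congr
      { toFun := fun f => ⟨⟨f.1 ∘ₗ L.mkQ, f.2.1.comp L.mkQ_surjective⟩, ?_, ?_⟩
        invFun := fun f => ⟨L.liftQ f.1.1 f.2.1, ?_, ?_⟩
        left_inv := fun f => by ext; simp
        right_inv := fun f => by ext; simp }
    · intro x hx
      simp [(Submodule.Quotient.mk_eq_zero L).2 hx]
    · exact ⟨(nonempty_ker_quotient_equiv L f.1).some.trans f.2.2.some⟩
    · intro a
      obtain ⟨x, hx⟩ := f.1.2 a
      exact ⟨Submodule.Quotient.mk x, hx⟩
    · have h3 := (nonempty_ker_quotient_equiv L (L.liftQ f.1.1 f.2.1)).some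
      rw [Submodule.liftQ_mkQ] at h3
      exact ⟨h3.symm.trans f.2.2.some⟩
  simp_rw [h1, h2]
  rw [← Nat.card_sigma, ← Nat.card_sigma]
  exact Nat.card_congr
    { toFun := fun x => ⟨x.2.1, x.1, x.2.2⟩
      invFun := fun x => ⟨x.2.1, x.1, x.2.2⟩
      left_inv := fun x => rfl
      right_inv := fun x => rfl }

/-- Sort the submodules `L` of `G` by the class `B` of `G/L`: there are `#Sur(G, B)/#Aut B` of them.
Only classes of order `|S| |A|` contribute, so the combination is finite and independent of `G`. -/
theorem card_submodule_ker_mem_momentSpan (A S : Type) [AddCommGroup A] [Module ℤ_[p] A] [Finite A]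
    [AddCommGroup S] [Module ℤ_[p] S] [Finite S] :
    (fun G : X₀ p => ((∑ᶠ f : {f : G.rep.carrier →ₗ[ℤ_[p]] A // Function.Surjective f},
      Nat.card {L : Submodule ℤ_[p] (LinearMap.ker f.1) //
        Nonempty ((LinearMap.ker f.1 ⧸ L) ≃ₗ[ℤ_[p]] S)} : ℕ) : ℝ)) ∈ momentSpan p := by
  classical
  let T := (finite_card_le (p := p) (Nat.card S * Nat.card A)).toFinset
  have key : (fun G : X₀ p => ((∑ᶠ f : {f : G.rep.carrier →ₗ[ℤ_[p]] A // Function.Surjective f},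
      Nat.card {L : Submodule ℤ_[p] (LinearMap.ker f.1) //
        Nonempty ((LinearMap.ker f.1 ⧸ L) ≃ₗ[ℤ_[p]] S)} : ℕ) : ℝ)) =
      ∑ B ∈ T, ((surKerCard p B.rep.carrier A S : ℝ) / B.cardAut) •
        fun G : X₀ p => (surCard p G.rep.carrier B.rep.carrier : ℝ) := by
    funext G
    have := Fintype.ofFinite {f : G.rep.carrier →ₗ[ℤ_[p]] A // Function.Surjective f}
    have := Fintype.ofFinite (Submodule ℤ_[p] G.rep.carrier)
    rw [finsum_eq_sum_of_fintype, sum_card_submodule_ker]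
    have h1 : ∀ L : Submodule ℤ_[p] G.rep.carrier, surKerCard p (G.rep.carrier ⧸ L) A S =
        ∑ B ∈ T, if cls p (G.rep.carrier ⧸ L) = B then surKerCard p B.rep.carrier A S else 0 := by
      intro L
      have hc := surKerCard_congr (A := A) (S := S)
        (nonempty_rep_cls (p := p) (G.rep.carrier ⧸ L)).some
      rw [Finset.sum_ite_eq, hc]
      split_ifs with h
      · rfl
      · by_contra hne
        refine h ?_
        rw [Set.Finite.mem_toFinset, Set.mem_ofPred_eq, card_cls,
          card_of_surKerCard_ne_zero (p := p) (S := S) (A := A) hne]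
    rw [Finset.sum_congr rfl fun L _ => h1 L, Finset.sum_comm, Nat.cast_sum, Finset.sum_apply]
    refine Finset.sum_congr rfl fun B _ => ?_
    rw [← Finset.sum_filter, Finset.sum_const, smul_eq_mul, Nat.cast_mul, Pi.smul_apply,
      smul_eq_mul, surCard_eq, Nat.cast_mul]
    have h2 := cardAut_pos B
    have h3 : (Finset.univ.filter fun L : Submodule ℤ_[p] G.rep.carrier =>
        cls p (G.rep.carrier ⧸ L) = B).card = Nat.card {K : Submodule ℤ_[p] G.rep.carrier //
          Nonempty ((G.rep.carrier ⧸ K) ≃ₗ[ℤ_[p]] B.rep.carrier)} := by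
      rw [Nat.card_eq_fintype_card, Fintype.card_subtype]
      congr 1
      exact Finset.filter_congr fun K _ => cls_eq_iff _ _
    rw [h3]
    change _ = _ * (_ * (B.cardAut : ℝ))
    field_simp
  rw [key]
  exact Submodule.sum_mem _ fun B _ => Submodule.smul_mem _ _ (Submodule.subset_span ⟨B, rfl⟩)

theorem homCard_eq_sum_surCard (K C : Type) [AddCommGroup K] [Module ℤ_[p] K] [Finite K]
    [AddCommGroup C] [Module ℤ_[p] C] [Finite C] [Fintype (Submodule ℤ_[p] C)] :
    Nat.card (K →ₗ[ℤ_[p]] C) = ∑ S : Submodule ℤ_[p] C, surCard p K S := by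
  unfold surCard
  rw [← Nat.card_sigma]
  refine (Nat.card_congr (Equiv.ofBijective (fun x => x.1.subtype ∘ₗ x.2.1) ⟨?_, fun f => ?_⟩)).symm
  · have hr : ∀ (S : Submodule ℤ_[p] C) (f : K →ₗ[ℤ_[p]] S), Function.Surjective f →
        LinearMap.range (S.subtype ∘ₗ f) = S := fun S f hf => by
      rw [LinearMap.range_comp, LinearMap.range_eq_top.2 hf, Submodule.map_subtype_top]
    rintro ⟨S, f, hf⟩ ⟨S', f', hf'⟩ h
    have h1 : S.subtype ∘ₗ f = S'.subtype ∘ₗ f' := h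
    obtain rfl : S = S' := by rw [← hr S f hf, h1, hr S' f' hf']
    have h2 : f = f' := LinearMap.ext fun x => Subtype.ext (LinearMap.congr_fun h1 x)
    subst h2
    rfl
  · exact ⟨⟨LinearMap.range f, f.rangeRestrict, f.surjective_rangeRestrict⟩, rfl⟩

/-! ### Ranks of kernels as moments. -/

/-- The rank of a finite `ℤ_p`-module. -/
def prk (p : ℕ) [Fact p.Prime] (K : Type*) [AddCommGroup K] [Module ℤ_[p] K] : ℕ :=
  Nat.log p (Nat.card (K ⧸ pRange p K))

theorem card_quotient_eq_pow_prk (K : Type*) [AddCommGroup K] [Module ℤ_[p] K] [Finite K] :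
    Nat.card (K ⧸ pRange p K) = p ^ prk p K := by
  obtain ⟨r, hr⟩ := exists_card_eq_pow p (K ⧸ pRange p K)
  rw [prk, hr, Nat.log_pow (Fact.out : p.Prime).one_lt]

theorem homCard_elementary (K : Type) [AddCommGroup K] [Module ℤ_[p] K] [Finite K] (r : ℕ) :
    Nat.card (K →ₗ[ℤ_[p]] (Fin r → Cyc p 1)) = (p ^ prk p K) ^ r := by
  rw [Nat.card_congr (β := Fin r → (K →ₗ[ℤ_[p]] Cyc p 1))
    { toFun := fun f i => LinearMap.proj i ∘ₗ f
      invFun := LinearMap.pi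
      left_inv := fun f => rfl
      right_inv := fun f => rfl }, Nat.card_fun, Nat.card_fin, ← card_quotient_eq_pow_prk]
  congr 1
  rw [← homCard_Cyc_eq_card (N := 1) (K ⧸ pRange p K) fun x => by
    obtain ⟨y, rfl⟩ := Submodule.mkQ_surjective _ x
    rw [pow_one, ← map_smul, Submodule.mkQ_apply, Submodule.Quotient.mk_eq_zero]
    exact smul_mem_pRange y]
  exact Nat.card_congr
    { toFun := fun η => (pRange p K).liftQ η (by
        rintro _ ⟨x, rfl⟩
        change η ((p : ℤ_[p]) • x) = 0
        have h := pow_smul_Cyc (p := p) (le_refl 1) (η x)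
        have h2 : (p : ℤ_[p]) ^ 1 = p := pow_one _
        rw [map_smul]
        exact (congrArg (fun a : ℤ_[p] => a • η x) h2).symm.trans h)
      invFun := fun η => η ∘ₗ (pRange p K).mkQ
      left_inv := fun η => by ext; simp
      right_inv := fun η => by ext; simp }

/-- For `K = ker f`, `p^(r rank K) = #Hom(K, 𝔽_p^r)`. Sorting by the image `S` gives `∑_S #Sur(K,
S)`, and `#Sur(K, S)` is `#Aut S` times the number of submodules of `K` with quotient `S`. -/
theorem sum_pow_prk_ker_mem_momentSpan (A : Type) [AddCommGroup A] [Module ℤ_[p] A] [Finite A]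
    (r : ℕ) :
    (fun G : X₀ p => ∑ᶠ f : {f : G.rep.carrier →ₗ[ℤ_[p]] A // Function.Surjective f},
      ((p : ℝ) ^ prk p (LinearMap.ker f.1)) ^ r) ∈ momentSpan p := by
  have := Fintype.ofFinite (Submodule ℤ_[p] (Fin r → Cyc p 1))
  have key : (fun G : X₀ p => ∑ᶠ f : {f : G.rep.carrier →ₗ[ℤ_[p]] A // Function.Surjective f},
      ((p : ℝ) ^ prk p (LinearMap.ker f.1)) ^ r) =
      ∑ S : Submodule ℤ_[p] (Fin r → Cyc p 1), (Nat.card (S ≃ₗ[ℤ_[p]] S) : ℝ) •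
        fun G : X₀ p => ((∑ᶠ f : {f : G.rep.carrier →ₗ[ℤ_[p]] A // Function.Surjective f},
          Nat.card {L : Submodule ℤ_[p] (LinearMap.ker f.1) //
            Nonempty ((LinearMap.ker f.1 ⧸ L) ≃ₗ[ℤ_[p]] S)} : ℕ) : ℝ) := by
    funext G
    have := Fintype.ofFinite {f : G.rep.carrier →ₗ[ℤ_[p]] A // Function.Surjective f}
    rw [finsum_eq_sum_of_fintype, Finset.sum_apply]
    simp_rw [Pi.smul_apply, smul_eq_mul, finsum_eq_sum_of_fintype, Nat.cast_sum, Finset.mul_sum]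
    rw [Finset.sum_comm]
    refine Finset.sum_congr rfl fun f _ => ?_
    have h1 := homCard_elementary (p := p) (LinearMap.ker f.1) r
    rw [homCard_eq_sum_surCard] at h1
    have h2 := congrArg (Nat.cast : ℕ → ℝ) h1
    rw [Nat.cast_pow, Nat.cast_pow, Nat.cast_sum] at h2
    rw [← h2]
    refine Finset.sum_congr rfl fun S _ => ?_
    rw [surCard_eq, Nat.cast_mul, mul_comm]
  rw [key]
  exact Submodule.sum_mem _ fun S _ => Submodule.smul_mem _ _
    (card_submodule_ker_mem_momentSpan A S)

theorem sum_eval_prk_ker_mem_momentSpan (A : Type) [AddCommGroup A] [Module ℤ_[p] A] [Finite A]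
    (P : Polynomial ℝ) :
    (fun G : X₀ p => ∑ᶠ f : {f : G.rep.carrier →ₗ[ℤ_[p]] A // Function.Surjective f},
      P.eval ((p : ℝ) ^ prk p (LinearMap.ker f.1))) ∈ momentSpan p := by
  induction P using Polynomial.induction_on' with
  | add P Q hP hQ =>
    convert add_mem hP hQ using 1
    funext G
    rw [Pi.add_apply, ← finsum_add_distrib (Set.toFinite _) (Set.toFinite _)]
    simp
  | monomial r a =>
    convert Submodule.smul_mem _ a (sum_pow_prk_ker_mem_momentSpan (p := p) A r) using 1
    funext G
    rw [Pi.smul_apply, smul_finsum]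
    simp

end CohenLenstra
end
noncomputable section

namespace CohenLenstra

open Module Filter Topology

variable {p : ℕ} [Fact p.Prime]

/-! ### The growth of the ranks of kernels -/

theorem card_subtype_comp_le {A X Y : Type*} [Ring A] [AddCommGroup X] [AddCommGroup Y]
    [Module A X] [Module A Y] [Finite X] [Finite Y] (ρ : X →ₗ[A] Y) (P : Y → Prop) :
    Nat.card {x // P (ρ x)} ≤ Nat.card {y // P y} * Nat.card (LinearMap.ker ρ) := by
  have hs : ∀ x, ρ (Function.invFun ρ (ρ x)) = ρ x := fun x => Function.invFun_eq ⟨x, rfl⟩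
  rw [← Nat.card_prod]
  refine Nat.card_le_card_of_injective (fun x => (⟨ρ x.1, x.2⟩,
    ⟨x.1 - Function.invFun ρ (ρ x.1), by rw [LinearMap.mem_ker, map_sub, hs, sub_self]⟩)) ?_
  intro x y h
  have h1 : ρ x.1 = ρ y.1 := congrArg (fun z => z.1.1) h
  have h2 : x.1 - Function.invFun ρ (ρ x.1) = y.1 - Function.invFun ρ (ρ y.1) :=
    congrArg (fun z => z.2.1) h
  rw [h1] at h2
  exact Subtype.ext (sub_left_injective h2)

/-- The `p`-torsion submodule. -/
def pTors (p : ℕ) [Fact p.Prime] (G : Type*) [AddCommGroup G] [Module ℤ_[p] G] :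
    Submodule ℤ_[p] G := LinearMap.ker (LinearMap.lsmul ℤ_[p] G (p : ℤ_[p]))

theorem card_pTors (G : Type*) [AddCommGroup G] [Module ℤ_[p] G] [Finite G] :
    Nat.card (pTors p G) = p ^ prk p G := by
  rw [← card_quotient_eq_pow_prk]
  exact card_ker_eq_card_quotient_range (LinearMap.lsmul ℤ_[p] G (p : ℤ_[p]))

/-- The lower bound on the number of generating tuples is positive because `c₀ > 0`, so there is
one. -/
theorem exists_span_pTors (G : Type*) [AddCommGroup G] [Module ℤ_[p] G] [Finite G] :
    ∃ x : Fin (prk p G) → pTors p G, Submodule.span ℤ_[p] (Set.range x) = ⊤ := by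
  have h1 := c₀_mul_card_pow_le_genCard (p := p) (G := pTors p G) (n := prk p G)
    ((Nat.card_le_card_of_surjective _ (Submodule.mkQ_surjective _)).trans (card_pTors G).le)
  have h2 : (0 : ℝ) < Nat.card (pTors p G) := by exact_mod_cast Nat.card_pos
  have h3 : 0 < (genCard p (prk p G) (pTors p G) : ℝ) :=
    (mul_pos (c₀_pos p) (pow_pos h2 _)).trans_le h1
  have h4 : genCard p (prk p G) (pTors p G) ≠ 0 := by exact_mod_cast h3.ne'
  obtain ⟨x, hx⟩ := (Nat.card_ne_zero.1 h4).1
  exact ⟨x, hx⟩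

/-- Restrict `f` to the `p`-torsion: at most `|S|^rank(G)` restrictions have image `S`, and two maps
with the same restriction differ by an element of `Hom(G/G[p], A)`, where `G/G[p] ≅ pG`. -/
theorem card_hom_map_pTors_le (G A : Type*) [AddCommGroup G] [Module ℤ_[p] G] [Finite G]
    [AddCommGroup A] [Module ℤ_[p] A] [Finite A] (S : Submodule ℤ_[p] A) :
    Nat.card {f : G →ₗ[ℤ_[p]] A // (pTors p G).map f = S} ≤
      Nat.card S ^ prk p G * Nat.card (pRange p G →ₗ[ℤ_[p]] A) := by
  let ρ : (G →ₗ[ℤ_[p]] A) →ₗ[ℤ_[p]] (pTors p G →ₗ[ℤ_[p]] A) :=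
    LinearMap.lcomp ℤ_[p] A (pTors p G).subtype
  have hρ : ∀ f : G →ₗ[ℤ_[p]] A, ρ f = f ∘ₗ (pTors p G).subtype := fun f => rfl
  have h1 := card_subtype_comp_le ρ fun g => LinearMap.range g = S
  have h2 : Nat.card {g : pTors p G →ₗ[ℤ_[p]] A // LinearMap.range g = S} ≤
      Nat.card S ^ prk p G := by
    obtain ⟨x, hx⟩ := exists_span_pTors (p := p) G
    refine le_trans ?_ (homCard_le_pow (S := S) hx)
    refine Nat.card_le_card_of_injective
      (fun f => f.1.codRestrict S fun c => f.2.le ⟨c, rfl⟩) fun f g h => ?_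
    refine Subtype.ext (LinearMap.ext fun c => ?_)
    exact congrArg Subtype.val (LinearMap.congr_fun h c)
  have h3 : Nat.card (LinearMap.ker ρ) = Nat.card (pRange p G →ₗ[ℤ_[p]] A) := by
    let e : (G ⧸ pTors p G) ≃ₗ[ℤ_[p]] pRange p G :=
      (LinearMap.lsmul ℤ_[p] G (p : ℤ_[p])).quotKerEquivRange
    rw [← homCard_congr e (LinearEquiv.refl ℤ_[p] A)]
    exact Nat.card_congr
      { toFun := fun f => (pTors p G).liftQ f.1 fun x hx => LinearMap.congr_fun f.2 ⟨x, hx⟩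
        invFun := fun f => ⟨f ∘ₗ (pTors p G).mkQ, by
          rw [LinearMap.mem_ker, hρ]
          ext x
          have : (pTors p G).mkQ x.1 = 0 := (Submodule.Quotient.mk_eq_zero _).2 x.2
          change f ((pTors p G).mkQ x.1) = 0
          rw [this, map_zero]⟩
        left_inv := fun f => by ext; rfl
        right_inv := fun f => by ext; rfl }
  have h4 : ∀ f : G →ₗ[ℤ_[p]] A, (pTors p G).map f = S ↔ LinearMap.range (ρ f) = S := fun f => by
    rw [hρ, LinearMap.range_comp, Submodule.range_subtype]
  simp_rw [h4]
  exact h1.trans (by rw [h3]; exact Nat.mul_le_mul_right _ h2)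

/-- The triangular numbers. -/
def tri (n : ℕ) : ℕ := ∑ j ∈ Finset.range n, j

theorem tri_add (a s : ℕ) : tri (a + s) = tri a + (a * s + tri s) := by
  rw [tri, tri, tri, Finset.sum_range_add, Finset.sum_add_distrib, Finset.sum_const,
    Finset.card_range, smul_eq_mul, mul_comm s a]

/-- So `tri n = n(n-1)/2`, and its double falls short of the exponent `n²` gained in
`sum_inv_cardAut_le` by exactly `n`. This is what leaves a geometric series. -/
theorem two_mul_tri_add (n : ℕ) : tri n + tri n + n = n * n := by
  have := Finset.sum_range_id_mul_two n
  rw [tri]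
  cases n with
  | zero => simp
  | succ n =>
    rw [Nat.add_sub_cancel] at this
    nlinarith

/-- The `p`-torsion of `ker f` is the kernel of `f` on `G[p]`, so the rank drops by `s`, where `p^s
= |f(G[p])|`. By `tri_add` this lowers the exponent by about `s rank(G)`, with an error of at most
`s²`; as `s ≤ p^s ≤ |A|`, the error costs at most `|A|^|A|`. -/
theorem pow_tri_prk_ker_le {G A : Type*} [AddCommGroup G] [Module ℤ_[p] G] [Finite G]
    [AddCommGroup A] [Module ℤ_[p] A] [Finite A] (f : G →ₗ[ℤ_[p]] A) :
    p ^ tri (prk p (LinearMap.ker f)) * Nat.card ((pTors p G).map f) ^ prk p G ≤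
      p ^ tri (prk p G) * Nat.card A ^ Nat.card A := by
  have hp : p.Prime := Fact.out
  let g : pTors p G →ₗ[ℤ_[p]] A := f ∘ₗ (pTors p G).subtype
  have hr : LinearMap.range g = (pTors p G).map f := by
    rw [LinearMap.range_comp, Submodule.range_subtype]
  have hk : Nat.card (LinearMap.ker g) = p ^ prk p (LinearMap.ker f) := by
    rw [← card_pTors]
    exact Nat.card_congr
      { toFun := fun x => ⟨⟨x.1.1, x.2⟩, Subtype.ext x.1.2⟩
        invFun := fun x => ⟨⟨x.1.1, congrArg Subtype.val x.2⟩, x.1.2⟩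
        left_inv := fun x => rfl
        right_inv := fun x => rfl }
  obtain ⟨s, hs⟩ := exists_card_eq_pow p ((pTors p G).map f)
  have h1 := (LinearMap.ker g).card_eq_card_quotient_mul_card
  rw [Nat.card_congr g.quotKerEquivRange.toEquiv, hr, hs, hk, card_pTors, ← pow_add] at h1
  have h2 : prk p G = prk p (LinearMap.ker f) + s := Nat.pow_right_injective hp.two_le h1
  have h3 : p ^ s ≤ Nat.card A := by
    rw [← hs]
    exact Nat.card_le_card_of_injective _ Subtype.val_injective
  have h4 : s ≤ Nat.card A := (Nat.lt_pow_self hp.one_lt).le.trans h3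
  rw [hs, h2, tri_add, ← pow_mul, ← pow_add]
  calc p ^ (tri (prk p (LinearMap.ker f)) + s * (prk p (LinearMap.ker f) + s))
      ≤ p ^ (tri (prk p (LinearMap.ker f)) + (prk p (LinearMap.ker f) * s + tri s) + s * s) :=
        Nat.pow_le_pow_right hp.pos (by nlinarith)
    _ = p ^ (tri (prk p (LinearMap.ker f)) + (prk p (LinearMap.ker f) * s + tri s)) * (p ^ s) ^ s := by
        rw [pow_add, pow_mul]
    _ ≤ _ := by
        refine Nat.mul_le_mul_left _ ((Nat.pow_le_pow_left h3 s).trans ?_)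
        exact Nat.pow_le_pow_right Nat.card_pos h4

/-- Sort `f` by the image `S` of `G[p]`: the factor `|S|^rank(G)` in the number of such `f` cancels
the one gained for each of them. -/
theorem sum_pow_tri_prk_ker_le (G A : Type*) [AddCommGroup G] [Module ℤ_[p] G] [Finite G]
    [AddCommGroup A] [Module ℤ_[p] A] [Finite A] [Fintype (G →ₗ[ℤ_[p]] A)] :
    ∑ f : G →ₗ[ℤ_[p]] A, (p : ℝ) ^ tri (prk p (LinearMap.ker f)) ≤
      (Nat.card (Submodule ℤ_[p] A) * (Nat.card A : ℝ) ^ Nat.card A) *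
        ((p : ℝ) ^ tri (prk p G) * Nat.card (pRange p G →ₗ[ℤ_[p]] A)) := by
  classical
  have := Fintype.ofFinite (Submodule ℤ_[p] A)
  have hp0 := p_pos p
  rw [← Finset.sum_fiberwise (s := Finset.univ) (g := fun f => (pTors p G).map f)]
  have key : ∀ S : Submodule ℤ_[p] A,
      ∑ f : G →ₗ[ℤ_[p]] A with (pTors p G).map f = S, (p : ℝ) ^ tri (prk p (LinearMap.ker f)) ≤
        (Nat.card A : ℝ) ^ Nat.card A *
        ((p : ℝ) ^ tri (prk p G) * Nat.card (pRange p G →ₗ[ℤ_[p]] A)) := fun S => by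
    have hS : (0 : ℝ) < (Nat.card S : ℝ) ^ prk p G := by
      have := Nat.card_pos (α := S); positivity
    have h1 := card_hom_map_pTors_le (p := p) G A S
    rw [Nat.card_eq_fintype_card, Fintype.card_subtype] at h1
    have h1' : ((Finset.univ.filter fun f : G →ₗ[ℤ_[p]] A => (pTors p G).map f = S).card : ℝ) ≤
        (Nat.card S : ℝ) ^ prk p G * Nat.card (pRange p G →ₗ[ℤ_[p]] A) := by exact_mod_cast h1
    have h2 : ∀ f ∈ Finset.univ.filter fun f : G →ₗ[ℤ_[p]] A => (pTors p G).map f = S,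
        (p : ℝ) ^ tri (prk p (LinearMap.ker f)) ≤
          (p : ℝ) ^ tri (prk p G) * (Nat.card A : ℝ) ^ Nat.card A / (Nat.card S : ℝ) ^ prk p G :=
      fun f hf => by
        rw [le_div_iff₀ hS]
        have h3 := pow_tri_prk_ker_le f
        rw [(Finset.mem_filter.1 hf).2] at h3
        exact_mod_cast h3
    refine (Finset.sum_le_card_nsmul _ _ _ h2).trans ?_
    rw [nsmul_eq_mul]
    refine (mul_le_mul_of_nonneg_right h1' (by positivity)).trans (le_of_eq ?_)
    field_simp
  refine (Finset.sum_le_sum fun S _ => key S).trans (le_of_eq ?_)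
  rw [Finset.sum_const, nsmul_eq_mul, Finset.card_univ, ← Nat.card_eq_fintype_card]
  ring

/-- Sort `G` by its rank `n` and the class `G'` of `pG`. By `sum_inv_cardAut_le` each block is at
most `c₀⁻¹ p^(-n) #Hom(G', C)/#Aut G'`, a product of two summable families. -/
theorem summable_pow_tri_mul_homCard (C : Type) [AddCommGroup C] [Module ℤ_[p] C] [Finite C] :
    Summable fun G : X₀ p => (p : ℝ) ^ (tri (prk p G.rep.carrier) + tri (prk p G.rep.carrier)) *
      Nat.card (pRange p G.rep.carrier →ₗ[ℤ_[p]] C) / G.cardAut := by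
  classical
  have hp0 := p_pos p
  have hc := c₀_pos p
  have hgeo : Summable fun n : ℕ => ((p : ℝ)⁻¹) ^ n :=
    summable_geometric_of_lt_one (by positivity) (inv_lt_one_of_one_lt₀ (one_lt_p p))
  have hS := (hgeo.mul_of_nonneg (summable_homCard_div_cardAut (p := p) C)
    (fun n => by positivity) (fun G => by positivity)).mul_left (c₀ p)⁻¹
  refine summable_of_sum_le (c := ∑' x : ℕ × X₀ p, (c₀ p)⁻¹ * (((p : ℝ)⁻¹) ^ x.1 *
    ((Nat.card (x.2.rep.carrier →ₗ[ℤ_[p]] C) : ℝ) / x.2.cardAut)))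
    (fun G => by positivity) fun s => ?_
  let φ : X₀ p → ℕ × X₀ p := fun G => (prk p G.rep.carrier, cls p (pRange p G.rep.carrier))
  rw [← Finset.sum_fiberwise_of_maps_to (t := s.image φ) (g := φ)
    fun G hG => Finset.mem_image_of_mem _ hG]
  refine le_trans (Finset.sum_le_sum fun x _ => ?_)
    (hS.sum_le_tsum (s.image φ) fun x _ => by positivity)
  obtain ⟨n, G'⟩ := x
  have h1 : ∀ G ∈ s.filter fun G => φ G = (n, G'),
      (p : ℝ) ^ (tri (prk p G.rep.carrier) + tri (prk p G.rep.carrier)) *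
        Nat.card (pRange p G.rep.carrier →ₗ[ℤ_[p]] C) / G.cardAut =
      ((p : ℝ) ^ (tri n + tri n) * Nat.card (G'.rep.carrier →ₗ[ℤ_[p]] C)) * (G.cardAut : ℝ)⁻¹ :=
    fun G hG => by
      have h2 := (Finset.mem_filter.1 hG).2
      simp only [φ, Prod.mk.injEq] at h2
      obtain ⟨e⟩ := (cls_eq_iff _ _).1 h2.2
      rw [h2.1, homCard_congr e (LinearEquiv.refl _ C), div_eq_mul_inv]
  rw [Finset.sum_congr rfl h1, ← Finset.mul_sum]
  have h3 := sum_inv_cardAut_le n G' (s.filter fun G => φ G = (n, G')) fun G hG => by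
    have h2 := (Finset.mem_filter.1 hG).2
    simp only [φ, Prod.mk.injEq] at h2
    exact ⟨by rw [card_quotient_eq_pow_prk, h2.1], h2.2⟩
  refine (mul_le_mul_of_nonneg_left h3 (by positivity)).trans (le_of_eq ?_)
  rw [← two_mul_tri_add n, pow_add _ _ n, inv_pow]
  have := cardAut_pos G'
  field_simp

/-- Cauchy-Schwarz with weights `#Aut G` and `1/#Aut G`, in the form `ab ≤ a² + b²`. -/
theorem summable_norm_mul_of_sq {𝕜 : Type*} [RCLike 𝕜] {ν : X₀ p → 𝕜} {W : X₀ p → ℝ}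
    (hν : Summable fun G => ‖ν G‖ ^ 2 * G.cardAut) (hW : Summable fun G => W G ^ 2 / G.cardAut)
    (hW0 : ∀ G, 0 ≤ W G) : Summable fun G => ‖ν G‖ * W G := by
  refine Summable.of_nonneg_of_le (fun G => mul_nonneg (norm_nonneg _) (hW0 G)) (fun G => ?_)
    (hν.add hW)
  have h := cardAut_pos G
  have h2 : W G ^ 2 / G.cardAut = (W G / G.cardAut) ^ 2 * G.cardAut := by field_simp
  have h3 : ‖ν G‖ * W G = (‖ν G‖ * (W G / G.cardAut)) * G.cardAut := by field_simp
  rw [h2, h3, ← add_mul]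
  refine mul_le_mul_of_nonneg_right ?_ h.le
  nlinarith [sq_nonneg (‖ν G‖ - W G / G.cardAut), sq_nonneg (‖ν G‖), sq_nonneg (W G / G.cardAut)]

theorem homCard_prod_self (M A : Type*) [AddCommGroup M] [Module ℤ_[p] M] [AddCommGroup A]
    [Module ℤ_[p] A] : Nat.card (M →ₗ[ℤ_[p]] A × A) = Nat.card (M →ₗ[ℤ_[p]] A) ^ 2 := by
  rw [sq, ← Nat.card_prod]
  exact Nat.card_congr (LinearMap.prodEquiv ℤ_[p]).symm.toEquiv

theorem summable_surCard_sq (B : X₀ p) :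
    Summable fun G : X₀ p => (surCard p G.rep.carrier B.rep.carrier : ℝ) ^ 2 / G.cardAut := by
  refine Summable.of_nonneg_of_le (fun G => by positivity) (fun G => ?_)
    (summable_homCard_div_cardAut (p := p) (B.rep.carrier × B.rep.carrier))
  rw [homCard_prod_self, Nat.cast_pow]
  have := surCard_le_homCard (p := p) G.rep.carrier B.rep.carrier
  gcongr

/-- Squaring the bound on the sum over `f` replaces `Hom(pG, A)` by `Hom(pG, A × A)`, which is again
covered by the preceding summability. -/
theorem summable_sum_pow_tri (A : Type) [AddCommGroup A] [Module ℤ_[p] A] [Finite A] :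
    Summable fun G : X₀ p => (∑ᶠ f : G.rep.carrier →ₗ[ℤ_[p]] A,
      (p : ℝ) ^ tri (prk p (LinearMap.ker f))) ^ 2 / G.cardAut := by
  have hp0 := p_pos p
  refine Summable.of_nonneg_of_le (fun G => by positivity) (fun G => ?_)
    ((summable_pow_tri_mul_homCard (p := p) (A × A)).mul_left
      ((Nat.card (Submodule ℤ_[p] A) * (Nat.card A : ℝ) ^ Nat.card A) ^ 2))
  have := Fintype.ofFinite (G.rep.carrier →ₗ[ℤ_[p]] A)
  rw [finsum_eq_sum_of_fintype, homCard_prod_self, Nat.cast_pow, ← mul_div_assoc, pow_add]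
  have h := cardAut_pos G
  refine div_le_div_of_nonneg_right ?_ h.le
  refine (pow_le_pow_left₀ (by positivity) (sum_pow_tri_prk_ker_le G.rep.carrier A) 2).trans
    (le_of_eq ?_)
  ring

/-! ### Polynomials that separate rank zero -/

/-- The polynomial with zeros `p, …, p^R` and value `1` at `1`. -/
def sepPoly (p R : ℕ) : Polynomial ℝ := ∏ i ∈ Finset.range R,
  (Polynomial.C (1 - (p : ℝ) ^ (i + 1))⁻¹ * (Polynomial.X - Polynomial.C ((p : ℝ) ^ (i + 1))))

theorem eval_sepPoly (p R : ℕ) (x : ℝ) : (sepPoly p R).eval x =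
    ∏ i ∈ Finset.range R, ((1 - (p : ℝ) ^ (i + 1))⁻¹ * (x - (p : ℝ) ^ (i + 1))) := by
  simp [sepPoly, Polynomial.eval_prod]

theorem eval_sepPoly_zero (R : ℕ) : (sepPoly p R).eval ((p : ℝ) ^ 0) = 1 := by
  rw [eval_sepPoly, pow_zero]
  refine Finset.prod_eq_one fun i _ => inv_mul_cancel₀ ?_
  rw [sub_ne_zero]
  exact (one_lt_pow₀ (one_lt_p p) (Nat.succ_ne_zero i)).ne

theorem eval_sepPoly_of_le {p R d : ℕ} (h0 : d ≠ 0) (h : d ≤ R) :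
    (sepPoly p R).eval ((p : ℝ) ^ d) = 0 := by
  rw [eval_sepPoly]
  refine Finset.prod_eq_zero (i := d - 1) (Finset.mem_range.2 (by omega)) ?_
  rw [show d - 1 + 1 = d by omega, sub_self, mul_zero]

theorem c₀_le_one (p : ℕ) [Fact p.Prime] : c₀ p ≤ 1 := by
  simpa using c₀_le_prod p 0

/-- For `0 < d ≤ R` the value is `0`. For `d > R` the `i`-th factor is at most `p^(d-1-i) / (1 -
p^(-i-1))`; the denominators multiply to at least `c₀`, and the exponents add up to part of the sum
`tri d`. Uniformity in `R` is what dominated convergence needs. -/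
theorem abs_eval_sepPoly_le (R d : ℕ) :
    |(sepPoly p R).eval ((p : ℝ) ^ d)| ≤ (c₀ p)⁻¹ * (p : ℝ) ^ tri d := by
  have hp0 := p_pos p
  have hc := c₀_pos p
  have hone : 1 ≤ (c₀ p)⁻¹ := (one_le_inv₀ hc).2 (c₀_le_one p)
  rcases Nat.eq_zero_or_pos d with rfl | hd
  · rw [eval_sepPoly_zero, abs_one]
    simpa [tri] using hone
  rcases le_or_gt d R with h | h
  · rw [eval_sepPoly_of_le hd.ne' h, abs_zero]
    positivity
  rw [eval_sepPoly, Finset.abs_prod]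
  have key : ∀ i ∈ Finset.range R, |(1 - (p : ℝ) ^ (i + 1))⁻¹ * ((p : ℝ) ^ d - (p : ℝ) ^ (i + 1))| ≤
      (1 - 1 / (p : ℝ) ^ (i + 1))⁻¹ * (p : ℝ) ^ (d - 1 - i) := fun i hi => by
    have hi := Finset.mem_range.1 hi
    have h1 : 1 < (p : ℝ) ^ (i + 1) := one_lt_pow₀ (one_lt_p p) (Nat.succ_ne_zero i)
    have h2 : (p : ℝ) ^ (i + 1) ≤ (p : ℝ) ^ d := pow_le_pow_right₀ (one_lt_p p).le (by omega)
    have h3 : (p : ℝ) ^ d = (p : ℝ) ^ (d - 1 - i) * (p : ℝ) ^ (i + 1) := by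
      rw [← pow_add]; congr 1; omega
    rw [abs_mul, abs_inv, abs_of_neg (sub_neg.2 h1), abs_of_nonneg (sub_nonneg.2 h2), neg_sub,
      one_sub_div (by positivity), inv_div, div_mul_eq_mul_div, inv_mul_eq_div, mul_comm _ ((p : ℝ) ^ (d - 1 - i)), ← h3]
    exact div_le_div_of_nonneg_right (by linarith [pow_pos hp0 (i + 1)]) (by linarith)
  refine (Finset.prod_le_prod (fun i _ => abs_nonneg _) key).trans ?_
  rw [Finset.prod_mul_distrib, Finset.prod_inv_distrib, Finset.prod_pow_eq_pow_sum]
  have h4 : ∑ i ∈ Finset.range R, (d - 1 - i) ≤ tri d := by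
    rw [tri, ← Finset.sum_range_reflect (fun j => j) d]
    exact Finset.sum_le_sum_of_subset_of_nonneg (Finset.range_mono h.le) fun _ _ _ => Nat.zero_le _
  exact mul_le_mul (inv_anti₀ hc (c₀_le_prod p R)) (pow_le_pow_right₀ (one_lt_p p).le h4)
    (by positivity) (by positivity)

theorem injective_of_prk_ker {G A : Type*} [AddCommGroup G] [Module ℤ_[p] G] [Finite G]
    [AddCommGroup A] [Module ℤ_[p] A] {f : G →ₗ[ℤ_[p]] A} (h : prk p (LinearMap.ker f) = 0) :
    Function.Injective f := by
  have h1 := card_quotient_eq_pow_prk (p := p) (LinearMap.ker f)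
  rw [h, pow_zero, Nat.card_eq_one_iff_unique] at h1
  have h2 : pRange p (LinearMap.ker f) = ⊤ := Submodule.Quotient.subsingleton_iff.1 h1.1
  have h3 : (⊥ : Submodule ℤ_[p] (LinearMap.ker f)) = ⊤ :=
    eq_top_of_sup_pRange _ (by rw [h2, bot_sup_eq])
  intro x y hxy
  have h4 : (⟨x - y, by rw [LinearMap.mem_ker, map_sub, hxy, sub_self]⟩ : LinearMap.ker f) ∈
      (⊥ : Submodule ℤ_[p] (LinearMap.ker f)) := by rw [h3]; exact Submodule.mem_top
  exact sub_eq_zero.1 (congrArg Subtype.val h4)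

/-- A square integrable measure is determined by its moments. -/
theorem eq_zero_of_moments_eq_zero {𝕜 : Type*} [RCLike 𝕜] {ν : X₀ p → 𝕜}
    (hν : Summable fun G => ‖ν G‖ ^ 2 * G.cardAut)
    (h0 : ∀ B : X₀ p, ∑' G, ν G * ((surCard p G.rep.carrier B.rep.carrier : ℝ) : 𝕜) = 0)
    (A : X₀ p) : ν A = 0 := by
  classical
  have hp0 := p_pos p
  have hc := c₀_pos p
  -- Vanishing moments extend linearly to the whole moment span; each series converges absolutely by
  -- Cauchy-Schwarz.
  have hspan : ∀ φ ∈ momentSpan p, HasSum (fun G => ν G * ((φ G : ℝ) : 𝕜)) 0 := by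
    intro φ hφ
    induction hφ using Submodule.span_induction with
    | mem φ h =>
      obtain ⟨B, rfl⟩ := h
      have h1 : Summable fun G => ν G * ((surCard p G.rep.carrier B.rep.carrier : ℝ) : 𝕜) := by
        refine Summable.of_norm ?_
        simpa using summable_norm_mul_of_sq hν (summable_surCard_sq B) fun G => by positivity
      have h2 := h1.hasSum
      rwa [h0] at h2
    | zero => simp
    | add φ ψ _ _ h1 h2 => simpa [mul_add] using h1.add h2
    | smul a φ _ h1 =>
      have := h1.mul_left (a : 𝕜)
      rw [mul_zero] at this
      refine (congrArg (fun f => HasSum f 0) (funext fun G => ?_)).mp this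
      simp only [Pi.smul_apply, smul_eq_mul, RCLike.ofReal_mul]
      ring
  let Sur : X₀ p → Type := fun G =>
    {f : G.rep.carrier →ₗ[ℤ_[p]] A.rep.carrier // Function.Surjective f}
  have hft : ∀ G, Fintype (Sur G) := fun G => Fintype.ofFinite _
  have hft2 : ∀ G : X₀ p, Fintype (G.rep.carrier →ₗ[ℤ_[p]] A.rep.carrier) := fun G =>
    Fintype.ofFinite _
  let dk : ∀ G, Sur G → ℕ := fun G f => prk p (LinearMap.ker f.1)
  let F : ℕ → X₀ p → ℝ := fun R G => ∑ f : Sur G, (sepPoly p R).eval ((p : ℝ) ^ dk G f)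
  let g : X₀ p → ℝ := fun G => ∑ f : Sur G, if dk G f = 0 then 1 else 0
  let W : X₀ p → ℝ := fun G => ∑ f : G.rep.carrier →ₗ[ℤ_[p]] A.rep.carrier,
    (p : ℝ) ^ tri (prk p (LinearMap.ker f))
  have hF : ∀ R, HasSum (fun G => ν G * ((F R G : ℝ) : 𝕜)) 0 := fun R => by
    refine hspan (F R) ?_
    convert sum_eval_prk_ker_mem_momentSpan A.rep.carrier (sepPoly p R) using 1
    funext G
    rw [finsum_eq_sum_of_fintype]
  have hW : Summable fun G => ‖ν G‖ * W G := by
    refine summable_norm_mul_of_sq hν ?_ fun G => by positivity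
    convert summable_sum_pow_tri (p := p) A.rep.carrier using 2 with G
    rw [finsum_eq_sum_of_fintype]
  have hbound : ∀ R G, ‖ν G * ((F R G : ℝ) : 𝕜)‖ ≤ (c₀ p)⁻¹ * (‖ν G‖ * W G) := fun R G => by
    have h1 : |F R G| ≤ (c₀ p)⁻¹ * W G := by
      calc |F R G| ≤ ∑ f : Sur G, |(sepPoly p R).eval ((p : ℝ) ^ dk G f)| :=
            Finset.abs_sum_le_sum_abs _ _
        _ ≤ ∑ f : Sur G, (c₀ p)⁻¹ * (p : ℝ) ^ tri (dk G f) :=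
            Finset.sum_le_sum fun f _ => abs_eval_sepPoly_le R _
        _ = (c₀ p)⁻¹ * ∑ f : Sur G, (p : ℝ) ^ tri (dk G f) := by rw [Finset.mul_sum]
        _ ≤ (c₀ p)⁻¹ * W G := by
            refine mul_le_mul_of_nonneg_left ?_ (by positivity)
            have h3 : ∑ f : Sur G, (p : ℝ) ^ tri (dk G f) =
                ∑ f ∈ Finset.univ.filter (fun f : G.rep.carrier →ₗ[ℤ_[p]] A.rep.carrier =>
                  Function.Surjective f), (p : ℝ) ^ tri (prk p (LinearMap.ker f)) :=
              (Finset.sum_subtype (p := fun f : G.rep.carrier →ₗ[ℤ_[p]] A.rep.carrier =>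
                Function.Surjective f) _
                (fun f => by rw [Finset.mem_filter]; exact and_iff_right (Finset.mem_univ f))
                fun f => (p : ℝ) ^ tri (prk p (LinearMap.ker f))).symm
            rw [h3]
            exact Finset.sum_le_sum_of_subset_of_nonneg (Finset.filter_subset _ _)
              fun _ _ _ => by positivity
    rw [norm_mul, RCLike.norm_ofReal]
    calc ‖ν G‖ * |F R G| ≤ ‖ν G‖ * ((c₀ p)⁻¹ * W G) :=
          mul_le_mul_of_nonneg_left h1 (norm_nonneg _)
      _ = _ := by ring
  have hlim : ∀ G, Tendsto (fun R => ν G * ((F R G : ℝ) : 𝕜)) atTop (𝓝 (ν G * ((g G : ℝ) : 𝕜))) := by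
    intro G
    refine tendsto_const_nhds.congr' ?_
    -- There are finitely many surjections `G → A`; once `R` exceeds the ranks of their kernels, `F
    -- R G` counts those with kernel of rank zero.
    have h1 : ∀ᶠ R in atTop, ∀ f : Sur G, dk G f ≤ R :=
      eventually_all.2 fun f => eventually_ge_atTop _
    filter_upwards [h1] with R hR
    have h2 : F R G = g G := Finset.sum_congr rfl fun f _ => by
      split_ifs with h
      · rw [h, eval_sepPoly_zero]
      · exact eval_sepPoly_of_le h (hR f)
    rw [h2]
  have ht := tendsto_tsum_of_dominated_convergence (hW.mul_left (c₀ p)⁻¹) hlim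
    (Eventually.of_forall fun R G => hbound R G)
  simp_rw [fun R => (hF R).tsum_eq] at ht
  have hz : ∑' G, ν G * ((g G : ℝ) : 𝕜) = 0 := tendsto_nhds_unique ht tendsto_const_nhds
  rw [tsum_eq_single A fun G hG => ?_] at hz
  · refine (mul_eq_zero.1 hz).resolve_right ?_
    have h1 : 0 < g A := by
      refine Finset.sum_pos' (fun f _ => by positivity) ⟨⟨LinearMap.id, Function.surjective_id⟩,
        Finset.mem_univ _, ?_⟩
      have h2 : dk A ⟨LinearMap.id, Function.surjective_id⟩ = 0 := by
        simp only [dk, prk]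
        rw [Nat.log_eq_zero_iff]
        left
        refine lt_of_le_of_lt (b := 1) ?_ (Fact.out : p.Prime).one_lt
        have h3 : Subsingleton (LinearMap.ker (LinearMap.id : A.rep.carrier →ₗ[ℤ_[p]] A.rep.carrier)) := by
          rw [LinearMap.ker_id]; infer_instance
        have h4 := Nat.card_le_card_of_surjective _ (Submodule.mkQ_surjective
          (pRange p (LinearMap.ker (LinearMap.id : A.rep.carrier →ₗ[ℤ_[p]] A.rep.carrier))))
        exact h4.trans (Finite.card_le_one_iff_subsingleton.2 h3)
      rw [if_pos h2]
      exact one_pos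
    exact_mod_cast h1.ne'
  -- A surjection with kernel of rank zero is an isomorphism, so `g` is supported at `A`.
  · have h1 : g G = 0 := Finset.sum_eq_zero fun f _ => if_neg fun h => hG ?_
    · rw [h1]; simp
    · rw [← cls_rep G, cls_eq_iff]
      exact ⟨LinearEquiv.ofBijective f.1 ⟨injective_of_prk_ker h, f.2⟩⟩

end CohenLenstra
end
noncomputable section

namespace CohenLenstra

open Module Filter Topology MeasureTheory

variable {p : ℕ} [Fact p.Prime] {𝕜 : Type} [RCLike 𝕜]

/-! ### The Hilbert space `L²(X₀, μ₀)*` in coordinates -/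

theorem μ₀_pos (G : X₀ p) : 0 < μ₀ G := div_pos (c₀_pos p) (cardAut_pos G)

instance discreteMeasurableSpace_X₀ : DiscreteMeasurableSpace (X₀ p) := ⟨fun _ => trivial⟩

/-- Every point has positive mass, so almost everywhere means everywhere and the point values of an
`Lp` class are well defined. -/
theorem ae_invWeight_iff {P : X₀ p → Prop} : (∀ᵐ G ∂(invWeight p), P G) ↔ ∀ G, P G := by
  rw [invWeight, Measure.ae_sum_iff]
  refine forall_congr' fun G => ?_
  have h : ENNReal.ofReal (1 / μ₀ G) ≠ 0 := by
    rw [Ne, ENNReal.ofReal_eq_zero, not_le]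
    exact one_div_pos.2 (μ₀_pos G)
  rw [Measure.ae_ennreal_smul_measure_iff h, ae_dirac_eq]
  rfl

theorem L2Star_ext {ν ν' : L2Star p 𝕜} (h : ∀ G, ν G = ν' G) : ν = ν' :=
  Lp.ext (ae_invWeight_iff.2 h)

theorem add_apply (ν ν' : L2Star p 𝕜) (G : X₀ p) : (ν + ν') G = ν G + ν' G :=
  ae_invWeight_iff.1 (Lp.coeFn_add ν ν') G

theorem smul_apply (c : 𝕜) (ν : L2Star p 𝕜) (G : X₀ p) : (c • ν) G = c * ν G :=
  ae_invWeight_iff.1 (Lp.coeFn_smul c ν) G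

theorem memLp_of_summable {f : X₀ p → 𝕜} (h : Summable fun G => ‖f G‖ ^ 2 / μ₀ G) :
    MemLp f 2 (invWeight p) := by
  rw [memLp_two_iff_integrable_sq_norm AEStronglyMeasurable.of_discrete]
  refine ⟨AEStronglyMeasurable.of_discrete, ?_⟩
  rw [HasFiniteIntegral, invWeight, lintegral_sum_measure]
  have h1 : ∀ G : X₀ p, ∫⁻ a, ‖‖f a‖ ^ 2‖ₑ ∂(ENNReal.ofReal (1 / μ₀ G) • Measure.dirac G) =
      ENNReal.ofReal (‖f G‖ ^ 2 / μ₀ G) := fun G => by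
    have h2 := μ₀_pos G
    rw [lintegral_smul_measure, lintegral_dirac, smul_eq_mul,
      Real.enorm_eq_ofReal (by positivity), ← ENNReal.ofReal_mul (by positivity)]
    congr 1
    field_simp
  simp_rw [h1]
  exact (h.tsum_ofReal_ne_top).lt_top

/-- The element of `L²(X₀, μ₀)*` with given point masses. -/
def ofSummable (f : X₀ p → 𝕜) (h : Summable fun G => ‖f G‖ ^ 2 / μ₀ G) : L2Star p 𝕜 :=
  (memLp_of_summable h).toLp f

theorem ofSummable_apply (f : X₀ p → 𝕜) (h : Summable fun G => ‖f G‖ ^ 2 / μ₀ G) (G : X₀ p) :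
    ofSummable f h G = f G :=
  ae_invWeight_iff.1 (MemLp.coeFn_toLp (memLp_of_summable h)) G

theorem hasSum_inner_L2Star (ν ν' : L2Star p 𝕜) :
    HasSum (fun G => (starRingEnd 𝕜) (ν G) * ν' G / (μ₀ G : 𝕜)) (inner 𝕜 ν ν') := by
  have h1 : Integrable (fun a => inner 𝕜 (ν a) (ν' a)) (invWeight p) := L2.integrable_inner ν ν'
  have h2 := hasSum_integral_measure h1
  rw [L2.inner_def]
  refine (congrArg (fun f => HasSum f _) (funext fun G => ?_)).mp h2
  have h3 := μ₀_pos G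
  rw [integral_smul_measure, integral_dirac, ENNReal.toReal_ofReal (by positivity),
    RCLike.inner_apply, RCLike.real_smul_eq_coe_mul]
  push_cast
  field_simp

theorem hasSum_norm_sq_L2Star (ν : L2Star p 𝕜) :
    HasSum (fun G => ‖ν G‖ ^ 2 / μ₀ G) (‖ν‖ ^ 2) := by
  have h := hasSum_inner_L2Star ν ν
  have h2 := (RCLike.hasSum_re 𝕜 h)
  rw [inner_self_eq_norm_sq] at h2
  convert h2 using 2 with G
  rw [RCLike.conj_mul, ← RCLike.ofReal_pow, ← RCLike.ofReal_div, RCLike.ofReal_re]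

/-- The point mass at `G`. -/
def pointMass (𝕜 : Type) [RCLike 𝕜] (G : X₀ p) : L2Star p 𝕜 := by
  classical
  exact ofSummable (fun G' => if G' = G then 1 else 0)
    (summable_of_ne_finset_zero (s := {G}) fun G' h => by simp [Finset.notMem_singleton.1 h])

theorem pointMass_self (G : X₀ p) : pointMass 𝕜 G G = 1 := by
  rw [pointMass, ofSummable_apply, if_pos rfl]

theorem pointMass_of_ne {G G' : X₀ p} (h : G' ≠ G) : pointMass 𝕜 G G' = 0 := by
  rw [pointMass, ofSummable_apply, if_neg h]

theorem inner_pointMass (G : X₀ p) (ν : L2Star p 𝕜) :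
    inner 𝕜 (pointMass 𝕜 G) ν = ν G / (μ₀ G : 𝕜) := by
  rw [← (hasSum_inner_L2Star (pointMass 𝕜 G) ν).tsum_eq, tsum_eq_single G fun G' h => by
    rw [pointMass_of_ne h]; simp, pointMass_self]
  simp

/-! ### Operators given by sub-Markov kernels -/

/-- A sub-Markov kernel from `X₀` to `Y`, such that the image of the measure `μ₀` is at most `m`. -/
structure IsKernel {Y : Type*} (k : X₀ p → Y → ℝ) (m : Y → ℝ) : Prop where
  nonneg : ∀ G y, 0 ≤ k G y
  pos : ∀ y, 0 < m y
  row : ∀ G (s : Finset Y), ∑ y ∈ s, k G y ≤ 1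
  col : ∀ y (s : Finset (X₀ p)), ∑ G ∈ s, μ₀ G * k G y ≤ m y

namespace IsKernel

variable {Y : Type*} {k : X₀ p → Y → ℝ} {m : Y → ℝ}

theorem le_one (hk : IsKernel k m) (G : X₀ p) (y : Y) : k G y ≤ 1 := by
  simpa using hk.row G {y}

theorem summable_sq (hk : IsKernel k m) (ν : L2Star p 𝕜) (y : Y) :
    Summable fun G => ‖ν G‖ ^ 2 / μ₀ G * k G y := by
  refine Summable.of_nonneg_of_le (fun G => ?_) (fun G => ?_) (hasSum_norm_sq_L2Star ν).summable
  · have := μ₀_pos G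
    have := hk.nonneg G y
    positivity
  · have := μ₀_pos G
    exact mul_le_of_le_one_right (by positivity) (hk.le_one G y)

/-- Cauchy-Schwarz for `|ν| k = √(μ₀ k) · |ν| √(k/μ₀)`; the column bound controls the first factor.
-/
theorem sum_norm_sq_le (hk : IsKernel k m) (ν : L2Star p 𝕜) (y : Y) (s : Finset (X₀ p)) :
    (∑ G ∈ s, ‖ν G * (k G y : 𝕜)‖) ^ 2 ≤ m y * ∑' G, ‖ν G‖ ^ 2 / μ₀ G * k G y := by
  have h1 : ∀ G, 0 ≤ ‖ν G‖ ^ 2 / μ₀ G * k G y := fun G => by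
    have := μ₀_pos G
    have := hk.nonneg G y
    positivity
  refine (Finset.sum_sq_le_sum_mul_sum_of_sq_le_mul s (f := fun G => μ₀ G * k G y)
    (g := fun G => ‖ν G‖ ^ 2 / μ₀ G * k G y)
    (fun G _ => mul_nonneg (μ₀_pos G).le (hk.nonneg G y)) (fun G _ => h1 G) fun G _ => ?_).trans ?_
  · have := μ₀_pos G
    rw [norm_mul, RCLike.norm_ofReal, abs_of_nonneg (hk.nonneg G y)]
    refine le_of_eq ?_
    field_simp
  · exact mul_le_mul (hk.col y s) ((hk.summable_sq ν y).sum_le_tsum s fun _ _ => h1 _)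
      (Finset.sum_nonneg fun G _ => h1 G) (hk.pos y).le

theorem summable_norm (hk : IsKernel k m) (ν : L2Star p 𝕜) (y : Y) :
    Summable fun G => ‖ν G * (k G y : 𝕜)‖ :=
  summable_of_sum_le (fun _ => norm_nonneg _) fun s =>
    Real.le_sqrt_of_sq_le (hk.sum_norm_sq_le ν y s)

theorem summable (hk : IsKernel k m) (ν : L2Star p 𝕜) (y : Y) :
    Summable fun G => ν G * (k G y : 𝕜) := (hk.summable_norm ν y).of_norm

theorem norm_tsum_sq_le (hk : IsKernel k m) (ν : L2Star p 𝕜) (y : Y) :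
    ‖(∑' G, ν G * (k G y : 𝕜)) / (√(m y) : 𝕜)‖ ^ 2 ≤ ∑' G, ‖ν G‖ ^ 2 / μ₀ G * k G y := by
  have hm := hk.pos y
  rw [norm_div, RCLike.norm_ofReal, abs_of_nonneg (Real.sqrt_nonneg _), div_pow,
    Real.sq_sqrt hm.le, div_le_iff₀' hm]
  have h1 : ‖∑' G, ν G * (k G y : 𝕜)‖ ≤ √(m y * ∑' G, ‖ν G‖ ^ 2 / μ₀ G * k G y) :=
    (norm_tsum_le_tsum_norm (hk.summable_norm ν y)).trans
      ((hk.summable_norm ν y).tsum_le_of_sum_le fun s =>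
        Real.le_sqrt_of_sq_le (hk.sum_norm_sq_le ν y s))
  have h2 : 0 ≤ m y * ∑' G, ‖ν G‖ ^ 2 / μ₀ G * k G y :=
    (sq_nonneg _).trans (hk.sum_norm_sq_le ν y ∅)
  exact (Real.le_sqrt (norm_nonneg _) h2).1 h1

/-- Summing the pointwise bound over `y` and using that the rows have mass at most `1` shows that
the operator is a contraction. -/
theorem sum_norm_tsum_sq_le (hk : IsKernel k m) (ν : L2Star p 𝕜) (s : Finset Y) :
    ∑ y ∈ s, ‖(∑' G, ν G * (k G y : 𝕜)) / (√(m y) : 𝕜)‖ ^ 2 ≤ ‖ν‖ ^ 2 := by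
  refine (Finset.sum_le_sum fun y _ => hk.norm_tsum_sq_le ν y).trans ?_
  rw [← Summable.tsum_finsetSum fun y _ => hk.summable_sq ν y, ← (hasSum_norm_sq_L2Star ν).tsum_eq]
  refine Summable.tsum_le_tsum (fun G => ?_) (summable_sum fun y _ => hk.summable_sq ν y)
    (hasSum_norm_sq_L2Star ν).summable
  have := μ₀_pos G
  rw [← Finset.mul_sum]
  exact mul_le_of_le_one_right (by positivity) (hk.row G s)

/-- The operator `L²(X₀, μ₀)* → ℓ²(Y)` of a kernel. -/
def op (𝕜 : Type) [RCLike 𝕜] (hk : IsKernel k m) : L2Star p 𝕜 →L[𝕜] lp (fun _ : Y => 𝕜) 2 :=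
  LinearMap.mkContinuous
    -- Division by `√(m y)` identifies the square integrable measures on `Y` with the unweighted
    -- `ℓ²(Y)`.
    { toFun := fun ν => ⟨fun y => (∑' G, ν G * (k G y : 𝕜)) / (√(m y) : 𝕜),
        memℓp_gen' (C := ‖ν‖ ^ 2) fun s => by simpa using hk.sum_norm_tsum_sq_le ν s⟩
      map_add' := fun ν ν' => by
        ext y
        simp only [lp.coeFn_add, Pi.add_apply]
        rw [← add_div, ← (hk.summable ν y).tsum_add (hk.summable ν' y)]
        simp_rw [add_apply, add_mul]
      map_smul' := fun c ν => by
        ext y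
        simp only [lp.coeFn_smul, Pi.smul_apply, RingHom.id_apply, smul_eq_mul]
        rw [← mul_div_assoc, ← tsum_mul_left]
        simp_rw [smul_apply, mul_assoc] } 1 fun ν => by
    rw [one_mul]
    refine lp.norm_le_of_forall_sum_le (by norm_num) (norm_nonneg _) fun s => ?_
    simpa using hk.sum_norm_tsum_sq_le ν s

theorem op_apply (hk : IsKernel k m) (ν : L2Star p 𝕜) (y : Y) :
    hk.op 𝕜 ν y = (∑' G, ν G * (k G y : 𝕜)) / (√(m y) : 𝕜) := rfl

/-- The operator composed with its adjoint. -/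
def sqOp (𝕜 : Type) [RCLike 𝕜] (hk : IsKernel k m) : L2Star p 𝕜 →L[𝕜] L2Star p 𝕜 :=
  ContinuousLinearMap.adjoint (hk.op 𝕜) ∘L hk.op 𝕜

theorem isSelfAdjoint_sqOp (hk : IsKernel k m) : IsSelfAdjoint (hk.sqOp 𝕜) := by
  rw [IsSelfAdjoint, ContinuousLinearMap.star_eq_adjoint, sqOp,
    ContinuousLinearMap.adjoint_comp, ContinuousLinearMap.adjoint_adjoint]

/-- Pairing with the point mass at `G` evaluates the operator there. The second step of the
composite has the time-reversed kernel `μ₀ G * k G y / m y`. -/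
theorem hasSum_sqOp (hk : IsKernel k m) (ν : L2Star p 𝕜) (G : X₀ p) :
    HasSum (fun y => (∑' G', ν G' * (k G' y : 𝕜)) * ((μ₀ G * k G y / m y : ℝ) : 𝕜))
      (hk.sqOp 𝕜 ν G) := by
  have h1 : hk.sqOp 𝕜 ν G = (μ₀ G : 𝕜) * inner 𝕜 (hk.op 𝕜 (pointMass 𝕜 G)) (hk.op 𝕜 ν) := by
    have h2 := inner_pointMass G (hk.sqOp 𝕜 ν)
    rw [sqOp, ContinuousLinearMap.comp_apply, ContinuousLinearMap.adjoint_inner_right] at h2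
    have h3 : (μ₀ G : 𝕜) ≠ 0 := RCLike.ofReal_ne_zero.2 (μ₀_pos G).ne'
    rw [h2, mul_div_cancel₀ _ h3]
    rfl
  rw [h1]
  refine (congrArg (fun f => HasSum f _) (funext fun y => ?_)).mp
    ((lp.hasSum_inner (hk.op 𝕜 (pointMass 𝕜 G)) (hk.op 𝕜 ν)).mul_left (μ₀ G : 𝕜))
  have hm : (0 : ℝ) < √(m y) := Real.sqrt_pos.2 (hk.pos y)
  have hm' : (√(m y) : 𝕜) ≠ 0 := RCLike.ofReal_ne_zero.2 hm.ne'
  have h4 : ∑' G', pointMass 𝕜 G G' * (k G' y : 𝕜) = (k G y : 𝕜) := by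
    rw [tsum_eq_single G fun G' h => by rw [pointMass_of_ne h, zero_mul], pointMass_self, one_mul]
  have h5 : (m y : 𝕜) = (√(m y) : 𝕜) * (√(m y) : 𝕜) := by
    rw [← RCLike.ofReal_mul, Real.mul_self_sqrt (hk.pos y).le]
  rw [RCLike.inner_apply, op_apply, op_apply, h4, map_div₀, RCLike.conj_ofReal, RCLike.conj_ofReal]
  rw [RCLike.ofReal_div, RCLike.ofReal_mul, h5]
  field_simp

end IsKernel

end CohenLenstra
end
noncomputable section

namespace CohenLenstra

open Module Filter Topology

/-! ### The spectrum of a triangular self-adjoint operator -/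

section Spectrum

variable {𝕜 : Type*} [RCLike 𝕜] {E : Type*} [NormedAddCommGroup E] [InnerProductSpace 𝕜 E]

/-- The bound on `A` gives injectivity and closed range, and the bound on the adjoint gives dense
range. -/
theorem isUnit_of_bound [CompleteSpace E] {A : E →L[𝕜] E} {δ : ℝ} (hδ : 0 < δ) (h : ∀ x, δ * ‖x‖ ≤ ‖A x‖)
    (h' : ∀ x, δ * ‖x‖ ≤ ‖ContinuousLinearMap.adjoint A x‖) : IsUnit A := by
  rw [ContinuousLinearMap.isUnit_iff_bijective]
  have ha : AntilipschitzWith (Real.toNNReal δ⁻¹) A := by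
    refine ContinuousLinearMap.antilipschitz_of_bound A fun x => ?_
    rw [Real.coe_toNNReal _ (inv_nonneg.2 hδ.le), le_inv_mul_iff₀ hδ]
    exact h x
  refine ⟨ha.injective, ?_⟩
  have hc : IsClosed (LinearMap.range A.toLinearMap : Set E) := ha.isClosed_range A.uniformContinuous
  have ho : (LinearMap.range A.toLinearMap)ᗮ = ⊥ := by
    rw [ContinuousLinearMap.orthogonal_range, LinearMap.ker_eq_bot']
    intro x hx
    have h1 := h' x
    have h2 : ContinuousLinearMap.adjoint A x = 0 := hx
    rw [h2, norm_zero] at h1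
    exact norm_le_zero_iff.1 (le_of_mul_le_mul_left (by simpa using h1) hδ)
  have ht := Submodule.topologicalClosure_eq_top_iff.2 ho
  rw [IsClosed.submodule_topologicalClosure_eq hc] at ht
  exact LinearMap.range_eq_top.1 ht

variable {D : E →L[𝕜] E} {c : ℕ → 𝕜}

/-- Eigenspaces of a self-adjoint operator are orthogonal, so Pythagoras gives the bound on finite
sums of eigenvectors. It persists on the closure of their span. -/
theorem bound_of_dense_eigenspaces [CompleteSpace E] (hD : IsSelfAdjoint D) (hc : Function.Injective c)
    (hdense : (⨆ n, End.eigenspace (D : E →ₗ[𝕜] E) (c n)).topologicalClosure = ⊤) {μ : 𝕜} {δ : ℝ}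
    (hδ : 0 ≤ δ) (hμ : ∀ n, δ ≤ ‖μ - c n‖) (x : E) : δ * ‖x‖ ≤ ‖μ • x - D x‖ := by
  have hsym := ContinuousLinearMap.isSelfAdjoint_iff_isSymmetric.1 hD
  have hOF := hsym.orthogonalFamily_eigenspaces.comp hc
  have hcl : IsClosed {x : E | δ * ‖x‖ ≤ ‖μ • x - D x‖} :=
    isClosed_le (by fun_prop) (by fun_prop)
  have hx : x ∈ closure ((⨆ n, End.eigenspace (D : E →ₗ[𝕜] E) (c n) : Submodule 𝕜 E) : Set E) := by
    rw [← Submodule.topologicalClosure_coe, hdense]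
    trivial
  refine closure_minimal ?_ hcl hx
  intro y hy
  obtain ⟨f, hf, rfl⟩ := (Submodule.mem_iSup_iff_exists_finsupp _ _).1 hy
  have hDf : ∀ n, D (f n) = c n • f n := fun n => End.mem_eigenspace_iff.1 (hf n)
  let l : ∀ n, End.eigenspace (D : E →ₗ[𝕜] E) (c n) := fun n => ⟨f n, hf n⟩
  let l' : ∀ n, End.eigenspace (D : E →ₗ[𝕜] E) (c n) := fun n => (μ - c n) • l n
  have h1 : ‖∑ n ∈ f.support, f n‖ ^ 2 = ∑ n ∈ f.support, ‖f n‖ ^ 2 := hOF.norm_sum l f.support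
  have h2 : ‖∑ n ∈ f.support, (μ - c n) • f n‖ ^ 2 = ∑ n ∈ f.support, ‖(μ - c n) • f n‖ ^ 2 :=
    hOF.norm_sum l' f.support
  change δ * ‖∑ n ∈ f.support, f n‖ ≤ ‖μ • ∑ n ∈ f.support, f n - D (∑ n ∈ f.support, f n)‖
  have h3 : μ • ∑ n ∈ f.support, f n - D (∑ n ∈ f.support, f n) =
      ∑ n ∈ f.support, (μ - c n) • f n := by
    rw [map_sum, Finset.smul_sum, ← Finset.sum_sub_distrib]
    exact Finset.sum_congr rfl fun n _ => by rw [hDf, sub_smul]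
  rw [h3]
  refine (sq_le_sq₀ (by positivity) (norm_nonneg _)).1 ?_
  rw [mul_pow, h1, h2, Finset.mul_sum]
  refine Finset.sum_le_sum fun n _ => ?_
  rw [norm_smul, mul_pow]
  exact mul_le_mul_of_nonneg_right (pow_le_pow_left₀ hδ (hμ n) 2) (sq_nonneg _)

variable {ι : Type*} {v : ι → E} {lev : ι → ℕ}

/-- The span of the vectors of level less than `m`. -/
def lowerSpan (𝕜 : Type*) [RCLike 𝕜] {E : Type*} [NormedAddCommGroup E] [InnerProductSpace 𝕜 E]
    {ι : Type*} (v : ι → E) (lev : ι → ℕ) (m : ℕ) : Submodule 𝕜 E :=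
  Submodule.span 𝕜 (v '' {j | lev j < m})

/-- The sum of the eigenspaces in the span of the vectors of level less than `m`. -/
def lowerEigen (D : E →L[𝕜] E) (c : ℕ → 𝕜) (v : ι → E) (lev : ι → ℕ) (m : ℕ) : Submodule 𝕜 E :=
  ⨆ k : Set.Iio m, (End.eigenspace (D : E →ₗ[𝕜] E) (c k) ⊓ lowerSpan 𝕜 v lev m)

theorem lowerSpan_mono {m n : ℕ} (h : m ≤ n) : lowerSpan 𝕜 v lev m ≤ lowerSpan 𝕜 v lev n :=
  Submodule.span_mono (Set.image_mono fun _ hj => lt_of_lt_of_le hj h)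

theorem lowerEigen_le (m : ℕ) : lowerEigen D c v lev m ≤ lowerSpan 𝕜 v lev m :=
  iSup_le fun _ => inf_le_right

theorem lowerEigen_le_iSup (m : ℕ) :
    lowerEigen D c v lev m ≤ ⨆ n, End.eigenspace (D : E →ₗ[𝕜] E) (c n) := by
  rw [lowerEigen]
  refine iSup_le fun k => le_trans inf_le_left ?_
  exact le_iSup (fun n => End.eigenspace (D : E →ₗ[𝕜] E) (c n)) k.1

/-- On the eigenspaces below level `m`, `D - c m` acts by the nonzero scalars `c k - c m`. -/
theorem exists_sub_smul_eq (hc : Function.Injective c) {m : ℕ} {u : E}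
    (hu : u ∈ lowerEigen D c v lev m) : ∃ y ∈ lowerEigen D c v lev m, D y - c m • y = u := by
  refine Submodule.iSup_induction _ (motive := fun u => ∃ y ∈ lowerEigen D c v lev m,
    D y - c m • y = u) hu (fun k x hx => ?_) ⟨0, zero_mem _, by simp⟩ ?_
  · have hne : c k - c m ≠ 0 := sub_ne_zero.2 fun h => (show (k : ℕ) < m from k.2).ne (hc h)
    have hDx : D x = c k • x := End.mem_eigenspace_iff.1 hx.1
    refine ⟨(c k - c m)⁻¹ • x, Submodule.smul_mem _ _ ?_, ?_⟩
    · exact Submodule.mem_iSup_of_mem (p := fun k : Set.Iio m =>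
        End.eigenspace (D : E →ₗ[𝕜] E) (c k) ⊓ lowerSpan 𝕜 v lev m) k hx
    · rw [map_smul, hDx, smul_comm (c m), ← smul_sub, ← sub_smul, smul_smul, inv_mul_cancel₀ hne,
        one_smul]
  · rintro x x' ⟨y, hy, rfl⟩ ⟨y', hy', rfl⟩
    exact ⟨y + y', add_mem hy hy', by rw [map_add, smul_add]; abel⟩

/-- An operator that is triangular with respect to `v` can be diagonalized on the span of `v`. -/
theorem lowerSpan_le_lowerEigen (hc : Function.Injective c)
    (htri : ∀ i, D (v i) - c (lev i) • v i ∈ lowerSpan 𝕜 v lev (lev i)) (m : ℕ) :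
    lowerSpan 𝕜 v lev m ≤ lowerEigen D c v lev m := by
  induction m with
  | zero =>
    rw [lowerSpan, show {j | lev j < 0} = ∅ by ext j; simp, Set.image_empty, Submodule.span_empty]
    exact bot_le
  | succ m ih =>
    have hmono : lowerEigen D c v lev m ≤ lowerEigen D c v lev (m + 1) :=
      iSup_le fun k => le_trans (inf_le_inf_left _ (lowerSpan_mono (Nat.le_succ m)))
        (le_iSup (fun k : Set.Iio (m + 1) => End.eigenspace (D : E →ₗ[𝕜] E) (c k) ⊓
          lowerSpan 𝕜 v lev (m + 1)) ⟨k.1, Nat.lt_succ_of_lt k.2⟩)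
    refine Submodule.span_le.2 ?_
    rintro _ ⟨j, hj, rfl⟩
    rcases Nat.lt_succ_iff_lt_or_eq.1 hj with h | h
    · exact hmono (ih (Submodule.subset_span ⟨j, h, rfl⟩))
    · have hu := ih (h ▸ htri j)
      -- Here `y` lies in the lower eigenspaces and has the same image as `v j` under `D - c m`, so
      -- `v j - y` is an eigenvector for `c m`.
      obtain ⟨y, hy, hyu⟩ := exists_sub_smul_eq hc hu
      have hw : v j - y ∈ lowerEigen D c v lev (m + 1) := by
        refine Submodule.mem_iSup_of_mem (p := fun k : Set.Iio (m + 1) =>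
          End.eigenspace (D : E →ₗ[𝕜] E) (c k) ⊓ lowerSpan 𝕜 v lev (m + 1))
          ⟨m, Nat.lt_succ_self m⟩ ⟨End.mem_eigenspace_iff.2 ?_, sub_mem
            (Submodule.subset_span ⟨j, hj, rfl⟩)
            (lowerSpan_mono (Nat.le_succ m) (lowerEigen_le m hy))⟩
        change D (v j - y) = c m • (v j - y)
        rw [map_sub, smul_sub, sub_eq_sub_iff_sub_eq_sub, hyu]
      have := add_mem hw (hmono hy)
      rwa [sub_add_cancel] at this

/-- The spectrum of a self-adjoint operator that is triangular with respect to a family of vectors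
with dense span. -/
theorem spectrum_eq_of_triangular [CompleteSpace E] (hD : IsSelfAdjoint D) (hc : Function.Injective c)
    (hc0 : Tendsto c atTop (𝓝 0)) (hreal : ∀ n, (starRingEnd 𝕜) (c n) = c n)
    (hlin : LinearIndependent 𝕜 v) (hdense : (Submodule.span 𝕜 (Set.range v)).topologicalClosure = ⊤)
    (hlev : Function.Surjective lev)
    (htri : ∀ i, D (v i) - c (lev i) • v i ∈ lowerSpan 𝕜 v lev (lev i)) :
    spectrum 𝕜 D = Set.range c ∪ {0} := by
  have hV := lowerSpan_le_lowerEigen hc htri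
  have hclosed : IsClosed (Set.range c ∪ {0}) := by
    have h : IsClosed (insert 0 (Set.range c)) := hc0.isCompact_insert_range.isClosed
    rwa [Set.insert_eq, Set.union_comm] at h
  have hle : Submodule.span 𝕜 (Set.range v) ≤ ⨆ n, End.eigenspace (D : E →ₗ[𝕜] E) (c n) := by
    refine Submodule.span_le.2 ?_
    rintro _ ⟨j, rfl⟩
    have h0 : v j ∈ lowerSpan 𝕜 v lev (lev j + 1) :=
      Submodule.subset_span ⟨j, Nat.lt_succ_self _, rfl⟩
    have h1 := hV (lev j + 1) h0
    exact lowerEigen_le_iSup _ h1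
  have hdense' : (⨆ n, End.eigenspace (D : E →ₗ[𝕜] E) (c n)).topologicalClosure = ⊤ :=
    top_le_iff.1 (hdense.ge.trans (Submodule.topologicalClosure_mono hle))
  refine Set.Subset.antisymm ?_ ?_
  · intro μ hμ
    by_contra hnot
    rw [spectrum.mem_iff] at hμ
    refine hμ ?_
    obtain ⟨δ, hδ, hball⟩ := Metric.isOpen_iff.1 hclosed.isOpen_compl μ hnot
    have hdist : ∀ n, δ ≤ ‖μ - c n‖ := fun n => by
      by_contra! h
      have hmem : c n ∈ Metric.ball μ δ := by
        rw [Metric.mem_ball, dist_comm, dist_eq_norm]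
        exact h
      exact hball hmem (Or.inl ⟨n, rfl⟩)
    -- The adjoint of `μ - D` is `conj μ - D`. As the `c n` are real, `conj μ` is as far from them
    -- as `μ`.
    have hdist' : ∀ n, δ ≤ ‖(starRingEnd 𝕜) μ - c n‖ := fun n => by
      rw [← hreal n, ← map_sub, RCLike.norm_conj]
      exact hdist n
    refine isUnit_of_bound hδ (fun x => ?_) fun x => ?_
    · exact bound_of_dense_eigenspaces hD hc hdense' hδ.le hdist x
    · have h1 := bound_of_dense_eigenspaces hD hc hdense' hδ.le hdist' x
      convert h1 using 2
      rw [Algebra.algebraMap_eq_smul_one, map_sub, ← ContinuousLinearMap.star_eq_adjoint,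
        ← ContinuousLinearMap.star_eq_adjoint, hD.star_eq, star_smul, star_one]
      rfl
  · have hsub : Set.range c ⊆ spectrum 𝕜 D := by
      rintro _ ⟨m, rfl⟩
      obtain ⟨i, rfl⟩ := hlev m
      obtain ⟨y, hy, hyu⟩ := exists_sub_smul_eq hc (hV _ (htri i))
      -- The correction `y` lies in the span of the vectors of lower level, and linear independence
      -- keeps `v i` out of it.
      have hne : v i - y ≠ 0 := fun h => by
        refine hlin.notMem_span_image (s := {j | lev j < lev i}) (x := i)
          (fun h => lt_irrefl (lev i) h) ?_
        rw [sub_eq_zero.1 h]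
        exact lowerEigen_le _ hy
      have hDw : D (v i - y) = c (lev i) • (v i - y) := by
        rw [map_sub, smul_sub, sub_eq_sub_iff_sub_eq_sub, hyu]
      rw [spectrum.mem_iff]
      intro hu
      have hb := ContinuousLinearMap.isUnit_iff_bijective.1 hu
      refine hne (hb.1 (a₁ := v i - y) (a₂ := 0) ?_)
      rw [map_zero]
      change c (lev i) • (v i - y) - D (v i - y) = 0
      rw [hDw, sub_self]
    refine Set.union_subset hsub (Set.singleton_subset_iff.2 ?_)
    -- The point `0` belongs to the spectrum as a limit of eigenvalues.
    exact (spectrum.isClosed D).mem_of_tendsto hc0 (Eventually.of_forall fun n => hsub ⟨n, rfl⟩)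

end Spectrum

end CohenLenstra
end
noncomputable section

namespace CohenLenstra

open Module Filter Topology

variable {p : ℕ} [Fact p.Prime] {𝕜 : Type} [RCLike 𝕜]

/-! ### The moments of a random extension and reversibility -/

/-- The isomorphism class of the extension of `G` given by a character. -/
def charMiddle {k : ℕ} (G : FinMod p) (χ : G.carrier →ₗ[ℤ_[p]] Cyc p k) : X₁ p :=
  Quotient.mk _ (charExtn G χ).toRankOneMod

theorem charMiddle_eq_iff {k : ℕ} (G : FinMod p) (χ : G.carrier →ₗ[ℤ_[p]] Cyc p k) (H : X₁ p) :
    charMiddle G χ = H ↔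
      Nonempty (fiberProd χ ≃ₗ[ℤ_[p]] H.rep.carrier) := by
  constructor
  · rintro rfl
    obtain ⟨e⟩ := Quotient.exact (Quotient.out_eq (charMiddle G χ))
    exact ⟨e.symm⟩
  · rintro ⟨e⟩
    rw [← Quotient.out_eq H]
    exact Quotient.sound ⟨e⟩

theorem hasSum_dStarProb_mul {k : ℕ} (G : X₀ p) (hG : ∀ x : G.rep.carrier, (p : ℤ_[p]) ^ k • x = 0)
    [Fintype (G.rep.carrier →ₗ[ℤ_[p]] Cyc p k)] (φ : X₁ p → ℝ) :
    HasSum (fun H => dStarProb G H * φ H)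
      ((∑ χ : G.rep.carrier →ₗ[ℤ_[p]] Cyc p k,
        φ (charMiddle G.rep χ)) / G.card) := by
  classical
  let m : (G.rep.carrier →ₗ[ℤ_[p]] Cyc p k) → X₁ p := charMiddle G.rep
  have h1 : ∀ H, dStarProb G H * φ H = ∑ χ, (if H = m χ then φ (m χ) else 0) / G.card := fun H => by
    have h2 : ∀ χ, (if H = m χ then φ (m χ) else 0) = if m χ = H then φ H else 0 := fun χ => by
      by_cases h : H = m χ
      · rw [if_pos h, if_pos h.symm, h]
      · rw [if_neg h, if_neg (Ne.symm h)]
    simp_rw [h2]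
    rw [← Finset.sum_div, ← Finset.sum_filter, Finset.sum_const, nsmul_eq_mul, dStarProb_eq G hG,
      Nat.card_eq_fintype_card, Fintype.card_subtype, div_mul_eq_mul_div]
    congr 4
    exact Finset.filter_congr fun χ _ => (charMiddle_eq_iff G.rep χ H).symm
  simp_rw [h1]
  rw [Finset.sum_div]
  refine hasSum_sum fun χ _ => ?_
  exact (hasSum_ite_eq (m χ) (φ (m χ))).div_const _

theorem dStarProb_nonneg (G : X₀ p) (H : X₁ p) : 0 ≤ dStarProb G H := by
  rw [dStarProb]; positivity

theorem exists_pow_smul_eq_zero (G : X₀ p) :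
    ∃ k, ∀ x : G.rep.carrier, (p : ℤ_[p]) ^ k • x = 0 := by
  obtain ⟨k, hk⟩ := exists_card_eq_pow p G.rep.carrier
  exact ⟨k, pow_smul_eq_zero_of_card hk le_rfl⟩

theorem hasSum_dStarProb (G : X₀ p) : HasSum (fun H => dStarProb G H) 1 := by
  obtain ⟨k, hk⟩ := exists_pow_smul_eq_zero G
  have := Fintype.ofFinite (G.rep.carrier →ₗ[ℤ_[p]] Cyc p k)
  have h := hasSum_dStarProb_mul G hk fun _ => 1
  rw [Finset.sum_const, Finset.card_univ, ← Nat.card_eq_fintype_card,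
    homCard_Cyc_eq_card _ hk, nsmul_one] at h
  change HasSum _ ((G.card : ℝ) / G.card) at h
  rw [div_self (card_pos G).ne'] at h
  simpa using h

theorem hasSum_dStarProb_mul_surCard (G : X₀ p) (B : Type) [AddCommGroup B] [Module ℤ_[p] B]
    [Finite B] [Fintype B] :
    HasSum (fun H : X₁ p => dStarProb G H * surCard p H.rep.carrier B)
      (∑ b : B, (surCard p G.rep.carrier (B ⧸ Submodule.span ℤ_[p] {b}) : ℝ)) := by
  obtain ⟨k, hk⟩ := exists_pow_smul_eq_zero G
  have := Fintype.ofFinite (G.rep.carrier →ₗ[ℤ_[p]] Cyc p k)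
  have h := hasSum_dStarProb_mul G hk fun H => (surCard p H.rep.carrier B : ℝ)
  have h1 : ∀ χ : G.rep.carrier →ₗ[ℤ_[p]] Cyc p k,
      surCard p (charMiddle G.rep χ).rep.carrier B =
        surCard p (fiberProd χ) B := fun χ => by
    obtain ⟨e⟩ := (charMiddle_eq_iff G.rep χ _).1 rfl
    exact (surCard_congr e (LinearEquiv.refl _ B)).symm
  have h2 := sum_surCard_fiberProd (B := B) hk
  have h3 : (∑ χ : G.rep.carrier →ₗ[ℤ_[p]] Cyc p k, (surCard p (fiberProd χ) B : ℝ)) =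
      G.card * ∑ b : B, (surCard p G.rep.carrier (B ⧸ Submodule.span ℤ_[p] {b}) : ℝ) := by
    exact_mod_cast h2
  simp_rw [h1] at h
  rw [h3, mul_div_cancel_left₀ _ (card_pos G).ne'] at h
  exact h

theorem surCard_punit (M : Type*) [AddCommGroup M] [Module ℤ_[p] M] :
    surCard p M (PUnit : Type) = 1 := by
  rw [surCard, Nat.card_eq_one_iff_unique]
  exact ⟨⟨fun f g => Subtype.ext (LinearMap.ext fun x => rfl)⟩, ⟨⟨0, fun x => ⟨0, rfl⟩⟩⟩⟩

/-- Every module has exactly one surjection to the trivial module, so this is the moment formula for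
`B = 0`. -/
theorem hasSum_dProb (H : X₁ p) : HasSum (fun G => dProb H G) 1 := by
  have h := hasSum_dProb_mul_surCard H PUnit
  simpa [surCard_punit] using h

theorem exists_reversible_measure (p : ℕ) [Fact p.Prime] : ∃ μ₁ : X₁ p → ℝ, (∀ H, 0 < μ₁ H) ∧
    ∀ G H, μ₀ G * dStarProb G H = μ₁ H * dProb H G := by
  obtain ⟨w, hw, h⟩ := exists_reversible p
  refine ⟨fun H => c₀ p * w H, fun H => mul_pos (c₀_pos p) (hw H), fun G H => ?_⟩
  rw [μ₀, div_eq_mul_inv, mul_assoc, h, mul_assoc]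

theorem isKernel_dStarProb {μ₁ : X₁ p → ℝ} (hpos : ∀ H, 0 < μ₁ H)
    (hrev : ∀ G H, μ₀ G * dStarProb G H = μ₁ H * dProb H G) : IsKernel dStarProb μ₁ where
  nonneg := dStarProb_nonneg
  pos := hpos
  row G s := sum_le_hasSum s (fun H _ => dStarProb_nonneg G H) (hasSum_dStarProb G)
  col H s := by
    simp_rw [hrev]
    rw [← Finset.mul_sum]
    exact mul_le_of_le_one_right (hpos H).le
      (sum_le_hasSum s (fun G _ => dProb_nonneg H G) (hasSum_dProb H))

/-! ### Levels -/

/-- The exponent `n` of the order `p^n` of `G`. -/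
def level (G : X₀ p) : ℕ := Nat.log p G.card

theorem card_eq_pow_level (G : X₀ p) : G.card = p ^ level G := by
  obtain ⟨k, hk⟩ := exists_card_eq_pow p G.rep.carrier
  rw [level, X₀.card, hk, Nat.log_pow (Fact.out : p.Prime).one_lt]

theorem level_lt_iff {G G' : X₀ p} : level G < level G' ↔ G.card < G'.card := by
  rw [card_eq_pow_level, card_eq_pow_level, Nat.pow_lt_pow_iff_right (Fact.out : p.Prime).one_lt]

theorem level_surjective (p : ℕ) [Fact p.Prime] : Function.Surjective (level (p := p)) := fun n =>
  ⟨cls p (Cyc p n), by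
    rw [level, card_cls, card_Cyc, Nat.log_pow (Fact.out : p.Prime).one_lt]⟩

/-- The eigenvalues `p^{-n}`. -/
def eigenval (p : ℕ) (𝕜 : Type) [RCLike 𝕜] (n : ℕ) : 𝕜 := ((p : 𝕜) ^ n)⁻¹

theorem eigenval_eq_ofReal (p n : ℕ) : eigenval p 𝕜 n = (((p : ℝ)⁻¹ ^ n : ℝ) : 𝕜) := by
  rw [eigenval]; push_cast; rw [inv_pow]

theorem eigenval_injective (p : ℕ) [Fact p.Prime] (𝕜 : Type) [RCLike 𝕜] :
    Function.Injective (eigenval p 𝕜) := fun m n h => by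
  rw [eigenval, eigenval, inv_inj] at h
  have h2 : p ^ m = p ^ n := by exact_mod_cast h
  exact Nat.pow_right_injective (Fact.out : p.Prime).two_le h2

theorem tendsto_eigenval (p : ℕ) [Fact p.Prime] (𝕜 : Type) [RCLike 𝕜] :
    Tendsto (eigenval p 𝕜) atTop (𝓝 0) := by
  have h := tendsto_pow_atTop_nhds_zero_of_lt_one (r := (p : ℝ)⁻¹)
    (inv_nonneg.2 (p_pos p).le) (inv_lt_one_of_one_lt₀ (one_lt_p p))
  have h2 := (RCLike.continuous_ofReal (K := 𝕜)).continuousAt.tendsto.comp h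
  rw [RCLike.ofReal_zero] at h2
  exact h2.congr fun n => (eigenval_eq_ofReal p n).symm

theorem eigenval_level (G : X₀ p) : eigenval p 𝕜 (level G) = (G.card : 𝕜)⁻¹ := by
  rw [eigenval, card_eq_pow_level G, Nat.cast_pow]

/-! ### Multiplication by `|G|⁻¹` -/

/-- The square root is there because `sqOp` applies the kernel twice. -/
theorem isKernel_diag (p : ℕ) [Fact p.Prime] [DecidableEq (X₀ p)] :
    IsKernel (fun G G' : X₀ p => if G = G' then (√(G.card : ℝ))⁻¹ else 0) μ₀ := by
  have h1 : ∀ G : X₀ p, (√(G.card : ℝ))⁻¹ ≤ 1 := fun G => by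
    refine inv_le_one_of_one_le₀ (Real.one_le_sqrt.2 ?_)
    have h2 := card_pos G
    exact_mod_cast Nat.one_le_iff_ne_zero.2 (by exact_mod_cast h2.ne')
  refine ⟨fun G G' => by positivity, μ₀_pos, fun G s => ?_, fun G' s => ?_⟩
  · rw [Finset.sum_ite_eq]
    split_ifs
    · exact h1 G
    · exact zero_le_one
  · simp_rw [mul_ite, mul_zero]
    rw [Finset.sum_ite_eq']
    split_ifs
    · exact mul_le_of_le_one_right (μ₀_pos G').le (h1 G')
    · exact (μ₀_pos G').le

theorem sqOp_diag_apply [DecidableEq (X₀ p)] (ν : L2Star p 𝕜) (G : X₀ p) :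
    (isKernel_diag p).sqOp 𝕜 ν G = (G.card : 𝕜)⁻¹ * ν G := by
  rw [← ((isKernel_diag p).hasSum_sqOp ν G).tsum_eq, tsum_eq_single G fun G' h => by
    rw [if_neg h.symm]; simp, tsum_eq_single G fun G' h => by rw [if_neg h]; simp, if_pos rfl]
  have h1 := μ₀_pos G
  have h2 : (√(G.card : ℝ))⁻¹ * (μ₀ G * (√(G.card : ℝ))⁻¹ / μ₀ G) = (G.card : ℝ)⁻¹ := by
    rw [mul_div_cancel_left₀ _ h1.ne', ← mul_inv, Real.mul_self_sqrt (Nat.cast_nonneg _)]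
  rw [mul_assoc, ← RCLike.ofReal_mul, h2, mul_comm]
  simp

theorem topologicalClosure_span_eq_top {ι : Type*} {v : ι → L2Star p 𝕜}
    (h : ∀ ν : L2Star p 𝕜, (∀ i, inner 𝕜 (v i) ν = 0) → ν = 0) :
    (Submodule.span 𝕜 (Set.range v)).topologicalClosure = ⊤ := by
  rw [Submodule.topologicalClosure_eq_top_iff, Submodule.eq_bot_iff]
  intro ν hν
  exact h ν fun i => (Submodule.mem_orthogonal _ _).1 hν _ (Submodule.subset_span ⟨i, rfl⟩)

theorem sum_apply {ι : Type*} (s : Finset ι) (f : ι → L2Star p 𝕜) (G : X₀ p) :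
    (∑ i ∈ s, f i) G = ∑ i ∈ s, f i G := by
  classical
  induction s using Finset.induction_on with
  | empty =>
    rw [Finset.sum_empty, Finset.sum_empty]
    exact ae_invWeight_iff.1 (MeasureTheory.Lp.coeFn_zero 𝕜 2 (invWeight p)) G
  | insert i s hi ih => rw [Finset.sum_insert hi, Finset.sum_insert hi, add_apply, ih]

theorem zero_apply (G : X₀ p) : (0 : L2Star p 𝕜) G = 0 :=
  ae_invWeight_iff.1 (MeasureTheory.Lp.coeFn_zero 𝕜 2 (invWeight p)) G

/-- On the point masses the operator is diagonal, a triangular operator with zero remainder. -/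
theorem spectrum_sqOp_diag [DecidableEq (X₀ p)] :
    spectrum 𝕜 ((isKernel_diag p).sqOp 𝕜) = Set.range (eigenval p 𝕜) ∪ {0} := by
  refine spectrum_eq_of_triangular (v := pointMass 𝕜) (lev := level)
    (isKernel_diag p).isSelfAdjoint_sqOp (eigenval_injective p 𝕜) (tendsto_eigenval p 𝕜)
    (fun n => by rw [eigenval_eq_ofReal, RCLike.conj_ofReal]) ?_ ?_ (level_surjective p) fun G => ?_
  · rw [linearIndependent_iff']
    intro s g hg G hG
    have h1 := congrArg (fun ν : L2Star p 𝕜 => ν G) hg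
    simp only [sum_apply, smul_apply, zero_apply] at h1
    rw [Finset.sum_eq_single G (fun G' _ h => by rw [pointMass_of_ne h.symm, mul_zero])
      (fun h => absurd hG h), pointMass_self, mul_one] at h1
    exact h1
  · refine topologicalClosure_span_eq_top fun ν hν => L2Star_ext fun G => ?_
    have h1 := hν G
    rw [inner_pointMass, div_eq_zero_iff] at h1
    rw [zero_apply]
    exact h1.resolve_right (RCLike.ofReal_ne_zero.2 (μ₀_pos G).ne')
  · have h1 : (isKernel_diag p).sqOp 𝕜 (pointMass 𝕜 G) - eigenval p 𝕜 (level G) • pointMass 𝕜 G =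
        0 := by
      rw [sub_eq_zero]
      refine L2Star_ext fun G' => ?_
      rw [sqOp_diag_apply, smul_apply, eigenval_level]
      by_cases h : G' = G
      · rw [h]
      · rw [pointMass_of_ne h, mul_zero, mul_zero]
    rw [h1]
    exact zero_mem _

/-! ### The Cohen-Lenstra operator -/

/-- The measure with density `G ↦ #Sur(G, B)` with respect to `μ₀`. -/
def momentMeasure (𝕜 : Type) [RCLike 𝕜] (B : X₀ p) : L2Star p 𝕜 :=
  ofSummable (fun G => ((surCard p G.rep.carrier B.rep.carrier * μ₀ G : ℝ) : 𝕜)) (by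
    refine ((summable_surCard_sq B).mul_left (c₀ p)).congr fun G => ?_
    have h := μ₀_pos G
    rw [RCLike.norm_ofReal, sq_abs, mul_pow, sq (μ₀ G), ← mul_assoc, mul_div_cancel_right₀ _ h.ne',
      μ₀]
    ring)

theorem momentMeasure_apply (B G : X₀ p) : momentMeasure 𝕜 B G =
    ((surCard p G.rep.carrier B.rep.carrier * μ₀ G : ℝ) : 𝕜) := ofSummable_apply _ _ G

/-- By reversibility `d* m_B` has density `#Sur(H, B)/|B|` with respect to `μ₁`, the expected number
of surjections from a random quotient of `H`. Reversing once more, `d` averages this density over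
the random extensions of `G`. -/
theorem sqOp_momentMeasure {μ₁ : X₁ p → ℝ} (hpos : ∀ H, 0 < μ₁ H)
    (hrev : ∀ G H, μ₀ G * dStarProb G H = μ₁ H * dProb H G) (B : X₀ p) [Fintype B.rep.carrier] :
    (isKernel_dStarProb hpos hrev).sqOp 𝕜 (momentMeasure 𝕜 B) =
      (B.card : 𝕜)⁻¹ • ∑ b : B.rep.carrier,
        momentMeasure 𝕜 (cls p (B.rep.carrier ⧸ Submodule.span ℤ_[p] {b})) := by
  refine L2Star_ext fun G => ?_
  refine ((isKernel_dStarProb hpos hrev).hasSum_sqOp (momentMeasure 𝕜 B) G).unique ?_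
  have h1 : ∀ H : X₁ p, ∑' G', momentMeasure 𝕜 B G' * (dStarProb G' H : 𝕜) =
      ((μ₁ H * (surCard p H.rep.carrier B.rep.carrier / B.card) : ℝ) : 𝕜) := fun H => by
    have h2 := (hasSum_dProb_mul_surCard H B.rep.carrier).mul_left (μ₁ H)
    refine Eq.trans (tsum_congr fun G' => ?_) ((RCLike.hasSum_ofReal 𝕜).2 h2).tsum_eq
    rw [momentMeasure_apply, ← RCLike.ofReal_mul]
    congr 1
    rw [mul_assoc, hrev]
    ring
  have h3 := ((hasSum_dStarProb_mul_surCard G B.rep.carrier).mul_left (μ₀ G / B.card))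
  have h4 : (((B.card : 𝕜)⁻¹ • ∑ b : B.rep.carrier,
      momentMeasure 𝕜 (cls p (B.rep.carrier ⧸ Submodule.span ℤ_[p] {b})) : L2Star p 𝕜) : X₀ p → 𝕜) G =
      ((μ₀ G / B.card * ∑ b : B.rep.carrier, (surCard p G.rep.carrier
        (B.rep.carrier ⧸ Submodule.span ℤ_[p] {b}) : ℝ) : ℝ) : 𝕜) := by
    rw [smul_apply, sum_apply]
    simp_rw [momentMeasure_apply]
    have h5 : ∀ b : B.rep.carrier, surCard p G.rep.carrier
        (cls p (B.rep.carrier ⧸ Submodule.span ℤ_[p] {b})).rep.carrier =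
          surCard p G.rep.carrier (B.rep.carrier ⧸ Submodule.span ℤ_[p] {b}) := fun b =>
      surCard_congr (LinearEquiv.refl _ _) (nonempty_rep_cls _).some
    simp_rw [h5]
    rw [← RCLike.ofReal_sum, ← Finset.sum_mul, ← RCLike.ofReal_natCast (K := 𝕜),
      ← RCLike.ofReal_inv, ← RCLike.ofReal_mul]
    congr 1
    ring
  rw [h4]
  refine (congrArg (fun f => HasSum f _) (funext fun H => ?_)).mp ((RCLike.hasSum_ofReal 𝕜).2 h3)
  rw [h1, ← RCLike.ofReal_mul, hrev]
  congr 1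
  have h6 := hpos H
  rw [mul_div_cancel_left₀ _ h6.ne']
  calc μ₀ G / B.card * (dStarProb G H * surCard p H.rep.carrier B.rep.carrier)
      = (μ₀ G * dStarProb G H) * (surCard p H.rep.carrier B.rep.carrier / B.card) := by ring
    _ = _ := by rw [hrev]; ring

theorem cls_quotient_span_zero (B : X₀ p) :
    cls p (B.rep.carrier ⧸ Submodule.span ℤ_[p] {(0 : B.rep.carrier)}) = B := by
  rw [cls_eq_iff]
  exact ⟨Submodule.quotEquivOfEqBot _ (Submodule.span_singleton_eq_bot.2 rfl)⟩

theorem level_quotient_span_lt (B : X₀ p) {b : B.rep.carrier} (hb : b ≠ 0) :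
    level (cls p (B.rep.carrier ⧸ Submodule.span ℤ_[p] {b})) < level B := by
  rw [level_lt_iff, card_cls, X₀.card, (Submodule.span ℤ_[p] {b}).card_eq_card_quotient_mul_card]
  have h1 : 1 < Nat.card (Submodule.span ℤ_[p] {b}) := by
    rw [Finite.one_lt_card_iff_nontrivial, Submodule.nontrivial_iff_ne_bot, Ne,
      Submodule.span_singleton_eq_bot]
    exact hb
  have h2 : 0 < Nat.card (B.rep.carrier ⧸ Submodule.span ℤ_[p] {b}) := Nat.card_pos
  nlinarith

theorem eq_of_surCard_ne_zero {G B : X₀ p} (h : surCard p G.rep.carrier B.rep.carrier ≠ 0)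
    (hc : G.card ≤ B.card) : G = B := by
  obtain ⟨f, hf⟩ := (Nat.card_ne_zero.1 h).1
  have h1 : Nat.card G.rep.carrier = Nat.card B.rep.carrier :=
    le_antisymm hc (Nat.card_le_card_of_surjective f hf)
  have h2 := (Nat.bijective_iff_surjective_and_card f).2 ⟨hf, h1⟩
  rw [← cls_rep G, cls_eq_iff]
  exact ⟨LinearEquiv.ofBijective f h2⟩

theorem surCard_self_ne_zero (G : X₀ p) : surCard p G.rep.carrier G.rep.carrier ≠ 0 :=
  Nat.card_ne_zero.2 ⟨⟨⟨LinearMap.id, Function.surjective_id⟩⟩, inferInstance⟩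

/-- In a vanishing combination evaluate at a group `B` of least order among those with nonzero
coefficient: it surjects onto no other group that occurs. -/
theorem linearIndependent_momentMeasure (p : ℕ) [Fact p.Prime] (𝕜 : Type) [RCLike 𝕜] :
    LinearIndependent 𝕜 (momentMeasure (p := p) 𝕜) := by
  classical
  rw [linearIndependent_iff']
  intro s g hg
  by_contra! hne
  obtain ⟨B₀, hB₀, hgB₀⟩ := hne
  obtain ⟨B, hB, hmin⟩ := (s.filter fun B => g B ≠ 0).exists_min_image X₀.card
    ⟨B₀, Finset.mem_filter.2 ⟨hB₀, hgB₀⟩⟩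
  rw [Finset.mem_filter] at hB
  have h1 := congrArg (fun ν : L2Star p 𝕜 => ν B) hg
  simp only [sum_apply, smul_apply, zero_apply] at h1
  rw [Finset.sum_eq_single B (fun B' hB' hne => ?_) (fun h => absurd hB.1 h), mul_eq_zero] at h1
  · have h2 := h1.resolve_left hB.2
    rw [momentMeasure_apply, RCLike.ofReal_eq_zero, mul_eq_zero] at h2
    have h3 := h2.resolve_right (μ₀_pos B).ne'
    exact surCard_self_ne_zero B (by exact_mod_cast h3)
  · by_cases hg0 : g B' = 0
    · rw [hg0, zero_mul]
    · have h2 : surCard p B.rep.carrier B'.rep.carrier = 0 := by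
        by_contra h0
        exact hne (eq_of_surCard_ne_zero h0 (hmin B' (Finset.mem_filter.2 ⟨hB', hg0⟩))).symm
      rw [momentMeasure_apply, h2]
      simp

/-- The inner products with `momentMeasure` are the moments of `ν`, so the span is dense because
moments determine a square integrable measure. -/
theorem spectrum_sqOp_dStarProb {μ₁ : X₁ p → ℝ} (hpos : ∀ H, 0 < μ₁ H)
    (hrev : ∀ G H, μ₀ G * dStarProb G H = μ₁ H * dProb H G) :
    spectrum 𝕜 ((isKernel_dStarProb hpos hrev).sqOp 𝕜) = Set.range (eigenval p 𝕜) ∪ {0} := by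
  classical
  refine spectrum_eq_of_triangular (v := momentMeasure 𝕜) (lev := level)
    (isKernel_dStarProb hpos hrev).isSelfAdjoint_sqOp (eigenval_injective p 𝕜)
    (tendsto_eigenval p 𝕜) (fun n => by rw [eigenval_eq_ofReal, RCLike.conj_ofReal])
    (linearIndependent_momentMeasure p 𝕜) ?_ (level_surjective p) fun B => ?_
  · refine topologicalClosure_span_eq_top fun ν hν => L2Star_ext fun G => ?_
    rw [zero_apply]
    refine eq_zero_of_moments_eq_zero ?_ (fun B => ?_) G
    · refine ((hasSum_norm_sq_L2Star ν).summable.mul_left (c₀ p)).congr fun G => ?_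
      have h1 := (c₀_pos p).ne'
      have h2 := (cardAut_pos G).ne'
      rw [μ₀]
      field_simp
    · rw [← hν B, ← (hasSum_inner_L2Star (momentMeasure 𝕜 B) ν).tsum_eq]
      refine tsum_congr fun G => ?_
      have h1 : (μ₀ G : 𝕜) ≠ 0 := RCLike.ofReal_ne_zero.2 (μ₀_pos G).ne'
      rw [momentMeasure_apply, RCLike.conj_ofReal, RCLike.ofReal_mul]
      field_simp
  · have := Fintype.ofFinite B.rep.carrier
    -- The term `b = 0` is the diagonal one, with eigenvalue `|B|⁻¹`; every `b ≠ 0` gives a proper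
    -- quotient, of lower level.
    rw [sqOp_momentMeasure hpos hrev, eigenval_level, ← smul_sub,
      ← Finset.add_sum_erase _ _ (Finset.mem_univ (0 : B.rep.carrier)), cls_quotient_span_zero,
      add_sub_cancel_left]
    refine Submodule.smul_mem _ _ (Submodule.sum_mem _ fun b hb => ?_)
    exact Submodule.subset_span ⟨_, level_quotient_span_lt B (Finset.ne_of_mem_erase hb), rfl⟩

end CohenLenstra
end
open CohenLenstra in
theorem mainTheorem9 (p : ℕ) [Fact p.Prime] (𝕜 : Type) [RCLike 𝕜] :
    -- the series that define `Δ₀ ν = d (d* ν)` converge absolutely on `L²(X₀, μ₀)*`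
    (∀ ν : L2Star p 𝕜,
      (∀ H : X₁ p, Summable fun G : X₀ p => ν G * (dStarProb G H : 𝕜)) ∧
      (∀ G : X₀ p, Summable fun H : X₁ p => dStar (⇑ν) H * (dProb H G : 𝕜))) ∧
    -- `D` is `Δ₀` and `M` is multiplication by `|#G|⁻¹`, as bounded operators on `L²(X₀, μ₀)*`
    ∃ D M : L2Star p 𝕜 →L[𝕜] L2Star p 𝕜,
      (∀ (ν : L2Star p 𝕜) (G : X₀ p), D ν G = Δ₀ (⇑ν) G) ∧
      (∀ (ν : L2Star p 𝕜) (G : X₀ p), M ν G = ((G.card : 𝕜))⁻¹ * ν G) ∧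
      IsSelfAdjoint D ∧ IsSelfAdjoint M ∧
      spectrum 𝕜 D = spectrum 𝕜 M ∧
      spectrum 𝕜 M = {z : 𝕜 | ∃ n : ℕ, z = ((p : 𝕜) ^ n)⁻¹} ∪ {0} := by
  classical
  obtain ⟨μ₁, hpos, hrev⟩ := exists_reversible_measure p
  have hk := isKernel_dStarProb hpos hrev
  -- The time reversal of `d*` is `d`, so the abstract operator `sqOp` is given by the series of
  -- `Δ₀`.
  have hratio : ∀ (G : X₀ p) (H : X₁ p), μ₀ G * dStarProb G H / μ₁ H = dProb H G := fun G H => by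
    rw [hrev, mul_div_cancel_left₀ _ (hpos H).ne']
  have hD : ∀ (ν : L2Star p 𝕜) (G : X₀ p),
      HasSum (fun H : X₁ p => dStar (⇑ν) H * (dProb H G : 𝕜)) (hk.sqOp 𝕜 ν G) := fun ν G => by
    have h := hk.hasSum_sqOp ν G
    simp_rw [hratio] at h
    exact h
  have hspec : Set.range (eigenval p 𝕜) = {z : 𝕜 | ∃ n : ℕ, z = ((p : 𝕜) ^ n)⁻¹} := by
    ext z
    exact exists_congr fun n => eq_comm
  refine ⟨fun ν => ⟨fun H => hk.summable ν H, fun G => (hD ν G).summable⟩,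
    hk.sqOp 𝕜, (isKernel_diag p).sqOp 𝕜, fun ν G => (hD ν G).tsum_eq.symm, sqOp_diag_apply,
    hk.isSelfAdjoint_sqOp, (isKernel_diag p).isSelfAdjoint_sqOp, ?_, ?_⟩
  · rw [spectrum_sqOp_diag, spectrum_sqOp_dStarProb hpos hrev]
  · rw [spectrum_sqOp_diag, hspec]
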